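/- **Setting.** Let $M$ be a finite-dimensional smooth manifold (Hausdorff, second countable, without boundary), $m\ge 0$ an integer and $\omega\in\Omega^{m+1}(M)$ a closed form; $(M,\omega)$ is then called a pre-$m$-symplectic manifold. For an $n$-vector field $x_1\wedge\cdots\wedge x_n$ put $\iota_{x_1\cdots x_n}\alpha:=\iota_{x_1}\cdots\iota_{x_n}\alpha=\alpha(x_n,\dots,x_1,-)$, and extend linearly to $\mathfrak X^n(M)=\Gamma(M,\wedge^nTM)$. A pair $(x,\alpha)$ with $x\in\mathfrak X^{n}(M)$ and $\alpha\in\Omega^{m-n}(M)$ is a *Hamiltonian pair* if $\iota_x\omega=d\alpha$; then $\alpha$ is called a Hamiltonian form, and $\Omega^{m-n}_{\mathrm{ham}}(M)$ denotes the space of Hamiltonian forms of degree $m-n$. An *$L_\infty$-algebra* is a $\mathbb Z$-graded real vector space $L$ concentrated in positive degrees with graded symmetric maps $l_n\colon L^{\otimes n}\to L$ ($n\ge1$) of degree $-1$ such that for every $n\ge 1$ and all homogeneous $v_1,\dots,v_n$ $$\sum_{i+j=n+1}\ \sum_{\sigma\in Sh(i,n-i)}\epsilon(\sigma;v)\; l_j\big(l_i(v_{\sigma(1)},\dots,v_{\sigma(i)}),v_{\sigma(i+1)},\dots,v_{\sigma(n)}\big)=0,$$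 where $Sh(i,n-i)$ is the set of permutations that are increasing on $\{1,\dots,i\}$ and on $\{i+1,\dots,n\}$, and $\epsilon(\sigma;v)$ is the Koszul sign. For $i\ge1$ and $j\ge 0$ with $i+j\le m$ put $$\Xi_1^j(M):=\Omega^{m-1-j}_{\mathrm{ham}}(M),\qquad \Xi_i^j(M):=\Omega^{m-i-j}(M)\ \ (i\ge2),$$ put $\Xi_i^j(M):=0$ for all other $(i,j)$, and let $\Xi(M)$ be the direct sum of all $\Xi_i^j(M)$, graded by $\Xi_k(M)=\bigoplus_{i+j=k}\Xi_i^j(M)$. **Theorem.** 1. There is exactly one family of multilinear brackets $l_k$, $k\ge1$, on $\Xi(M)$ with the following properties. For $i\ge2$, $l_1$ maps $\Xi_i^j(M)$ to $\Xi_{i-1}^j(M)$ by $\alpha\mapsto-d\alpha$; $l_1$ is zero on every $\Xi_1^j(M)$. For $k\ge2$, all $\alpha_a\in\Xi_1^{j_a}(M)$ and all Hamiltonian pairs $(x_a,\alpha_a)$ with $x_a\in\mathfrak X^{j_a+1}(M)$, $$l_k(\alpha_1,\dots,\alpha_k)=\iota_{x_1\cdots x_k}\omega\in\Xi_{k-1}^{j_1+\cdots+j_k}(M),$$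 and for $k\ge2$ the bracket $l_k$ is zero if some argument lies in a $\Xi_i^j(M)$ with $i\ne1$. 2. With these brackets, $\Xi(M)$ is an $L_\infty$-algebra. 3. It contains Rogers' $L_\infty$-algebra as an $L_\infty$-subalgebra. Namely, let $R_1=\Omega^{m-1}_{\mathrm{ham}}(M)$ (zero if $m=0$), $R_n=\Omega^{m-n}(M)$ for $2\le n\le m$, and $R_n=0$ otherwise. There is exactly one family of multilinear brackets on $R=\bigoplus_nR_n$ with $l_1=-d$ on $R_n$ for $n\ge2$, $l_1=0$ on $R_1$, and, for $k\ge2$, $l_k(\alpha_1,\dots,\alpha_k)=\iota_{x_1\cdots x_k}\omega\in R_{k-1}$ for $\alpha_a\in R_1$ and Hamiltonian pairs $(x_a,\alpha_a)$, and $l_k=0$ if some argument has degree different from $1$. With these brackets $R$ is an $L_\infty$-algebra, and the inclusion $R\to\Xi(M)$ as the bottom row, $R_n=\Xi_n^0(M)$, is injective, of degree zero and commutes with all brackets. -/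

import Mathlib

open scoped Manifold ContDiff DirectSum

noncomputable section

namespace MultiSymp

/-! ### Linear algebra on one tangent space -/

section Fibre

variable (V : Type*) [AddCommGroup V] [Module ℝ V] [TopologicalSpace V]

/-- Exterior forms of all degrees on `V`: the component in degree `k` is an alternating
`k`-linear form. -/
abbrev FormFibre : Type _ := ∀ k : ℕ, V [⋀^Fin k]→L[ℝ] ℝ

variable {V}

/-- `α ↦ α(v, -)` for a form of degree `k + 1`. -/
def plugIn {k : ℕ} (v : V) (α : V [⋀^Fin (k + 1)]→L[ℝ] ℝ) : V [⋀^Fin k]→L[ℝ] ℝ :=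
  { α.toAlternatingMap.curryLeft v with
    cont := by
      change Continuous fun w : Fin k → V => α (Matrix.vecCons v w)
      exact α.cont.comp (Continuous.finCons continuous_const continuous_id) }

theorem plugIn_apply {k : ℕ} (v : V) (α : V [⋀^Fin (k + 1)]→L[ℝ] ℝ) (w : Fin k → V) :
    plugIn v α w = α (Matrix.vecCons v w) := rfl

variable (V) in
/-- The contraction operator `ι_v α = α(v, -)` of a vector `v`, on forms of all degrees. It is
linear in `v`, lowers the degree by one, and is zero on forms of degree zero. -/
def vectorContraction : V →ₗ[ℝ] Module.End ℝ (FormFibre V) where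
  toFun v :=
    { toFun := fun α k => plugIn v (α (k + 1))
      map_add' := fun α β => by
        funext k; ext w; simp [plugIn_apply]
      map_smul' := fun c α => by
        funext k; ext w; simp [plugIn_apply] }
  map_add' u v := by
    ext α k w
    simp [plugIn_apply, ContinuousAlternatingMap.vecCons_add]
  map_smul' c v := by
    ext α k w
    simp [plugIn_apply, ContinuousAlternatingMap.vecCons_smul]

theorem vectorContraction_sq (v : V) : vectorContraction V v * vectorContraction V v = 0 := by
  ext α k w
  change α (k + 1 + 1) (Matrix.vecCons v (Matrix.vecCons v w)) = 0
  exact (α (k + 1 + 1)).map_eq_zero_of_eq _ (i := 0) (j := 1) (by simp) (by simp)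

variable (V) in
/-- The contraction operator of a multivector: the algebra morphism determined by
`ι_{x₁ ⋯ xₙ} = ι_{x₁} ∘ ⋯ ∘ ι_{xₙ}`, that is `ι_{x₁ ⋯ xₙ} α = α(xₙ, …, x₁, -)`. -/
def contraction : ExteriorAlgebra ℝ V →ₐ[ℝ] Module.End ℝ (FormFibre V) :=
  ExteriorAlgebra.lift ℝ ⟨vectorContraction V, vectorContraction_sq⟩

end Fibre

/-! ### Differential forms and multivector fields on a manifold modelled on `E` -/

section Fields

variable (E : Type*) [NormedAddCommGroup E] [NormedSpace ℝ E]
  (M : Type*) [TopologicalSpace M] [ChartedSpace E M]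

/-- Arbitrary (not necessarily smooth) families of exterior forms on the tangent spaces. -/
abbrev FormField : Type _ := ∀ p : M, FormFibre (TangentSpace 𝓘(ℝ, E) p)

/-- Arbitrary (not necessarily smooth) families of multivectors on the tangent spaces. -/
abbrev MultivectorField : Type _ := ∀ p : M, ExteriorAlgebra ℝ (TangentSpace 𝓘(ℝ, E) p)

variable {E M}

/-- The degree `k` component of a family of forms, written in the preferred chart at `p₀`: its
pullback along the inverse of the chart. -/
def FormField.inChart (α : FormField E M) (k : ℕ) (p₀ : M) (y : E) : E [⋀^Fin k]→L[ℝ] ℝ :=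
  (α ((extChartAt 𝓘(ℝ, E) p₀).symm y) k).compContinuousLinearMap
    (mfderiv 𝓘(ℝ, E) 𝓘(ℝ, E) (extChartAt 𝓘(ℝ, E) p₀).symm y)

/-- A family of forms is smooth if all its components are smooth in charts. -/
def FormField.IsSmooth (α : FormField E M) : Prop :=
  ∀ (k : ℕ) (p₀ : M), ContDiffOn ℝ ∞ (α.inChart k p₀) (extChartAt 𝓘(ℝ, E) p₀).target

/-- A family of multivectors written in the preferred chart at `p₀`. -/
def MultivectorField.inChart (x : MultivectorField E M) (p₀ : M) (y : E) :
    ExteriorAlgebra ℝ E :=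
  ExteriorAlgebra.map
    (mfderiv 𝓘(ℝ, E) 𝓘(ℝ, E) (extChartAt 𝓘(ℝ, E) p₀)
      ((extChartAt 𝓘(ℝ, E) p₀).symm y)).toLinearMap
    (x ((extChartAt 𝓘(ℝ, E) p₀).symm y))

/-- A family of multivectors is smooth if in charts all its coordinates, with respect to linear
functionals on the exterior algebra of the model space, are smooth functions. -/
def MultivectorField.IsSmooth (x : MultivectorField E M) : Prop :=
  ∀ (φ : Module.Dual ℝ (ExteriorAlgebra ℝ E)) (p₀ : M),
    ContDiffOn ℝ ∞ (fun y => φ (x.inChart p₀ y)) (extChartAt 𝓘(ℝ, E) p₀).target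

/-- The exterior derivative, computed at every point `p` in the preferred chart at `p`. -/
def extD (α : FormField E M) : FormField E M := fun p k =>
  match k with
  | 0 => 0
  | k + 1 =>
    (extDeriv (α.inChart k p) (extChartAt 𝓘(ℝ, E) p p)).compContinuousLinearMap
      (mfderiv 𝓘(ℝ, E) 𝓘(ℝ, E) (extChartAt 𝓘(ℝ, E) p) p)

/-- The contraction `ι_x α` of a multivector field and a differential form. -/
def contract (x : MultivectorField E M) (α : FormField E M) : FormField E M :=
  fun p => contraction _ (x p) (α p)

theorem FormField.inChart_add (α β : FormField E M) (k : ℕ) (p₀ : M) :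
    (α + β).inChart k p₀ = α.inChart k p₀ + β.inChart k p₀ := by
  funext y; ext w; rfl

theorem FormField.inChart_smul (c : ℝ) (α : FormField E M) (k : ℕ) (p₀ : M) :
    (c • α).inChart k p₀ = c • α.inChart k p₀ := by
  funext y; ext w; rfl

theorem FormField.inChart_zero (k : ℕ) (p₀ : M) :
    (0 : FormField E M).inChart k p₀ = 0 := by
  funext y; ext w; rfl

theorem MultivectorField.inChart_add (x y : MultivectorField E M) (p₀ : M) (z : E) :
    (x + y).inChart p₀ z = x.inChart p₀ z + y.inChart p₀ z :=
  map_add _ _ _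

theorem MultivectorField.inChart_smul (c : ℝ) (x : MultivectorField E M) (p₀ : M) (z : E) :
    (c • x).inChart p₀ z = c • x.inChart p₀ z := by
  unfold MultivectorField.inChart
  exact map_smul _ c _

theorem MultivectorField.inChart_zero (p₀ : M) (z : E) :
    (0 : MultivectorField E M).inChart p₀ z = 0 :=
  map_zero _

variable (E M)

/-- `Ω^k(M)`: smooth differential forms concentrated in degree `k`. -/
def formSpace (k : ℕ) : Submodule ℝ (FormField E M) where
  carrier := {α | α.IsSmooth ∧ ∀ p l, l ≠ k → α p l = 0}
  add_mem' := by
    rintro α β ⟨hα, hα'⟩ ⟨hβ, hβ'⟩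
    refine ⟨fun l p₀ => ?_, fun p l hl => by simp [hα' p l hl, hβ' p l hl]⟩
    rw [FormField.inChart_add]
    exact (hα l p₀).add (hβ l p₀)
  zero_mem' := by
    refine ⟨fun l p₀ => ?_, fun p l hl => rfl⟩
    rw [FormField.inChart_zero]
    exact contDiffOn_const
  smul_mem' := by
    rintro c α ⟨hα, hα'⟩
    refine ⟨fun l p₀ => ?_, fun p l hl => by simp [hα' p l hl]⟩
    rw [FormField.inChart_smul]
    exact (hα l p₀).const_smul c

/-- `𝔛^n(M)`: smooth sections of the `n`-th exterior power of the tangent bundle. -/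
def multivectorSpace (n : ℕ) : Submodule ℝ (MultivectorField E M) where
  carrier := {x | x.IsSmooth ∧ ∀ p, x p ∈ ⋀[ℝ]^n (TangentSpace 𝓘(ℝ, E) p)}
  add_mem' := by
    rintro x y ⟨hx, hx'⟩ ⟨hy, hy'⟩
    refine ⟨fun φ p₀ => ?_, fun p => Submodule.add_mem _ (hx' p) (hy' p)⟩
    simpa [MultivectorField.inChart_add] using (hx φ p₀).add (hy φ p₀)
  zero_mem' := by
    refine ⟨fun φ p₀ => ?_, fun p => Submodule.zero_mem _⟩
    simpa [MultivectorField.inChart_zero] using contDiffOn_const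
  smul_mem' := by
    rintro c x ⟨hx, hx'⟩
    refine ⟨fun φ p₀ => ?_, fun p => Submodule.smul_mem _ c (hx' p)⟩
    simpa [MultivectorField.inChart_smul] using (hx φ p₀).const_smul c

variable {E M}

/-- `(M, ω)` is a pre-`m`-symplectic manifold: `ω` is a closed form of degree `m + 1`. -/
def IsPreSymplectic (m : ℕ) (ω₀ : FormField E M) : Prop :=
  ω₀ ∈ formSpace E M (m + 1) ∧ extD ω₀ = 0

/-- `(x, α)` is a hamiltonian pair, with `x` an `n`-vector field and `α` a form of degree
`m - n`. -/
def IsHamiltonianPair (m : ℕ) (ω₀ : FormField E M) (n : ℕ) (x : MultivectorField E M)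
    (α : FormField E M) : Prop :=
  n ≤ m ∧ x ∈ multivectorSpace E M n ∧ α ∈ formSpace E M (m - n) ∧ contract x ω₀ = extD α

theorem differentiableAt_inChart {k : ℕ} {α : FormField E M} (hα : α ∈ formSpace E M k) (l : ℕ)
    (p : M) : DifferentiableAt ℝ (α.inChart l p) (extChartAt 𝓘(ℝ, E) p p) :=
  ((hα.1 l p).contDiffAt (extChartAt_target_mem_nhds p)).differentiableAt (by simp)

theorem extD_add {k : ℕ} {α β : FormField E M} (hα : α ∈ formSpace E M k)
    (hβ : β ∈ formSpace E M k) : extD (α + β) = extD α + extD β := by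
  funext p l
  cases l with
  | zero => simp [extD]
  | succ l =>
    simp only [extD, Pi.add_apply, FormField.inChart_add]
    rw [extDeriv_add (differentiableAt_inChart hα l p) (differentiableAt_inChart hβ l p)]
    rfl

theorem extD_smul (c : ℝ) (α : FormField E M) : extD (c • α) = c • extD α := by
  funext p l
  cases l with
  | zero => simp [extD]
  | succ l =>
    simp only [extD, Pi.smul_apply, FormField.inChart_smul]
    rw [extDeriv_smul]
    rfl

/-- The hamiltonian forms of degree `m - n`: those that are part of a hamiltonian pair. -/
def hamiltonianSpace (m : ℕ) (ω₀ : FormField E M) (n : ℕ) : Submodule ℝ (FormField E M) where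
  carrier := {α | α ∈ formSpace E M (m - n) ∧
    ∃ x ∈ multivectorSpace E M n, contract x ω₀ = extD α}
  add_mem' := by
    rintro α β ⟨hα, x, hx, hxα⟩ ⟨hβ, y, hy, hyβ⟩
    refine ⟨Submodule.add_mem _ hα hβ, x + y, Submodule.add_mem _ hx hy, ?_⟩
    rw [extD_add hα hβ, ← hxα, ← hyβ]
    funext p
    simp [contract]
  zero_mem' := by
    refine ⟨Submodule.zero_mem _, 0, Submodule.zero_mem _, ?_⟩
    have h := extD_smul (0 : ℝ) (0 : FormField E M)
    rw [zero_smul, zero_smul] at h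
    rw [h]
    funext p
    simp [contract]
  smul_mem' := by
    rintro c α ⟨hα, x, hx, hxα⟩
    refine ⟨Submodule.smul_mem _ c hα, c • x, Submodule.smul_mem _ c hx, ?_⟩
    rw [extD_smul, ← hxα]
    funext p
    simp [contract]

end Fields

/-! ### `L∞`-algebras -/

section LInfinity

/-- The Koszul sign `ε(σ; v)` for homogeneous elements of degrees `d`, characterized by
`σ · (v₁ ⊗ ⋯ ⊗ vₙ) = ε(σ; v) v_{σ(1)} ⊗ ⋯ ⊗ v_{σ(n)}`: every inversion of `σ` contributes
`(-1)` to the product of the two degrees. -/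
def koszulSign {n : ℕ} (d : Fin n → ℤ) (σ : Equiv.Perm (Fin n)) : ℤˣ :=
  ∏ q : Fin n × Fin n with q.1 < q.2 ∧ σ q.2 < σ q.1, Int.negOnePow (d (σ q.1) * d (σ q.2))

/-- `σ` is a `(p, n - p)`-unshuffle: it is increasing on the first `p` and on the last `n - p`
indices. -/
def IsUnshuffle {n : ℕ} (p : ℕ) (σ : Equiv.Perm (Fin n)) : Prop :=
  ∀ a b : Fin n, a < b → ((b : ℕ) < p ∨ p ≤ (a : ℕ)) → σ a < σ b

variable {L : Type*} [AddCommGroup L] [Module ℝ L]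

/-- Families of brackets on `L`; `l n` is the bracket with `n + 1` arguments, usually called
`l_{n+1}`. -/
abbrev Brackets (L : Type*) [AddCommGroup L] [Module ℝ L] : Type _ :=
  ∀ n : ℕ, MultilinearMap ℝ (fun _ : Fin (n + 1) => L) L

/-- The composition `g ∘₁ f`, where `f` has `i + 1` and `g` has `n - i + 1` arguments:
`g(f(v₀, …, v_i), v_{i+1}, …, v_n)`. -/
def composeFirst (l : Brackets L) {n : ℕ} (i : Fin (n + 1)) (v : Fin (n + 1) → L) : L :=
  l (n - i) (Fin.cons (l i fun a => v ⟨a, by omega⟩) fun b => v ⟨i + 1 + b, by omega⟩)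

open scoped Classical in
/-- The left-hand side of the generalized Jacobi identity with `n + 1` arguments `v`, homogeneous
of degrees `d`: the sum over `i' + j' = n + 2` of the symmetric insertions of `l_{i'}` into
`l_{j'}`, where `i' = i + 1`. -/
def jacobiator (l : Brackets L) {n : ℕ} (d : Fin (n + 1) → ℤ) (v : Fin (n + 1) → L) : L :=
  ∑ i : Fin (n + 1), ∑ σ : Equiv.Perm (Fin (n + 1)) with IsUnshuffle (i + 1) σ,
    koszulSign d σ • composeFirst l i (v ∘ σ)

/-- An `L∞`-algebra (in the graded symmetric convention): a `ℤ`-graded vector space concentrated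
in positive degrees, with graded symmetric brackets of degree `-1` that satisfy the generalized
Jacobi identities. -/
structure IsLInfinityAlgebra (gr : ℤ → Submodule ℝ L) (l : Brackets L) : Prop where
  isInternal : DirectSum.IsInternal gr
  positive : ∀ k ≤ 0, gr k = ⊥
  degree : ∀ (n : ℕ) (d : Fin (n + 1) → ℤ) (v : Fin (n + 1) → L), (∀ a, v a ∈ gr (d a)) →
    l n v ∈ gr (∑ a, d a - 1)
  symmetric : ∀ (n : ℕ) (d : Fin (n + 1) → ℤ) (v : Fin (n + 1) → L), (∀ a, v a ∈ gr (d a)) →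
    ∀ σ : Equiv.Perm (Fin (n + 1)), koszulSign d σ • l n (v ∘ σ) = l n v
  jacobi : ∀ (n : ℕ) (d : Fin (n + 1) → ℤ) (v : Fin (n + 1) → L), (∀ a, v a ∈ gr (d a)) →
    jacobiator l d v = 0

/-- `F` embeds the graded space `L'` with brackets `l'` as an `L∞`-subalgebra of `L`: it is an
injective linear map of degree zero that commutes with all brackets. -/
structure IsLInfinitySubalgebra {L' : Type*} [AddCommGroup L'] [Module ℝ L']
    (gr' : ℤ → Submodule ℝ L') (l' : Brackets L') (gr : ℤ → Submodule ℝ L) (l : Brackets L)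
    (F : L' →ₗ[ℝ] L) : Prop where
  injective : Function.Injective F
  degree : ∀ (k : ℤ), ∀ v ∈ gr' k, F v ∈ gr k
  bracket : ∀ (n : ℕ) (v : Fin (n + 1) → L'), l n (fun a => F (v a)) = F (l' n v)

end LInfinity

/-! ### The spaces `Ξ(M)` and Rogers' space -/

section Xi

variable {E : Type*} [NormedAddCommGroup E] [NormedSpace ℝ E]
  {M : Type*} [TopologicalSpace M] [ChartedSpace E M]

/-- The bigraded pieces `Ξ_i^j(M)` for `q = (i, j)`: zero unless `1 ≤ i` and `0 ≤ j ≤ m - i`;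
in that range `Ξ_1^j(M)` consists of the hamiltonian forms of degree `m - 1 - j`, which are paired
with `(j + 1)`-vector fields, and `Ξ_i^j(M) = Ω^{m-i-j}(M)` for `i ≥ 2`. -/
def xiPiece (m : ℕ) (ω₀ : FormField E M) (q : ℕ × ℕ) : Submodule ℝ (FormField E M) :=
  if 1 ≤ q.1 ∧ q.1 + q.2 ≤ m then
    if q.1 = 1 then hamiltonianSpace m ω₀ (q.2 + 1) else formSpace E M (m - (q.1 + q.2))
  else ⊥

/-- The total space `Ξ(M) = ⨁_{i,j} Ξ_i^j(M)`. -/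
abbrev Xi (m : ℕ) (ω₀ : FormField E M) : Type _ := ⨁ q : ℕ × ℕ, xiPiece m ω₀ q

instance (m : ℕ) (ω₀ : FormField E M) : AddCommGroup (Xi m ω₀) :=
  @DirectSum.instAddCommGroup (ℕ × ℕ) (fun q => xiPiece m ω₀ q) fun q =>
    Submodule.addCommGroup (xiPiece m ω₀ q)

/-- An element of `Ξ_i^j(M)` regarded as an element of `Ξ(M)`. -/
abbrev xiOf (m : ℕ) (ω₀ : FormField E M) (i j : ℕ) : xiPiece m ω₀ (i, j) →ₗ[ℝ] Xi m ω₀ :=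
  DirectSum.lof ℝ (ℕ × ℕ) (fun q => xiPiece m ω₀ q) (i, j)

/-- The grading `Ξ_k(M) = ⨁_{i+j=k} Ξ_i^j(M)`. -/
def xiGrading (m : ℕ) (ω₀ : FormField E M) (k : ℤ) : Submodule ℝ (Xi m ω₀) :=
  ⨆ (i : ℕ) (j : ℕ) (_ : (i : ℤ) + j = k), LinearMap.range (xiOf m ω₀ i j)

/-- The contraction `ι_{x₀ ⋯ x_n} ω` with a product of multivector fields. -/
def contractProd {n : ℕ} (x : Fin n → MultivectorField E M) (ω₀ : FormField E M) :
    FormField E M :=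
  contract (List.ofFn x).prod ω₀

/-- The defining formulas of the brackets of `Ξ(M)`. -/
structure IsXiBrackets (m : ℕ) (ω₀ : FormField E M) (l : Brackets (Xi m ω₀)) : Prop where
  /-- `l₁ = -d : Ξ_i^j(M) → Ξ_{i-1}^j(M)` for `i ≥ 2`. -/
  differential : ∀ (i j : ℕ), 2 ≤ i → ∀ α : xiPiece m ω₀ (i, j),
    ∃ β : xiPiece m ω₀ (i - 1, j), (β : FormField E M) = -extD (α : FormField E M) ∧
      l 0 (fun _ => xiOf m ω₀ i j α) = xiOf m ω₀ (i - 1) j β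
  /-- `l₁` is zero on the first column. -/
  differential_column_one : ∀ (j : ℕ) (α : xiPiece m ω₀ (1, j)),
    l 0 (fun _ => xiOf m ω₀ 1 j α) = 0
  /-- For `k = n + 1 ≥ 2`, the bracket `l_k` of elements `α_a` of `Ξ_1^{j_a}(M)` is
  `ι_{x_1 ⋯ x_k} ω`, in bidegree `(k - 1, ∑ j_a)`, for any hamiltonian pairs `(x_a, α_a)`. -/
  higher : ∀ (n : ℕ), 1 ≤ n → ∀ (j : Fin (n + 1) → ℕ) (α : ∀ a, xiPiece m ω₀ (1, j a))
    (x : Fin (n + 1) → MultivectorField E M),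
    (∀ a, IsHamiltonianPair m ω₀ (j a + 1) (x a) (α a)) →
    ∃ β : xiPiece m ω₀ (n, ∑ a, j a), (β : FormField E M) = contractProd x ω₀ ∧
      l n (fun a => xiOf m ω₀ 1 (j a) (α a)) = xiOf m ω₀ n (∑ a, j a) β
  /-- For `k = n + 1 ≥ 2`, the bracket `l_k` is zero if one of its arguments lies outside the
  first column. -/
  higher_zero : ∀ (n : ℕ), 1 ≤ n → ∀ (i j : Fin (n + 1) → ℕ)
    (α : ∀ a, xiPiece m ω₀ (i a, j a)), (∃ a, i a ≠ 1) →
    l n (fun a => xiOf m ω₀ (i a) (j a) (α a)) = 0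

/-- The graded pieces of Rogers' `L∞`-algebra: hamiltonian forms of degree `m - 1` in degree `1`,
and `Ω^{m-n}(M)` in degree `n` for `2 ≤ n ≤ m`. -/
def rogersPiece (m : ℕ) (ω₀ : FormField E M) (n : ℕ) : Submodule ℝ (FormField E M) :=
  if 1 ≤ n ∧ n ≤ m then
    if n = 1 then hamiltonianSpace m ω₀ 1 else formSpace E M (m - n)
  else ⊥

/-- The underlying space of Rogers' `L∞`-algebra. -/
abbrev Rogers (m : ℕ) (ω₀ : FormField E M) : Type _ := ⨁ n : ℕ, rogersPiece m ω₀ n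

instance (m : ℕ) (ω₀ : FormField E M) : AddCommGroup (Rogers m ω₀) :=
  @DirectSum.instAddCommGroup ℕ (fun n => rogersPiece m ω₀ n) fun n =>
    Submodule.addCommGroup (rogersPiece m ω₀ n)

/-- A homogeneous element of degree `n`, regarded as an element of Rogers' `L∞`-algebra. -/
abbrev rogersOf (m : ℕ) (ω₀ : FormField E M) (n : ℕ) : rogersPiece m ω₀ n →ₗ[ℝ] Rogers m ω₀ :=
  DirectSum.lof ℝ ℕ (fun n => rogersPiece m ω₀ n) n

/-- The grading of Rogers' `L∞`-algebra. -/
def rogersGrading (m : ℕ) (ω₀ : FormField E M) (k : ℤ) : Submodule ℝ (Rogers m ω₀) :=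
  ⨆ (n : ℕ) (_ : (n : ℤ) = k), LinearMap.range (rogersOf m ω₀ n)

/-- The brackets of Rogers' `L∞`-algebra: `l₁ = -d` in degrees at least two, and
`l_k(α₁, …, α_k) = ι_{x₁ ⋯ x_k} ω` for `k ≥ 2` and arguments of degree one, where the `x_a` are
hamiltonian vector fields of the `α_a`; everything else is zero. -/
structure IsRogersBrackets (m : ℕ) (ω₀ : FormField E M) (r : Brackets (Rogers m ω₀)) : Prop where
  differential : ∀ (i : ℕ), 2 ≤ i → ∀ α : rogersPiece m ω₀ i,
    ∃ β : rogersPiece m ω₀ (i - 1), (β : FormField E M) = -extD (α : FormField E M) ∧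
      r 0 (fun _ => rogersOf m ω₀ i α) = rogersOf m ω₀ (i - 1) β
  differential_degree_one : ∀ (α : rogersPiece m ω₀ 1), r 0 (fun _ => rogersOf m ω₀ 1 α) = 0
  higher : ∀ (n : ℕ), 1 ≤ n → ∀ (α : Fin (n + 1) → rogersPiece m ω₀ 1)
    (x : Fin (n + 1) → MultivectorField E M),
    (∀ a, IsHamiltonianPair m ω₀ 1 (x a) (α a)) →
    ∃ β : rogersPiece m ω₀ n, (β : FormField E M) = contractProd x ω₀ ∧
      r n (fun a => rogersOf m ω₀ 1 (α a)) = rogersOf m ω₀ n β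
  higher_zero : ∀ (n : ℕ), 1 ≤ n → ∀ (i : Fin (n + 1) → ℕ)
    (α : ∀ a, rogersPiece m ω₀ (i a)), (∃ a, i a ≠ 1) →
    r n (fun a => rogersOf m ω₀ (i a) (α a)) = 0

theorem rogersPiece_eq (m : ℕ) (ω₀ : FormField E M) (n : ℕ) :
    rogersPiece m ω₀ n = xiPiece m ω₀ (n, 0) := by
  simp [rogersPiece, xiPiece]

/-- The inclusion of Rogers' space into `Ξ(M)` as the bottom row `j = 0`. -/
def rogersInclusion (m : ℕ) (ω₀ : FormField E M) : Rogers m ω₀ →ₗ[ℝ] Xi m ω₀ :=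
  DirectSum.toModule ℝ ℕ (Xi m ω₀) fun n =>
    xiOf m ω₀ n 0 ∘ₗ Submodule.inclusion (rogersPiece_eq m ω₀ n).le

end Xi

end MultiSymp

end

/-! Write `d` for the exterior derivative and `ι_x` for contraction. Contractions with multivector
fields commute up to the Koszul sign of their degrees, and `[[d, ι_x], ι_y]` is again a contraction,
namely with the Schouten bracket `[x, y]` (`lieD_contract`). So `d` is a second order operator for
the algebra of contractions. If `ω` and all `ι_{x_a} ω` are closed, then `d` and all `[d, ι_{x_a}]`
kill `ω`, and expanding leaves only pairs: `d ι_{x_1 ⋯ x_k} ω` is the sum over `a < b` of `±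
ι_{[x_a, x_b]}` applied to the contraction of `ω` with the remaining fields
(`second_order_expansion`, `extD_contractProd`).

This formula carries the `L∞` structure. An element of `Ξ_1^j` has degree `j + 1`, which is also the
degree of its hamiltonian field, so symmetry of the brackets is graded commutativity of the exterior
algebra. For `k = 2` the formula says that `ι_{x_1 x_2} ω` is hamiltonian with field `[x_1, x_2]`,
so `l_2` lands in the first column. For `k ≥ 3` it is the Jacobi identity: `l_i` with `i ≥ 3` takes
values in column `i - 1 ≥ 2`, where all higher brackets vanish, and values of `l_1` are closed, so
their field may be taken to be zero. Only `l_1 ∘ l_k` and the terms `l_{k-1}(l_2(·,·), …)` survive,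
and these are the two sides of the formula. With fewer arguments the identity reduces to `d² = 0`
and to `l_1 = 0` on the first column.

The brackets are well defined because any factor can be moved next to `ω`, so that only `ι_{x_a} ω =
dα_a` matters (`contractProd_congr`). Hence one linear choice of hamiltonian fields
(`hamiltonianField`) yields multilinear brackets that satisfy the formula for every other choice.

The Schouten bracket is found in charts from `d = ∑ e^i ∧ ∂_i` and the commutator of `e^i ∧ -` with
`ι_x` (`derivedBracket_local`). The derived bracket is coordinate-free and contractions separate
multivectors, so the local formulas agree in all charts (`schouten_inChart`).

Rows of arguments add up, so the bottom row is closed under the brackets; Rogers' structure is the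
restriction to it. -/

noncomputable section

namespace MultiSymp

/-! ### Graded commutativity of the exterior algebra -/

section Exterior

open CliffordAlgebra

variable {V : Type*} [AddCommGroup V] [Module ℝ V]

/-- Exterior powers are spanned by products of vectors, built up by left multiplication. The motive
does not mention membership; membership is offered only in the product step. -/
theorem exteriorPower_induction {p : ℕ → ExteriorAlgebra ℝ V → Prop}
    (scalar : ∀ r : ℝ, p 0 (algebraMap ℝ _ r))
    (add : ∀ n x y, p n x → p n y → p n (x + y))
    (mul : ∀ n v x, x ∈ ⋀[ℝ]^n V → p n x → p (n + 1) (ExteriorAlgebra.ι ℝ v * x))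
    {n : ℕ} {x : ExteriorAlgebra ℝ V} (hx : x ∈ ⋀[ℝ]^n V) : p n x := by
  refine Submodule.pow_induction_on_left' (LinearMap.range (ExteriorAlgebra.ι ℝ : V →ₗ[ℝ] _))
    (C := fun n x _ => p n x) scalar (fun x y i _ _ h h' => add i x y h h') ?_ hx
  rintro _ ⟨v, rfl⟩ i x hx h
  exact mul i v x hx h

theorem ι_mul_mem {n : ℕ} (v : V) {x : ExteriorAlgebra ℝ V} (hx : x ∈ ⋀[ℝ]^n V) :
    ExteriorAlgebra.ι ℝ v * x ∈ ⋀[ℝ]^(n + 1) V := by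
  rw [ExteriorAlgebra.exteriorPower, pow_succ']
  exact Submodule.mul_mem_mul ⟨v, rfl⟩ hx

theorem exteriorPower_mul_mem {a b : ℕ} {x y : ExteriorAlgebra ℝ V} (hx : x ∈ ⋀[ℝ]^a V)
    (hy : y ∈ ⋀[ℝ]^b V) : x * y ∈ ⋀[ℝ]^(a + b) V := by
  rw [ExteriorAlgebra.exteriorPower, pow_add]
  exact Submodule.mul_mem_mul hx hy

theorem involute_of_mem {n : ℕ} {x : ExteriorAlgebra ℝ V} (hx : x ∈ ⋀[ℝ]^n V) :
    involute x = (-1 : ℝ) ^ n • x := by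
  refine exteriorPower_induction (p := fun n x => involute x = (-1 : ℝ) ^ n • x) ?_ ?_ ?_ hx
  · intro r; simp
  · intro n x y h h'; simp [h, h']
  · intro n v x _ h
    have hv : involute (ExteriorAlgebra.ι ℝ v) = -ExteriorAlgebra.ι ℝ v := involute_ι v
    rw [map_mul, h, hv, pow_succ]
    simp

theorem ι_mul_comm {n : ℕ} (v : V) {x : ExteriorAlgebra ℝ V} (hx : x ∈ ⋀[ℝ]^n V) :
    ExteriorAlgebra.ι ℝ v * x = (-1 : ℝ) ^ n • (x * ExteriorAlgebra.ι ℝ v) := by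
  refine exteriorPower_induction (p := fun n x => ExteriorAlgebra.ι ℝ v * x =
    (-1 : ℝ) ^ n • (x * ExteriorAlgebra.ι ℝ v)) ?_ ?_ ?_ hx
  · intro r; simpa using (Algebra.commutes r (ExteriorAlgebra.ι ℝ v)).symm
  · intro n x y h h'; simp [mul_add, add_mul, h, h']
  · intro n u x _ h
    have hu : ExteriorAlgebra.ι ℝ v * ExteriorAlgebra.ι ℝ u =
        -(ExteriorAlgebra.ι ℝ u * ExteriorAlgebra.ι ℝ v) :=
      eq_neg_of_add_eq_zero_left (ExteriorAlgebra.ι_add_mul_swap v u)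
    rw [← mul_assoc, hu, neg_mul, mul_assoc, h, pow_succ]
    simp [mul_assoc]

theorem exteriorPower_mul_comm {a b : ℕ} {x y : ExteriorAlgebra ℝ V} (hx : x ∈ ⋀[ℝ]^a V)
    (hy : y ∈ ⋀[ℝ]^b V) : x * y = (-1 : ℝ) ^ (a * b) • (y * x) := by
  refine exteriorPower_induction (p := fun a x => x * y = (-1 : ℝ) ^ (a * b) • (y * x)) ?_ ?_ ?_ hx
  · intro r; simpa using Algebra.commutes r y
  · intro n x y h h'; simp [mul_add, add_mul, h, h']
  · intro n u x _ h
    rw [mul_assoc, h, mul_smul_comm, ← mul_assoc, ι_mul_comm u hy, smul_mul_assoc, smul_smul,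
      ← pow_add, mul_assoc]
    congr 2
    ring

theorem contractLeft_mem {n : ℕ} (φ : Module.Dual ℝ V) {x : ExteriorAlgebra ℝ V}
    (hx : x ∈ ⋀[ℝ]^(n + 1) V) : contractLeft (Q := (0 : QuadraticForm ℝ V)) φ x ∈ ⋀[ℝ]^n V := by
  -- Since `k - 1` is truncated, membership alone says too little in degree zero. The second clause
  -- records that the contraction vanishes there, which the product of a vector with a scalar needs.
  have key : ∀ {k : ℕ} {x : ExteriorAlgebra ℝ V}, x ∈ ⋀[ℝ]^k V →
      contractLeft (Q := (0 : QuadraticForm ℝ V)) φ x ∈ ⋀[ℝ]^(k - 1) V ∧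
        (k = 0 → contractLeft (Q := (0 : QuadraticForm ℝ V)) φ x = 0) := by
    intro k x hx
    refine exteriorPower_induction (p := fun k x =>
      contractLeft (Q := (0 : QuadraticForm ℝ V)) φ x ∈ ⋀[ℝ]^(k - 1) V ∧
        (k = 0 → contractLeft (Q := (0 : QuadraticForm ℝ V)) φ x = 0)) ?_ ?_ ?_ hx
    · intro r
      have : contractLeft (Q := (0 : QuadraticForm ℝ V)) φ (algebraMap ℝ _ r) = 0 :=
        contractLeft_algebraMap 0 φ r
      exact ⟨this ▸ Submodule.zero_mem _, fun _ => this⟩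
    · intro n x y h h'
      rw [map_add]
      exact ⟨Submodule.add_mem _ h.1 h'.1, fun hn => by rw [h.2 hn, h'.2 hn, add_zero]⟩
    · intro n v x hx h
      refine ⟨?_, by simp⟩
      have : contractLeft (Q := (0 : QuadraticForm ℝ V)) φ (ExteriorAlgebra.ι ℝ v * x) =
        φ v • x - ExteriorAlgebra.ι ℝ v * contractLeft (Q := (0 : QuadraticForm ℝ V)) φ x :=
        contractLeft_ι_mul φ v x
      rw [this]
      refine Submodule.sub_mem _ (Submodule.smul_mem _ _ hx) ?_
      cases n with
      | zero => rw [h.2 rfl]; simp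
      | succ n => exact ι_mul_mem v h.1
  exact (key hx).1

end Exterior

/-! ### Contractions and wedge products with covectors on one tangent space -/

section Contraction

variable {V : Type*} [AddCommGroup V] [Module ℝ V] [TopologicalSpace V]

@[simp]
theorem contraction_ι (v : V) : contraction V (ExteriorAlgebra.ι ℝ v) = vectorContraction V v :=
  ExteriorAlgebra.lift_ι_apply ℝ _ _ _

@[simp]
theorem vectorContraction_apply (v : V) (α : FormFibre V) (k : ℕ) (w : Fin k → V) :
    vectorContraction V v α k w = α (k + 1) (Matrix.vecCons v w) := rfl

theorem contraction_comm {a b : ℕ} {x y : ExteriorAlgebra ℝ V} (hx : x ∈ ⋀[ℝ]^a V)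
    (hy : y ∈ ⋀[ℝ]^b V) :
    contraction V x * contraction V y =
      (-1 : ℝ) ^ (a * b) • (contraction V y * contraction V x) := by
  rw [← map_mul, exteriorPower_mul_comm hx hy, map_smul, map_mul]

/-- The contraction with a multivector of degree `n` lowers the degree by `n`. -/
theorem contraction_single {n : ℕ} {x : ExteriorAlgebra ℝ V} (hx : x ∈ ⋀[ℝ]^n V)
    (α : FormFibre V) (k : ℕ) :
    contraction V x α k = contraction V x (Pi.single (k + n) (α (k + n))) k := by
  refine exteriorPower_induction (p := fun n x => ∀ (α : FormFibre V) k,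
    contraction V x α k = contraction V x (Pi.single (k + n) (α (k + n))) k) ?_ ?_ ?_ hx α k
  · intro r α k; simp [Algebra.algebraMap_eq_smul_one]
  · intro n x y h h' α k
    simp only [map_add, LinearMap.add_apply, Pi.add_apply]
    rw [h, h']
  · intro n v x _ h α k
    simp only [map_mul, contraction_ι, Module.End.mul_apply]
    ext w
    have e : k + 1 + n = k + (n + 1) := by omega
    simp only [vectorContraction_apply]
    rw [h α (k + 1), h (Pi.single _ _) (k + 1), e]
    simp

theorem contraction_eq_of_eq {n : ℕ} {x : ExteriorAlgebra ℝ V} (hx : x ∈ ⋀[ℝ]^n V)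
    {α β : FormFibre V} {k : ℕ} (h : α (k + n) = β (k + n)) :
    contraction V x α k = contraction V x β k := by
  rw [contraction_single hx, h, ← contraction_single hx]

/-- The contraction of a multivector of degree `n` with a form of degree `k + n`. -/
def contractionBilin (V : Type*) [AddCommGroup V] [Module ℝ V] [TopologicalSpace V] (n k : ℕ) :
    ExteriorAlgebra ℝ V →ₗ[ℝ] (V [⋀^Fin (k + n)]→L[ℝ] ℝ) →ₗ[ℝ] (V [⋀^Fin k]→L[ℝ] ℝ) :=
  LinearMap.mk₂ ℝ (fun x a => contraction V x (Pi.single (k + n) a) k)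
    (by intros; simp) (by intros; simp) (by intros; simp [Pi.single_add])
    (by intros; simp [Pi.single_smul])

theorem contraction_eq_bilin {n : ℕ} {x : ExteriorAlgebra ℝ V} (hx : x ∈ ⋀[ℝ]^n V)
    (α : FormFibre V) (k : ℕ) :
    contraction V x α k = contractionBilin V n k x (α (k + n)) :=
  contraction_single hx α k

/-- Contracting an `n`-vector with a form of degree `n` amounts to applying a linear functional. -/
theorem contraction_ofDual {n : ℕ} (φ : Module.Dual ℝ (ExteriorAlgebra ℝ V))
    (α : V [⋀^Fin n]→L[ℝ] ℝ)
    (hα : ∀ w, α w = φ (ExteriorAlgebra.ιMulti ℝ n fun i => w i.rev))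
    {x : ExteriorAlgebra ℝ V} (hx : x ∈ ⋀[ℝ]^n V) :
    contraction V x (Pi.single n α) 0 ![] = φ x := by
  -- Generalized for the induction on `x`: the arguments `w` not yet used up stand to the left of
  -- `x`, in reversed order because `ι_{x₁ ⋯ xₙ} α = α(xₙ, …, x₁, -)`.
  have key : ∀ {k : ℕ} {x : ExteriorAlgebra ℝ V}, x ∈ ⋀[ℝ]^k V → ∀ (m : ℕ) (h : m + k = n)
      (w : Fin m → V), contraction V x (Pi.single n α) m w =
        φ ((ExteriorAlgebra.ιMulti ℝ m fun i => w i.rev) * x) := by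
    intro k x hx
    refine exteriorPower_induction (p := fun k x => ∀ (m : ℕ) (h : m + k = n)
      (w : Fin m → V), contraction V x (Pi.single n α) m w =
        φ ((ExteriorAlgebra.ιMulti ℝ m fun i => w i.rev) * x)) ?_ ?_ ?_ hx
    · rintro r m rfl w
      simp [Algebra.algebraMap_eq_smul_one, hα]
    · intro k x y hx hy m h w
      simp [mul_add, hx m h w, hy m h w]
    · intro k v x _ ih m h w
      simp only [map_mul, contraction_ι, Module.End.mul_apply, vectorContraction_apply]
      rw [ih (m + 1) (by omega), ← mul_assoc]
      congr 2
      rw [ExteriorAlgebra.ιMulti_apply, ExteriorAlgebra.ιMulti_apply, List.ofFn_succ']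
      simp [Fin.rev_castSucc, List.concat_eq_append]
  have := key hx 0 (by omega) ![]
  simpa using this

theorem contraction_eq_zero {n k : ℕ} {x : ExteriorAlgebra ℝ V} (hx : x ∈ ⋀[ℝ]^n V)
    {α : FormFibre V} (h : α (k + n) = 0) : contraction V x α k = 0 := by
  rw [contraction_eq_of_eq hx (β := 0) (by simpa using h)]
  simp

end Contraction

/-! ### Naturality of contraction -/

section Pullback

variable {V V' : Type*} [AddCommGroup V] [Module ℝ V] [TopologicalSpace V]
  [AddCommGroup V'] [Module ℝ V'] [TopologicalSpace V']

/-- The pullback of forms of all degrees along a linear map. -/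
def pullbackFibre (f : V →L[ℝ] V') : FormFibre V' →ₗ[ℝ] FormFibre V where
  toFun α k := (α k).compContinuousLinearMap f
  map_add' _ _ := rfl
  map_smul' _ _ := rfl

@[simp]
theorem pullbackFibre_apply (f : V →L[ℝ] V') (α : FormFibre V') (k : ℕ) :
    pullbackFibre f α k = (α k).compContinuousLinearMap f := rfl

theorem pullbackFibre_contraction (f : V →L[ℝ] V') (x : ExteriorAlgebra ℝ V) (α : FormFibre V') :
    pullbackFibre f (contraction V' (ExteriorAlgebra.map f.toLinearMap x) α) =
      contraction V x (pullbackFibre f α) := by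
  induction x using ExteriorAlgebra.induction generalizing α with
  | algebraMap r => simp [Algebra.algebraMap_eq_smul_one]
  | ι v =>
    funext k; ext w
    rw [ExteriorAlgebra.map_apply_ι, contraction_ι, contraction_ι]
    simp only [pullbackFibre_apply, vectorContraction_apply,
      ContinuousAlternatingMap.compContinuousLinearMap_apply]
    congr 1
    funext i
    refine Fin.cases ?_ (fun i => ?_) i <;> simp
  | mul x y hx hy =>
    simp only [map_mul, Module.End.mul_apply]
    rw [hx, hy]
  | add x y hx hy => simp [hx, hy]

end Pullback

/-! ### Commutators of covectors and contractions -/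

section Wedge

variable {E : Type*} [NormedAddCommGroup E] [NormedSpace ℝ E]

open CliffordAlgebra

/-- The operator `φ ∧ -` on forms of all degrees. -/
def covectorWedge (φ : E →L[ℝ] ℝ) : Module.End ℝ (FormFibre E) where
  toFun α k := match k with
    | 0 => 0
    | k + 1 => ContinuousAlternatingMap.alternatizeUncurryFin (φ.smulRight (α k))
  map_add' α β := by
    funext k
    cases k with
    | zero => simp
    | succ k =>
      ext v
      simp [ContinuousAlternatingMap.alternatizeUncurryFin_apply, Finset.sum_add_distrib]
  map_smul' c α := by
    funext k
    cases k with
    | zero => simp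
    | succ k =>
      ext v
      simp [ContinuousAlternatingMap.alternatizeUncurryFin_apply, Finset.mul_sum, mul_left_comm]

theorem covectorWedge_zero (φ : E →L[ℝ] ℝ) (α : FormFibre E) : covectorWedge φ α 0 = 0 := rfl

theorem covectorWedge_succ (φ : E →L[ℝ] ℝ) (α : FormFibre E) (k : ℕ) :
    covectorWedge φ α (k + 1) =
      ContinuousAlternatingMap.alternatizeUncurryFin (φ.smulRight (α k)) := rfl

/-- In the alternating sum for `φ ∧ α` evaluated at `v, w`, the term that feeds `v` to `φ` gives
`φ(v) α`, and the remaining terms assemble to `-φ ∧ ι_v α`. -/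
theorem covectorWedge_mul_vectorContraction (φ : E →L[ℝ] ℝ) (v : E) :
    covectorWedge φ * vectorContraction E v =
      φ v • 1 - vectorContraction E v * covectorWedge φ := by
  refine LinearMap.ext fun α => ?_
  funext k; ext w
  simp only [Module.End.mul_apply, LinearMap.sub_apply, LinearMap.smul_apply, Module.End.one_apply,
    Pi.sub_apply, Pi.smul_apply, ContinuousAlternatingMap.sub_apply,
    ContinuousAlternatingMap.smul_apply, vectorContraction_apply, covectorWedge_succ]
  rw [ContinuousAlternatingMap.alternatizeUncurryFin_apply, Fin.sum_univ_succ]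
  cases k with
  | zero => simp [covectorWedge_zero]
  | succ k =>
    rw [covectorWedge_succ, ContinuousAlternatingMap.alternatizeUncurryFin_apply]
    simp only [Fin.val_zero, pow_zero, Matrix.cons_val_zero, one_smul, Fin.val_succ,
      Matrix.cons_val_succ, ContinuousLinearMap.smulRight_apply,
      ContinuousAlternatingMap.smul_apply, Fin.removeNth_zero, vectorContraction_apply]
    have h1 : Fin.tail (Matrix.vecCons v w) = w := rfl
    have h2 : ∀ i : Fin (k + 1), i.succ.removeNth (Matrix.vecCons v w) =
        Matrix.vecCons v (i.removeNth w) := by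
      intro i; funext j
      refine Fin.cases ?_ (fun j => ?_) j <;> simp [Fin.removeNth]
    simp only [h1, h2, pow_succ, smul_eq_mul]
    rw [sub_add_eq_sub_sub, sub_self, zero_sub, ← Finset.sum_neg_distrib]
    refine Finset.sum_congr rfl fun i _ => ?_
    simp

/-- Supercommutation with `φ ∧ -` and the interior product `x ↦ φ ⌟ x` are both antiderivations, and
they agree on vectors. The involution supplies the sign of passing `x`. -/
theorem covectorWedge_mul_contraction (φ : E →L[ℝ] ℝ) (x : ExteriorAlgebra ℝ E) :
    covectorWedge φ * contraction E x = contraction E (involute x) * covectorWedge φ +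
      contraction E (contractLeft (Q := (0 : QuadraticForm ℝ E)) (φ : E →ₗ[ℝ] ℝ) x) := by
  induction x using CliffordAlgebra.left_induction with
  | algebraMap r =>
    have hr : contraction E (algebraMap ℝ (CliffordAlgebra (0 : QuadraticForm ℝ E)) r) =
      algebraMap ℝ _ r := (contraction E).commutes r
    rw [contractLeft_algebraMap, involute.commutes, hr, map_zero, add_zero]
    exact (Algebra.commutes r (covectorWedge φ)).symm
  | add x y hx hy =>
    simp only [map_add, mul_add, add_mul, hx, hy]
    abel
  | ι_mul x v hx =>
    have hv : contraction E (ι 0 v) = vectorContraction E v := contraction_ι v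
    refine LinearMap.ext fun α => ?_
    have h1 := fun β => LinearMap.congr_fun (covectorWedge_mul_vectorContraction φ v) β
    have h2 := LinearMap.congr_fun hx α
    simp only [Module.End.mul_apply, LinearMap.sub_apply, LinearMap.smul_apply,
      Module.End.one_apply, LinearMap.add_apply] at h1 h2
    rw [contractLeft_ι_mul, map_mul, map_mul, involute_ι, map_sub, map_smul, map_mul, map_mul,
      map_neg, hv]
    simp only [Module.End.mul_apply, LinearMap.sub_apply, LinearMap.smul_apply,
      LinearMap.add_apply, LinearMap.neg_apply, h1, h2, map_add, ContinuousLinearMap.coe_coe]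
    abel

theorem covectorWedge_mul_contraction_of_mem (φ : E →L[ℝ] ℝ) {n : ℕ} {x : ExteriorAlgebra ℝ E}
    (hx : x ∈ ⋀[ℝ]^n E) :
    covectorWedge φ * contraction E x = (-1 : ℝ) ^ n • (contraction E x * covectorWedge φ) +
      contraction E (contractLeft (Q := (0 : QuadraticForm ℝ E)) (φ : E →ₗ[ℝ] ℝ) x) := by
  rw [covectorWedge_mul_contraction, involute_of_mem hx, map_smul, smul_mul_assoc]

end Wedge

/-! ### Calculus of forms and multivectors on the model space -/

section Local

open CliffordAlgebra Filter Topology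

variable {E : Type*} [NormedAddCommGroup E] [NormedSpace ℝ E]

instance finiteDimensional_alternating [FiniteDimensional ℝ E] (k : ℕ) :
    FiniteDimensional ℝ (E [⋀^Fin k]→L[ℝ] ℝ) := by
  let f : (E [⋀^Fin k]→L[ℝ] ℝ) →ₗ[ℝ] MultilinearMap ℝ (fun _ : Fin k => E) ℝ :=
    { toFun := fun α => α.toMultilinearMap
      map_add' := fun _ _ => rfl
      map_smul' := fun _ _ => rfl }
  refine FiniteDimensional.of_injective f fun α β h => ?_
  ext w
  exact congrArg (fun g : MultilinearMap ℝ (fun _ : Fin k => E) ℝ => g w) h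

variable [FiniteDimensional ℝ E]

instance finiteDimensional_exteriorAlgebra : FiniteDimensional ℝ (ExteriorAlgebra ℝ E) :=
  Module.Finite.of_basis (Module.finBasis ℝ E).ExteriorAlgebra

/-- Coordinates on the exterior algebra. -/
def exteriorCoord (E : Type*) [NormedAddCommGroup E] [NormedSpace ℝ E] [FiniteDimensional ℝ E] :
    ExteriorAlgebra ℝ E ≃ₗ[ℝ] (Fin (Module.finrank ℝ (ExteriorAlgebra ℝ E)) → ℝ) :=
  (Module.finBasis ℝ (ExteriorAlgebra ℝ E)).equivFun

/-- The norm is a device for differentiating multivector fields. In finite dimension its choice is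
immaterial, and `contDiffOn_exterior_iff` returns to smoothness of coordinates. -/
instance normedAddCommGroupExterior : NormedAddCommGroup (ExteriorAlgebra ℝ E) :=
  NormedAddCommGroup.induced _ _ (exteriorCoord E).toLinearMap (exteriorCoord E).injective

instance normedSpaceExterior : NormedSpace ℝ (ExteriorAlgebra ℝ E) :=
  NormedSpace.induced ℝ _ _ (exteriorCoord E).toLinearMap

theorem contDiffOn_exterior_iff {X : E → ExteriorAlgebra ℝ E} {s : Set E} :
    ContDiffOn ℝ ∞ X s ↔
      ∀ φ : Module.Dual ℝ (ExteriorAlgebra ℝ E), ContDiffOn ℝ ∞ (fun y => φ (X y)) s := by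
  constructor
  · intro h φ
    exact (LinearMap.toContinuousLinearMap φ).contDiff.comp_contDiffOn h
  · intro h
    rw [← (exteriorCoord E).toContinuousLinearEquiv.comp_contDiffOn_iff, contDiffOn_pi]
    intro i
    exact h (LinearMap.proj i ∘ₗ (exteriorCoord E).toLinearMap)

/-- The directional derivative of a family of forms of all degrees. -/
def partialForm (β : E → FormFibre E) (y v : E) : FormFibre E :=
  fun k => fderiv ℝ (fun z => β z k) y v

/-- The exterior derivative of a family of forms of all degrees. -/
def formDeriv (β : E → FormFibre E) (y : E) : FormFibre E := fun k =>
  match k with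
  | 0 => 0
  | k + 1 => extDeriv (fun z => β z k) y

/-- The coordinate functionals of the chosen basis of the model space. -/
def coordForm (E : Type*) [NormedAddCommGroup E] [NormedSpace ℝ E] [FiniteDimensional ℝ E]
    (i : Fin (Module.finrank ℝ E)) : E →L[ℝ] ℝ :=
  LinearMap.toContinuousLinearMap ((Module.finBasis ℝ E).coord i)

/-- Expanding the direction of differentiation in the basis writes the derivative of `β` as `∑ e^i ⊗
∂_i β`, and alternation makes each tensor product a wedge product. All local computations start from
this form of `d`. -/
theorem formDeriv_eq_sum (β : E → FormFibre E) (y : E) :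
    formDeriv β y =
      ∑ i, covectorWedge (coordForm E i) (partialForm β y (Module.finBasis ℝ E i)) := by
  funext k
  rw [Finset.sum_apply]
  cases k with
  | zero => simp [formDeriv, covectorWedge_zero]
  | succ k =>
    simp only [formDeriv, covectorWedge_succ, partialForm, extDeriv]
    simp only [← ContinuousAlternatingMap.alternatizeUncurryFinCLM_apply, ← map_sum]
    congr 1
    ext1 v
    rw [sum_apply]
    simp only [ContinuousLinearMap.smulRight_apply, coordForm, LinearMap.coe_toContinuousLinearMap',
      Module.Basis.coord_apply]
    conv_lhs => rw [← (Module.finBasis ℝ E).sum_repr v]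
    simp only [map_sum, map_smul]

/-- The projection onto a complement of the exterior power kills `X` near `y`, hence kills its
derivative. -/
theorem fderiv_mem_exteriorPower {n : ℕ} {X : E → ExteriorAlgebra ℝ E} {y : E}
    (hX : DifferentiableAt ℝ X y) (h : ∀ᶠ z in 𝓝 y, X z ∈ ⋀[ℝ]^n E) (v : E) :
    fderiv ℝ X y v ∈ ⋀[ℝ]^n E := by
  obtain ⟨q, hq⟩ := (⋀[ℝ]^n E).exists_isCompl
  let P := LinearMap.toContinuousLinearMap (Submodule.mkQ (⋀[ℝ]^n E))
  let _ : NormedAddCommGroup q := inferInstance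
  let Q : ExteriorAlgebra ℝ E →L[ℝ] q :=
    LinearMap.toContinuousLinearMap (Submodule.projectionOnto q (⋀[ℝ]^n E) hq.symm)
  have h1 : (fun z => Q (X z)) =ᶠ[𝓝 y] fun _ => 0 := by
    filter_upwards [h] with z hz
    exact (Submodule.projectionOnto_apply_eq_zero_iff hq.symm).2 hz
  have h2 : fderiv ℝ (fun z => Q (X z)) y = Q.comp (fderiv ℝ X y) :=
    (Q.hasFDerivAt.comp y hX.hasFDerivAt).fderiv
  rw [h1.fderiv_eq] at h2
  have h3 := congrArg (fun A => A v) h2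
  have h4 : Q (fderiv ℝ X y v) = 0 := by simpa using h3.symm
  exact (Submodule.projectionOnto_apply_eq_zero_iff hq.symm).1 h4

theorem continuous_multilinear {n : ℕ} (f : MultilinearMap ℝ (fun _ : Fin n => E) ℝ) :
    Continuous f := by
  have h : ⇑f = fun w => ∑ r : Fin n → Fin (Module.finrank ℝ E),
      (∏ i, coordForm E (r i) (w i)) * f fun i => Module.finBasis ℝ E (r i) := by
    funext w
    conv_lhs => rw [show w = fun i => ∑ j, coordForm E j (w i) • Module.finBasis ℝ E j from
      funext fun i => ((Module.finBasis ℝ E).sum_repr (w i)).symm]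
    rw [MultilinearMap.map_sum]
    exact Finset.sum_congr rfl fun r _ => f.map_smul_univ _ _
  rw [h]
  fun_prop

omit [FiniteDimensional ℝ E] in
theorem fderiv_bilinear_apply {G H K : Type*} [NormedAddCommGroup G] [NormedSpace ℝ G]
    [NormedAddCommGroup H] [NormedSpace ℝ H] [NormedAddCommGroup K] [NormedSpace ℝ K]
    (B : G →L[ℝ] H →L[ℝ] K) {f : E → G} {g : E → H} {y : E} (hf : DifferentiableAt ℝ f y)
    (hg : DifferentiableAt ℝ g y) (v : E) :
    fderiv ℝ (fun z => B (f z) (g z)) y v =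
      B (fderiv ℝ f y v) (g y) + B (f y) (fderiv ℝ g y v) := by
  have h : HasFDerivAt (fun z => B (f z)) (B.comp (fderiv ℝ f y)) y :=
    B.hasFDerivAt.comp y hf.hasFDerivAt
  rw [(h.clm_apply hg.hasFDerivAt).fderiv]
  simp [add_comm]

section Contraction

variable {n : ℕ} {X : E → ExteriorAlgebra ℝ E} {β : E → FormFibre E} {y : E}

/-- `contractionBilin` as a continuous bilinear map. -/
def contractionCLM (E : Type*) [NormedAddCommGroup E] [NormedSpace ℝ E] [FiniteDimensional ℝ E]
    (n k : ℕ) :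
    ExteriorAlgebra ℝ E →L[ℝ] (E [⋀^Fin (k + n)]→L[ℝ] ℝ) →L[ℝ] (E [⋀^Fin k]→L[ℝ] ℝ) :=
  (contractionBilin E n k).toContinuousBilinearMap

/-- Derivatives are taken one degree at a time. The degree `k` part of a contraction is a continuous
bilinear function of `X` and the single component of degree `k + n`, so the usual product rule
applies. -/
theorem contraction_eventuallyEq (h : ∀ᶠ z in 𝓝 y, X z ∈ ⋀[ℝ]^n E) (k : ℕ) :
    (fun z => contraction E (X z) (β z) k) =ᶠ[𝓝 y]
      fun z => contractionCLM E n k (X z) (β z (k + n)) := by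
  filter_upwards [h] with z hz
  exact contraction_eq_bilin hz _ _

theorem contDiffAt_contraction {r : WithTop ℕ∞} (h : ∀ᶠ z in 𝓝 y, X z ∈ ⋀[ℝ]^n E)
    (hX : ContDiffAt ℝ r X y) (hβ : ∀ k, ContDiffAt ℝ r (fun z => β z k) y) (k : ℕ) :
    ContDiffAt ℝ r (fun z => contraction E (X z) (β z) k) y :=
  (((contractionCLM E n k).contDiff.comp_contDiffAt y hX).clm_apply (hβ (k + n))
    ).congr_of_eventuallyEq
    (contraction_eventuallyEq h k)

theorem partialForm_contraction (h : ∀ᶠ z in 𝓝 y, X z ∈ ⋀[ℝ]^n E)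
    (hX : DifferentiableAt ℝ X y) (hβ : ∀ k, DifferentiableAt ℝ (fun z => β z k) y) (v : E) :
    partialForm (fun z => contraction E (X z) (β z)) y v =
      contraction E (fderiv ℝ X y v) (β y) + contraction E (X y) (partialForm β y v) := by
  funext k
  rw [partialForm, (contraction_eventuallyEq h k).fderiv_eq,
    Pi.add_apply, contraction_eq_bilin (fderiv_mem_exteriorPower hX h v),
    contraction_eq_bilin h.self_of_nhds]
  exact fderiv_bilinear_apply (contractionCLM E n k) hX (hβ _) v

/-- The Lie derivative `[d, ι_X]` in coordinates. -/
theorem lieDerivative_eq_sum (h : ∀ᶠ z in 𝓝 y, X z ∈ ⋀[ℝ]^n E)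
    (hX : DifferentiableAt ℝ X y) (hβ : ∀ k, DifferentiableAt ℝ (fun z => β z k) y) :
    formDeriv (fun z => contraction E (X z) (β z)) y -
        (-1 : ℝ) ^ n • contraction E (X y) (formDeriv β y) =
      ∑ i, (covectorWedge (coordForm E i)
          (contraction E (fderiv ℝ X y (Module.finBasis ℝ E i)) (β y)) +
        contraction E (contractLeft (Q := (0 : QuadraticForm ℝ E))
          (coordForm E i : E →ₗ[ℝ] ℝ) (X y)) (partialForm β y (Module.finBasis ℝ E i))) := by
  rw [formDeriv_eq_sum, formDeriv_eq_sum, map_sum, Finset.smul_sum, ← Finset.sum_sub_distrib]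
  refine Finset.sum_congr rfl fun i _ => ?_
  -- Passing `e^i ∧ -` across `ι_X` produces a term that cancels against `(-1)^n ι_X dβ`, and the
  -- contraction with `e^i ⌟ X`.
  have h1 := LinearMap.congr_fun
    (covectorWedge_mul_contraction_of_mem (coordForm E i) h.self_of_nhds)
    (partialForm β y (Module.finBasis ℝ E i))
  simp only [Module.End.mul_apply, LinearMap.add_apply, LinearMap.smul_apply] at h1
  rw [partialForm_contraction h hX hβ, map_add, h1]
  abel

end Contraction

/-- The Schouten bracket of multivector fields of degrees `a` and `b` on the model space. -/
def schoutenLocal (a b : ℕ) (X Y : E → ExteriorAlgebra ℝ E) (y : E) : ExteriorAlgebra ℝ E :=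
  ∑ i, (contractLeft (Q := (0 : QuadraticForm ℝ E)) (coordForm E i : E →ₗ[ℝ] ℝ) (X y) *
      fderiv ℝ Y y (Module.finBasis ℝ E i) +
    (-1 : ℝ) ^ (a * b) •
      (contractLeft (Q := (0 : QuadraticForm ℝ E)) (coordForm E i : E →ₗ[ℝ] ℝ) (Y y) *
        fderiv ℝ X y (Module.finBasis ℝ E i)))

variable {a b : ℕ} {X Y : E → ExteriorAlgebra ℝ E} {y : E}

theorem schoutenLocal_mem (hXm : ∀ᶠ z in 𝓝 y, X z ∈ ⋀[ℝ]^(a + 1) E)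
    (hYm : ∀ᶠ z in 𝓝 y, Y z ∈ ⋀[ℝ]^(b + 1) E) (hX : DifferentiableAt ℝ X y)
    (hY : DifferentiableAt ℝ Y y) :
    schoutenLocal (a + 1) (b + 1) X Y y ∈ ⋀[ℝ]^(a + b + 1) E := by
  refine Submodule.sum_mem _ fun i _ => Submodule.add_mem _ ?_ (Submodule.smul_mem _ _ ?_)
  · exact exteriorPower_mul_mem (a := a) (b := b + 1) (contractLeft_mem _ hXm.self_of_nhds)
      (fderiv_mem_exteriorPower hY hYm _)
  · have := exteriorPower_mul_mem (contractLeft_mem (coordForm E i : E →ₗ[ℝ] ℝ) hYm.self_of_nhds)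
      (fderiv_mem_exteriorPower hX hXm (Module.finBasis ℝ E i))
    rwa [show b + (a + 1) = a + b + 1 by ring] at this

theorem contDiffOn_schoutenLocal {s : Set E} (hs : IsOpen s) (hX : ContDiffOn ℝ ∞ X s)
    (hY : ContDiffOn ℝ ∞ Y s) : ContDiffOn ℝ ∞ (schoutenLocal a b X Y) s := by
  have hd : ∀ {Z : E → ExteriorAlgebra ℝ E}, ContDiffOn ℝ ∞ Z s → ∀ v,
      ContDiffOn ℝ ∞ (fun y => fderiv ℝ Z y v) s := fun hZ v =>
    (hZ.fderiv_of_isOpen hs (by simp)).clm_apply contDiffOn_const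
  have hc : ∀ {Z : E → ExteriorAlgebra ℝ E}, ContDiffOn ℝ ∞ Z s → ∀ i,
      ContDiffOn ℝ ∞ (fun y => contractLeft (Q := (0 : QuadraticForm ℝ E))
        (coordForm E i : E →ₗ[ℝ] ℝ) (Z y)) s := fun hZ i =>
    (LinearMap.toContinuousLinearMap (contractLeft (Q := (0 : QuadraticForm ℝ E))
      (coordForm E i : E →ₗ[ℝ] ℝ))).contDiff.comp_contDiffOn hZ
  have hm : ∀ {Z W : E → ExteriorAlgebra ℝ E}, ContDiffOn ℝ ∞ Z s → ContDiffOn ℝ ∞ W s →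
      ContDiffOn ℝ ∞ (fun y => Z y * W y) s := fun hZ hW =>
    ((LinearMap.mul ℝ (ExteriorAlgebra ℝ E)).toContinuousBilinearMap.contDiff.comp_contDiffOn
      hZ).clm_apply hW
  exact ContDiffOn.sum fun i _ =>
    (hm (hc hX i) (hd hY _)).add ((hm (hc hY i) (hd hX _)).const_smul _)

/-- The derived bracket `[[d, ι_X], ι_Y]` is the contraction with the Schouten bracket. -/
theorem derivedBracket_local (hXm : ∀ᶠ z in 𝓝 y, X z ∈ ⋀[ℝ]^(a + 1) E)
    (hYm : ∀ᶠ z in 𝓝 y, Y z ∈ ⋀[ℝ]^(b + 1) E) (hX : ContDiffAt ℝ 1 X y)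
    (hY : ContDiffAt ℝ 1 Y y) {β : E → FormFibre E}
    (hβ : ∀ k, ContDiffAt ℝ 1 (fun z => β z k) y) :
    formDeriv (fun z => contraction E (X z) (contraction E (Y z) (β z))) y -
        (-1 : ℝ) ^ (a + 1) • contraction E (X y)
          (formDeriv (fun z => contraction E (Y z) (β z)) y) =
      (-1 : ℝ) ^ (a * (b + 1)) • contraction E (Y y)
        (formDeriv (fun z => contraction E (X z) (β z)) y -
          (-1 : ℝ) ^ (a + 1) • contraction E (X y) (formDeriv β y)) +
      contraction E (schoutenLocal (a + 1) (b + 1) X Y y) (β y) := by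
  have hdX := hX.differentiableAt (by simp)
  have hdY := hY.differentiableAt (by simp)
  have hdβ := fun k => (hβ k).differentiableAt (by simp)
  rw [lieDerivative_eq_sum hXm hdX
      fun k => (contDiffAt_contraction hYm hY hβ k).differentiableAt (by simp),
    lieDerivative_eq_sum hXm hdX hdβ, schoutenLocal, map_sum, map_sum, LinearMap.sum_apply,
    Finset.smul_sum, ← Finset.sum_add_distrib]
  refine Finset.sum_congr rfl fun i _ => ?_
  rw [partialForm_contraction hYm hdY hdβ]
  have hX0 := hXm.self_of_nhds
  have hY0 := hYm.self_of_nhds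
  -- These relations move `ι_Y` to the left. All terms that differentiate `β` are then absorbed by
  -- the Lie derivative behind `ι_Y`; what is left over is contraction with `(e^i ⌟ X) ∂_i Y` and,
  -- from the commutator in `h3`, with `± (e^i ⌟ Y) ∂_i X`.
  have h1 := fun γ => LinearMap.congr_fun (contraction_comm
    (contractLeft_mem (coordForm E i : E →ₗ[ℝ] ℝ) hX0) hY0) γ
  have h2 := fun γ => LinearMap.congr_fun (contraction_comm
    (fderiv_mem_exteriorPower hdX hXm (Module.finBasis ℝ E i)) hY0) γ
  have h3 := fun γ => LinearMap.congr_fun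
    (covectorWedge_mul_contraction_of_mem (coordForm E i) hY0) γ
  simp only [Module.End.mul_apply, LinearMap.add_apply, LinearMap.smul_apply] at h1 h2 h3
  simp only [map_add, map_smul, map_mul, Module.End.mul_apply, LinearMap.add_apply,
    LinearMap.smul_apply, h1, h2, h3, smul_add, smul_smul, ← pow_add]
  have e : (-1 : ℝ) ^ ((a + 1) * (b + 1) + (b + 1)) = (-1) ^ (a * (b + 1)) := by
    rw [show (a + 1) * (b + 1) + (b + 1) = a * (b + 1) + 2 * (b + 1) by ring, pow_add, pow_mul _ 2]
    simp
  rw [e]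
  abel

/-- Every linear functional on `n`-vectors is contraction with some `n`-form, whose arguments are
reversed to match the order in `ι_{x₁ ⋯ xₙ}`. Thus identities checked on forms can be carried back
to multivectors. -/
theorem eq_of_contraction_eq {n : ℕ} {x z : ExteriorAlgebra ℝ E} (hx : x ∈ ⋀[ℝ]^n E)
    (hz : z ∈ ⋀[ℝ]^n E) (h : ∀ α : FormFibre E, contraction E x α = contraction E z α) :
    x = z := by
  rw [← sub_eq_zero, ← Module.forall_dual_apply_eq_zero_iff ℝ]
  intro φ
  let f : E [⋀^Fin n]→ₗ[ℝ] ℝ :=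
    (φ.compAlternatingMap (ExteriorAlgebra.ιMulti ℝ n)).domDomCongr Fin.revPerm
  let α : E [⋀^Fin n]→L[ℝ] ℝ :=
    { f with cont := continuous_multilinear f.toMultilinearMap }
  have hα : ∀ w, α w = φ (ExteriorAlgebra.ιMulti ℝ n fun i => w i.rev) := fun w => rfl
  rw [map_sub, ← contraction_ofDual φ α hα hx, ← contraction_ofDual φ α hα hz, h, sub_self]

end Local

/-! ### Contraction and exterior derivative in charts -/

section Charts

open Filter Topology

variable {E : Type*} [NormedAddCommGroup E] [NormedSpace ℝ E]
  {M : Type*} [TopologicalSpace M] [ChartedSpace E M]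

variable (E) in
/-- The derivative at `q` of the preferred chart at `p₀`, as an endomorphism of the model space. -/
def chartDeriv (p₀ q : M) : E →L[ℝ] E :=
  mfderiv 𝓘(ℝ, E) 𝓘(ℝ, E) (extChartAt 𝓘(ℝ, E) p₀) q

/-- The derivative of the inverse of the preferred chart at `p₀`. -/
def chartSymmDeriv (p₀ : M) (y : E) : E →L[ℝ] E :=
  mfderiv 𝓘(ℝ, E) 𝓘(ℝ, E) (extChartAt 𝓘(ℝ, E) p₀).symm y

/-- The value of a family of forms, read in the model space. -/
def FormField.value (α : FormField E M) (q : M) : FormFibre E := α q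

/-- The value of a family of multivectors, read in the model space. -/
def MultivectorField.value (x : MultivectorField E M) (q : M) : ExteriorAlgebra ℝ E := x q

/-- A family of forms of all degrees in the preferred chart at `p₀`. -/
def FormField.inFibreChart (α : FormField E M) (p₀ : M) (y : E) : FormFibre E :=
  fun k => α.inChart k p₀ y

theorem FormField.inFibreChart_eq (α : FormField E M) (p₀ : M) (y : E) :
    α.inFibreChart p₀ y =
      pullbackFibre (chartSymmDeriv p₀ y) (α.value ((extChartAt 𝓘(ℝ, E) p₀).symm y)) := rfl

theorem FormField.inFibreChart_sub (α β : FormField E M) (p₀ : M) (y : E) :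
    (α - β).inFibreChart p₀ y = α.inFibreChart p₀ y - β.inFibreChart p₀ y := rfl

theorem FormField.inFibreChart_smul (c : ℝ) (α : FormField E M) (p₀ : M) (y : E) :
    (c • α).inFibreChart p₀ y = c • α.inFibreChart p₀ y := rfl

theorem MultivectorField.inChart_eq (x : MultivectorField E M) (p₀ : M) (y : E) :
    x.inChart p₀ y = ExteriorAlgebra.map
      (chartDeriv E p₀ ((extChartAt 𝓘(ℝ, E) p₀).symm y)).toLinearMap
      (x.value ((extChartAt 𝓘(ℝ, E) p₀).symm y)) := rfl

theorem contract_value (x : MultivectorField E M) (α : FormField E M) (q : M) :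
    (contract x α).value q = contraction E (x.value q) (α.value q) := rfl

variable [IsManifold 𝓘(ℝ, E) ∞ M]

theorem chartDeriv_comp_chartSymmDeriv {p₀ : M} {y : E}
    (hy : y ∈ (extChartAt 𝓘(ℝ, E) p₀).target) :
    (chartDeriv E p₀ ((extChartAt 𝓘(ℝ, E) p₀).symm y)).comp (chartSymmDeriv p₀ y) =
      ContinuousLinearMap.id ℝ E := by
  have h := mfderiv_extChartAt_comp_mfderivWithin_extChartAt_symm (I := 𝓘(ℝ, E)) hy
  rw [ModelWithCorners.range_eq_univ, mfderivWithin_univ] at h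
  exact h

theorem chartSymmDeriv_comp_chartDeriv {p₀ : M} {y : E}
    (hy : y ∈ (extChartAt 𝓘(ℝ, E) p₀).target) :
    (chartSymmDeriv p₀ y).comp (chartDeriv E p₀ ((extChartAt 𝓘(ℝ, E) p₀).symm y)) =
      ContinuousLinearMap.id ℝ E := by
  have h := mfderivWithin_extChartAt_symm_comp_mfderiv_extChartAt (I := 𝓘(ℝ, E)) hy
  rw [ModelWithCorners.range_eq_univ, mfderivWithin_univ] at h
  exact h

theorem pullbackFibre_comp {V₁ V₂ V₃ : Type*} [AddCommGroup V₁] [Module ℝ V₁]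
    [TopologicalSpace V₁] [AddCommGroup V₂] [Module ℝ V₂] [TopologicalSpace V₂] [AddCommGroup V₃]
    [Module ℝ V₃] [TopologicalSpace V₃] (f : V₁ →L[ℝ] V₂) (g : V₂ →L[ℝ] V₃) (α : FormFibre V₃) :
    pullbackFibre f (pullbackFibre g α) = pullbackFibre (g.comp f) α := rfl

theorem pullbackFibre_id {V : Type*} [AddCommGroup V] [Module ℝ V] [TopologicalSpace V]
    (α : FormFibre V) : pullbackFibre (ContinuousLinearMap.id ℝ V) α = α := rfl

theorem exteriorMap_comp_apply {V₁ V₂ V₃ : Type*} [AddCommGroup V₁] [Module ℝ V₁]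
    [AddCommGroup V₂] [Module ℝ V₂] [AddCommGroup V₃]
    [Module ℝ V₃] (f : V₁ →ₗ[ℝ] V₂) (g : V₂ →ₗ[ℝ] V₃) (x : ExteriorAlgebra ℝ V₁) :
    ExteriorAlgebra.map g (ExteriorAlgebra.map f x) = ExteriorAlgebra.map (g ∘ₗ f) x := by
  rw [← ExteriorAlgebra.map_comp_map]
  rfl

theorem exteriorMap_mem {V₁ V₂ : Type*} [AddCommGroup V₁] [Module ℝ V₁]
    [AddCommGroup V₂] [Module ℝ V₂] (f : V₁ →ₗ[ℝ] V₂) {n : ℕ} {x : ExteriorAlgebra ℝ V₁}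
    (hx : x ∈ ⋀[ℝ]^n V₁) : ExteriorAlgebra.map f x ∈ ⋀[ℝ]^n V₂ := by
  refine exteriorPower_induction (p := fun n x => ExteriorAlgebra.map f x ∈ ⋀[ℝ]^n V₂) ?_ ?_ ?_ hx
  · intro r
    rw [AlgHom.commutes, ExteriorAlgebra.exteriorPower, pow_zero]
    exact Submodule.algebraMap_mem r
  · intro n x y h h'
    rw [map_add]
    exact Submodule.add_mem _ h h'
  · intro n v x _ h
    rw [map_mul, ExteriorAlgebra.map_apply_ι]
    exact ι_mul_mem _ h

omit [IsManifold 𝓘(ℝ, E) ∞ M] in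
theorem MultivectorField.inChart_mem {n : ℕ} {x : MultivectorField E M}
    (hx : x ∈ multivectorSpace E M n) (p₀ : M) (y : E) : x.inChart p₀ y ∈ ⋀[ℝ]^n E :=
  exteriorMap_mem _ (hx.2 _)

theorem MultivectorField.map_inChart {x : MultivectorField E M} {p₀ : M} {y : E}
    (hy : y ∈ (extChartAt 𝓘(ℝ, E) p₀).target) :
    ExteriorAlgebra.map (chartSymmDeriv p₀ y).toLinearMap (x.inChart p₀ y) =
      x.value ((extChartAt 𝓘(ℝ, E) p₀).symm y) := by
  rw [MultivectorField.inChart_eq, exteriorMap_comp_apply]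
  have h := congrArg ContinuousLinearMap.toLinearMap (chartSymmDeriv_comp_chartDeriv hy)
  have h' : (chartSymmDeriv p₀ y).toLinearMap ∘ₗ
      (chartDeriv E p₀ ((extChartAt 𝓘(ℝ, E) p₀).symm y)).toLinearMap = LinearMap.id := h
  rw [h', ExteriorAlgebra.map_id]
  rfl

/-- Multivectors are pushed forward by the chart and forms pulled back by its inverse, so naturality
of contraction applies wherever the two derivatives are inverse to each other. -/
theorem inFibreChart_contract (x : MultivectorField E M) (α : FormField E M) {p₀ : M} {y : E}
    (hy : y ∈ (extChartAt 𝓘(ℝ, E) p₀).target) :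
    (contract x α).inFibreChart p₀ y = contraction E (x.inChart p₀ y) (α.inFibreChart p₀ y) := by
  rw [FormField.inFibreChart_eq, FormField.inFibreChart_eq, contract_value,
    ← MultivectorField.map_inChart hy, pullbackFibre_contraction]

/-- The transition map between the preferred charts at `p₀` and `p₁`. -/
def transition (E : Type*) [NormedAddCommGroup E] [NormedSpace ℝ E] {M : Type*}
    [TopologicalSpace M] [ChartedSpace E M] (p₀ p₁ : M) (y : E) : E :=
  extChartAt 𝓘(ℝ, E) p₁ ((extChartAt 𝓘(ℝ, E) p₀).symm y)

/-! ### Changes of chart -/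

section Transition

variable {p₀ p₁ : M} {y : E} (hy : y ∈ (extChartAt 𝓘(ℝ, E) p₀).target)
  (hy' : (extChartAt 𝓘(ℝ, E) p₀).symm y ∈ (extChartAt 𝓘(ℝ, E) p₁).source)

include hy

theorem mdifferentiableAt_chart_symm : MDifferentiableAt 𝓘(ℝ, E) 𝓘(ℝ, E)
    (extChartAt 𝓘(ℝ, E) p₀).symm y := by
  have h := mdifferentiableWithinAt_extChartAt_symm (I := 𝓘(ℝ, E)) hy
  rwa [ModelWithCorners.range_eq_univ, mdifferentiableWithinAt_univ] at h

include hy'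

omit [IsManifold 𝓘(ℝ, E) ∞ M] in
omit [IsManifold 𝓘(ℝ, E) ∞ M] in
theorem eventually_mem_overlap : ∀ᶠ z in 𝓝 y, z ∈ (extChartAt 𝓘(ℝ, E) p₀).target ∧
    (extChartAt 𝓘(ℝ, E) p₀).symm z ∈ (extChartAt 𝓘(ℝ, E) p₁).source := by
  have h1 := (isOpen_extChartAt_target (I := 𝓘(ℝ, E)) p₀).mem_nhds hy
  have h2 := (continuousAt_extChartAt_symm'' (I := 𝓘(ℝ, E)) hy).preimage_mem_nhds
    ((isOpen_extChartAt_source (I := 𝓘(ℝ, E)) p₁).mem_nhds hy')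
  filter_upwards [h1, h2] with z hz hz' using ⟨hz, hz'⟩

theorem contDiffAt_transition : ContDiffAt ℝ ∞ (transition E p₀ p₁) y := by
  have h := contDiffWithinAt_ext_coord_change (I := 𝓘(ℝ, E)) (n := ∞) p₁ p₀ (y := y) ⟨hy, hy'⟩
  rw [ModelWithCorners.range_eq_univ, contDiffWithinAt_univ] at h
  exact h

theorem fderiv_transition : fderiv ℝ (transition E p₀ p₁) y =
    (chartDeriv E p₁ ((extChartAt 𝓘(ℝ, E) p₀).symm y)).comp (chartSymmDeriv p₀ y) := by
  have h1 : MDifferentiableAt 𝓘(ℝ, E) 𝓘(ℝ, E) (extChartAt 𝓘(ℝ, E) p₁)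
      ((extChartAt 𝓘(ℝ, E) p₀).symm y) := by
    apply mdifferentiableAt_extChartAt
    rwa [← extChartAt_source (I := 𝓘(ℝ, E))]
  have h := mfderiv_comp y h1 (mdifferentiableAt_chart_symm hy)
  rw [mfderiv_eq_fderiv] at h
  exact h

theorem chartSymmDeriv_comp_fderiv_transition :
    (chartSymmDeriv p₁ (transition E p₀ p₁ y)).comp (fderiv ℝ (transition E p₀ p₁) y) =
      chartSymmDeriv p₀ y := by
  have ht : transition E p₀ p₁ y ∈ (extChartAt 𝓘(ℝ, E) p₁).target :=
    (extChartAt 𝓘(ℝ, E) p₁).map_source hy'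
  have hs : (extChartAt 𝓘(ℝ, E) p₁).symm (transition E p₀ p₁ y) =
    (extChartAt 𝓘(ℝ, E) p₀).symm y := (extChartAt 𝓘(ℝ, E) p₁).left_inv hy'
  have h := chartSymmDeriv_comp_chartDeriv ht
  rw [hs] at h
  rw [fderiv_transition hy hy', ← ContinuousLinearMap.comp_assoc, h, ContinuousLinearMap.id_comp]

theorem inFibreChart_transition (α : FormField E M) :
    α.inFibreChart p₀ y = pullbackFibre (fderiv ℝ (transition E p₀ p₁) y)
      (α.inFibreChart p₁ (transition E p₀ p₁ y)) := by
  have hs : (extChartAt 𝓘(ℝ, E) p₁).symm (transition E p₀ p₁ y) =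
    (extChartAt 𝓘(ℝ, E) p₀).symm y := (extChartAt 𝓘(ℝ, E) p₁).left_inv hy'
  rw [FormField.inFibreChart_eq, FormField.inFibreChart_eq, pullbackFibre_comp,
    chartSymmDeriv_comp_fderiv_transition hy hy', hs]

theorem inChart_eventuallyEq_transition (α : FormField E M) (k : ℕ) :
    α.inChart k p₀ =ᶠ[𝓝 y] fun z => (α.inChart k p₁ (transition E p₀ p₁ z)).compContinuousLinearMap
      (fderiv ℝ (transition E p₀ p₁) z) := by
  filter_upwards [eventually_mem_overlap hy hy'] with z hz
  exact congrFun (inFibreChart_transition hz.1 hz.2 α) k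

end Transition

/-- On multilinear forms, pullback is a continuous multilinear function of the linear maps.
Alternating forms are embedded there by `T`, and a linear left inverse `P` of `T`, continuous in
finite dimension, leads back. -/
theorem contDiffAt_compContinuousLinearMap [FiniteDimensional ℝ E] {k : ℕ}
    {f : E → E [⋀^Fin k]→L[ℝ] ℝ} {g : E → E →L[ℝ] E} {y : E}
    (hf : ContDiffAt ℝ ∞ f y) (hg : ContDiffAt ℝ ∞ g y) :
    ContDiffAt ℝ ∞ (fun z => (f z).compContinuousLinearMap (g z)) y := by
  let T : (E [⋀^Fin k]→L[ℝ] ℝ) →L[ℝ] ContinuousMultilinearMap ℝ (fun _ : Fin k => E) ℝ :=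
    ContinuousAlternatingMap.toContinuousMultilinearMapCLM ℝ
  let F : ContinuousMultilinearMap ℝ (fun _ : Fin k => E) ℝ →ₗ[ℝ]
      MultilinearMap ℝ (fun _ : Fin k => E) ℝ :=
    { toFun := fun g => g.toMultilinearMap
      map_add' := fun _ _ => rfl
      map_smul' := fun _ _ => rfl }
  have : FiniteDimensional ℝ (ContinuousMultilinearMap ℝ (fun _ : Fin k => E) ℝ) :=
    FiniteDimensional.of_injective F ContinuousMultilinearMap.toMultilinearMap_injective
  obtain ⟨P₀, hP₀⟩ := LinearMap.exists_leftInverse_of_injective T.toLinearMap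
    (LinearMap.ker_eq_bot.2 ContinuousAlternatingMap.toContinuousMultilinearMap_injective)
  let P := LinearMap.toContinuousLinearMap P₀
  have hPT : ∀ α, P (T α) = α := fun α => LinearMap.congr_fun hP₀ α
  have hC : ContDiff ℝ ∞ (fun h : Fin k → E →L[ℝ] E =>
      ContinuousMultilinearMap.compContinuousLinearMapContinuousMultilinear ℝ
        (fun _ : Fin k => E) (fun _ => E) ℝ h) := by
    apply ContinuousMultilinearMap.contDiff
  have h0 := hC.comp_contDiffAt y (contDiffAt_pi.2 fun _ : Fin k => hg)
  have hTf : ContDiffAt ℝ ∞ (fun z => T (f z)) y := T.contDiff.comp_contDiffAt y hf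
  have h1 := h0.clm_apply hTf
  have h2 := P.contDiff.comp_contDiffAt y h1
  refine h2.congr_of_eventuallyEq (Eventually.of_forall fun z => ?_)
  exact (hPT _).symm

theorem contDiffAt_inChart_of_transition [FiniteDimensional ℝ E] {p₀ p₁ : M} {y : E}
    (hy : y ∈ (extChartAt 𝓘(ℝ, E) p₀).target)
    (hy' : (extChartAt 𝓘(ℝ, E) p₀).symm y ∈ (extChartAt 𝓘(ℝ, E) p₁).source) {α : FormField E M}
    {k : ℕ} (h : ContDiffAt ℝ ∞ (α.inChart k p₁) (transition E p₀ p₁ y)) :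
    ContDiffAt ℝ ∞ (α.inChart k p₀) y := by
  refine ContDiffAt.congr_of_eventuallyEq ?_ (inChart_eventuallyEq_transition hy hy' α k)
  have ht := contDiffAt_transition hy hy'
  exact contDiffAt_compContinuousLinearMap (h.comp y ht) (ht.fderiv_right (by simp))

omit [IsManifold 𝓘(ℝ, E) ∞ M] in
theorem transition_transition {p₀ p₁ : M} {y : E} (hy : y ∈ (extChartAt 𝓘(ℝ, E) p₀).target)
    (hy' : (extChartAt 𝓘(ℝ, E) p₀).symm y ∈ (extChartAt 𝓘(ℝ, E) p₁).source) :
    transition E p₁ p₀ (transition E p₀ p₁ y) = y := by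
  rw [transition, transition, (extChartAt 𝓘(ℝ, E) p₁).left_inv hy',
    (extChartAt 𝓘(ℝ, E) p₀).right_inv hy]

theorem contDiffAt_inChart_transition [FiniteDimensional ℝ E] {p₀ p₁ : M} {y : E}
    (hy : y ∈ (extChartAt 𝓘(ℝ, E) p₀).target)
    (hy' : (extChartAt 𝓘(ℝ, E) p₀).symm y ∈ (extChartAt 𝓘(ℝ, E) p₁).source) {α : FormField E M}
    {k : ℕ} (h : ContDiffAt ℝ ∞ (α.inChart k p₀) y) :
    ContDiffAt ℝ ∞ (α.inChart k p₁) (transition E p₀ p₁ y) := by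
  have hs : (extChartAt 𝓘(ℝ, E) p₁).symm (transition E p₀ p₁ y) =
    (extChartAt 𝓘(ℝ, E) p₀).symm y := (extChartAt 𝓘(ℝ, E) p₁).left_inv hy'
  refine contDiffAt_inChart_of_transition (p₁ := p₀) ((extChartAt 𝓘(ℝ, E) p₁).map_source hy') ?_ ?_
  · change (extChartAt 𝓘(ℝ, E) p₁).symm (transition E p₀ p₁ y) ∈ _
    rw [hs]
    exact (extChartAt 𝓘(ℝ, E) p₀).map_target hy
  · change ContDiffAt ℝ ∞ (α.inChart k p₀) (transition E p₁ p₀ (transition E p₀ p₁ y))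
    rwa [transition_transition hy hy']

theorem two_le_smooth : minSmoothness ℝ 2 ≤ (∞ : WithTop ℕ∞) := by
  rw [minSmoothness_of_isRCLikeNormedField]
  exact WithTop.coe_le_coe.2 le_top

/-- The exterior derivative can be computed in every chart. -/
theorem inFibreChart_extD [FiniteDimensional ℝ E] {p₀ : M} {y : E}
    (hy : y ∈ (extChartAt 𝓘(ℝ, E) p₀).target) {α : FormField E M}
    (h : ∀ k, ContDiffAt ℝ ∞ (α.inChart k p₀) y) :
    (extD α).inFibreChart p₀ y = formDeriv (α.inFibreChart p₀) y := by
  funext k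
  cases k with
  | zero => rfl
  | succ k =>
    -- `extD` uses the preferred chart of the point itself. It is compared with the chart at `p₀`
    -- through the transition map, along which pullback commutes with `d`.
    set p₁ := (extChartAt 𝓘(ℝ, E) p₀).symm y with hp₁
    have hy' : (extChartAt 𝓘(ℝ, E) p₀).symm y ∈ (extChartAt 𝓘(ℝ, E) p₁).source :=
      mem_extChartAt_source p₁
    have h1 : (extD α).inFibreChart p₀ y (k + 1) =
        (extDeriv (α.inChart k p₁) (transition E p₀ p₁ y)).compContinuousLinearMap
          ((chartDeriv E p₁ ((extChartAt 𝓘(ℝ, E) p₀).symm y)).comp (chartSymmDeriv p₀ y)) := rfl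
    have h2 : formDeriv (α.inFibreChart p₀) y (k + 1) = extDeriv (α.inChart k p₀) y := rfl
    rw [h1, h2, (inChart_eventuallyEq_transition hy hy' α k).extDeriv_eq,
      extDeriv_pullback ((contDiffAt_inChart_transition hy hy' (h k)).differentiableAt (by simp))
        (contDiffAt_transition hy hy') two_le_smooth, fderiv_transition hy hy']

end Charts

/-! ### The Cartan calculus of smooth forms and multivector fields -/

section Global

open Filter Topology

variable {E : Type*} [NormedAddCommGroup E] [NormedSpace ℝ E] [FiniteDimensional ℝ E]
  {M : Type*} [TopologicalSpace M] [ChartedSpace E M]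

omit [FiniteDimensional ℝ E] in
theorem FormField.ext_value {α β : FormField E M} (h : ∀ q, α.value q = β.value q) : α = β :=
  funext h

theorem MultivectorField.contDiffOn_inChart {n : ℕ} {x : MultivectorField E M}
    (hx : x ∈ multivectorSpace E M n) (p₀ : M) :
    ContDiffOn ℝ ∞ (x.inChart p₀) (extChartAt 𝓘(ℝ, E) p₀).target :=
  contDiffOn_exterior_iff.2 fun φ => hx.1 φ p₀

theorem MultivectorField.contDiffAt_inChart {n : ℕ} {x : MultivectorField E M}
    (hx : x ∈ multivectorSpace E M n) {p₀ : M} {y : E}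
    (hy : y ∈ (extChartAt 𝓘(ℝ, E) p₀).target) : ContDiffAt ℝ ∞ (x.inChart p₀) y :=
  (MultivectorField.contDiffOn_inChart hx p₀).contDiffAt
    ((isOpen_extChartAt_target (I := 𝓘(ℝ, E)) p₀).mem_nhds hy)

omit [FiniteDimensional ℝ E] in
theorem FormField.IsSmooth.contDiffAt {α : FormField E M} (hα : α.IsSmooth) {p₀ : M} {y : E}
    (hy : y ∈ (extChartAt 𝓘(ℝ, E) p₀).target) (k : ℕ) : ContDiffAt ℝ ∞ (α.inChart k p₀) y :=
  (hα k p₀).contDiffAt ((isOpen_extChartAt_target (I := 𝓘(ℝ, E)) p₀).mem_nhds hy)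

omit [FiniteDimensional ℝ E] in
theorem FormField.isSmooth_iff {α : FormField E M} : α.IsSmooth ↔
    ∀ (p₀ : M) (y : E), y ∈ (extChartAt 𝓘(ℝ, E) p₀).target →
      ∀ k, ContDiffAt ℝ ∞ (α.inChart k p₀) y :=
  ⟨fun h _ _ hy k => h.contDiffAt hy k, fun h k p₀ y hy => (h p₀ y hy k).contDiffWithinAt⟩

omit [FiniteDimensional ℝ E] in
theorem extD_add_of_isSmooth {α β : FormField E M} (hα : α.IsSmooth) (hβ : β.IsSmooth) :
    extD (α + β) = extD α + extD β := by
  funext p l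
  cases l with
  | zero => simp [extD]
  | succ l =>
    simp only [extD, Pi.add_apply, FormField.inChart_add]
    rw [extDeriv_add ((hα.contDiffAt (mem_extChartAt_target p) l).differentiableAt (by simp))
      ((hβ.contDiffAt (mem_extChartAt_target p) l).differentiableAt (by simp))]
    rfl

variable [IsManifold 𝓘(ℝ, E) ∞ M]

/-- Smoothness is assumed at one point of one chart only: the forms that later test the Schouten
bracket are smooth merely on a chart domain. -/
theorem contDiffAt_inChart_contract {n : ℕ} {x : MultivectorField E M}
    (hx : x ∈ multivectorSpace E M n) {α : FormField E M} {p₀ : M} {y : E}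
    (hy : y ∈ (extChartAt 𝓘(ℝ, E) p₀).target) (hα : ∀ k, ContDiffAt ℝ ∞ (α.inChart k p₀) y)
    (k : ℕ) : ContDiffAt ℝ ∞ ((contract x α).inChart k p₀) y := by
  have h : (contract x α).inChart k p₀ =ᶠ[𝓝 y]
      fun z => contraction E (x.inChart p₀ z) (α.inFibreChart p₀ z) k := by
    filter_upwards [(isOpen_extChartAt_target (I := 𝓘(ℝ, E)) p₀).mem_nhds hy] with z hz
    exact congrFun (inFibreChart_contract x α hz) k
  exact (contDiffAt_contraction (Eventually.of_forall fun z =>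
    MultivectorField.inChart_mem hx p₀ z) (MultivectorField.contDiffAt_inChart hx hy) hα
      k).congr_of_eventuallyEq h

theorem isSmooth_contract {n : ℕ} {x : MultivectorField E M}
    (hx : x ∈ multivectorSpace E M n) {α : FormField E M} (hα : α.IsSmooth) :
    (contract x α).IsSmooth :=
  FormField.isSmooth_iff.2 fun _ _ hy =>
    contDiffAt_inChart_contract hx hy fun _ => hα.contDiffAt hy _

omit [FiniteDimensional ℝ E] [IsManifold 𝓘(ℝ, E) ∞ M] in
theorem formDeriv_congr {β γ : E → FormFibre E} {y : E} (h : β =ᶠ[𝓝 y] γ) :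
    formDeriv β y = formDeriv γ y := by
  funext k
  cases k with
  | zero => rfl
  | succ k =>
    exact Filter.EventuallyEq.extDeriv_eq (h.mono fun z hz => congrFun hz k)

theorem inChart_extD_eventuallyEq {α : FormField E M} (hα : α.IsSmooth) {p₀ : M} {y : E}
    (hy : y ∈ (extChartAt 𝓘(ℝ, E) p₀).target) (k : ℕ) :
    (extD α).inChart (k + 1) p₀ =ᶠ[𝓝 y] extDeriv (α.inChart k p₀) := by
  filter_upwards [(isOpen_extChartAt_target (I := 𝓘(ℝ, E)) p₀).mem_nhds hy] with z hz
  exact congrFun (inFibreChart_extD hz fun _ => hα.contDiffAt hz _) (k + 1)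

omit [FiniteDimensional ℝ E] [IsManifold 𝓘(ℝ, E) ∞ M] in
theorem inChart_extD_zero (α : FormField E M) (p₀ : M) : (extD α).inChart 0 p₀ = 0 := rfl

theorem isSmooth_extD {α : FormField E M} (hα : α.IsSmooth) : (extD α).IsSmooth := by
  refine FormField.isSmooth_iff.2 fun p₀ y hy k => ?_
  cases k with
  | zero => rw [inChart_extD_zero]; exact contDiffAt_const
  | succ k =>
    refine ContDiffAt.congr_of_eventuallyEq ?_ (inChart_extD_eventuallyEq hα hy k)
    exact (ContinuousAlternatingMap.alternatizeUncurryFinCLM ℝ E ℝ).contDiff.comp_contDiffAt y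
      ((hα.contDiffAt hy k).fderiv_right (m := ∞) (by simp))

omit [FiniteDimensional ℝ E] in
theorem extDeriv_zero {k : ℕ} (y : E) : extDeriv (0 : E → E [⋀^Fin k]→L[ℝ] ℝ) y = 0 := by
  simpa using extDeriv_smul (x := y) (0 : ℝ) (0 : E → E [⋀^Fin k]→L[ℝ] ℝ)

theorem extD_extD {α : FormField E M} (hα : α.IsSmooth) : extD (extD α) = 0 := by
  funext p k
  cases k with
  | zero => rfl
  | succ k =>
    have hp : extChartAt 𝓘(ℝ, E) p p ∈ (extChartAt 𝓘(ℝ, E) p).target := mem_extChartAt_target p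
    have h : extDeriv ((extD α).inChart k p) (extChartAt 𝓘(ℝ, E) p p) = 0 := by
      -- The degree zero component of `dα` is zero by definition; in higher degrees `d² = 0` is that
      -- of the model space.
      cases k with
      | zero =>
        rw [inChart_extD_zero]
        exact extDeriv_zero _
      | succ k =>
        rw [(inChart_extD_eventuallyEq hα hp k).extDeriv_eq]
        exact extDeriv_extDeriv_apply (hα.contDiffAt hp k) two_le_smooth
    simp only [extD, h]
    rfl

/-- The Lie derivative `[d, ι_x]` along a multivector field of degree `n`. -/
def lieD (n : ℕ) (x : MultivectorField E M) (α : FormField E M) : FormField E M :=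
  extD (contract x α) - (-1 : ℝ) ^ n • contract x (extD α)

/-! ### The Schouten bracket of multivector fields -/

section Schouten

variable {a b : ℕ} {x y : MultivectorField E M}

/-- The derived bracket `[[d, ι_x], ι_y]` in a chart. -/
theorem derivedBracket_inFibreChart (hx : x ∈ multivectorSpace E M (a + 1))
    (hy : y ∈ multivectorSpace E M (b + 1)) {p₀ : M} {z : E}
    (hz : z ∈ (extChartAt 𝓘(ℝ, E) p₀).target) {α : FormField E M}
    (hα : ∀ k, ContDiffAt ℝ ∞ (α.inChart k p₀) z) :
    (lieD (a + 1) x (contract y α) -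
        (-1 : ℝ) ^ (a * (b + 1)) • contract y (lieD (a + 1) x α)).inFibreChart p₀ z =
      contraction E (schoutenLocal (a + 1) (b + 1) (x.inChart p₀) (y.inChart p₀) z)
        (α.inFibreChart p₀ z) := by
  have hd : ∀ u : MultivectorField E M,
      formDeriv ((contract u α).inFibreChart p₀) z =
        formDeriv (fun w => contraction E (u.inChart p₀ w) (α.inFibreChart p₀ w)) z :=
    fun u => formDeriv_congr (by
      filter_upwards [(isOpen_extChartAt_target (I := 𝓘(ℝ, E)) p₀).mem_nhds hz] with w hw
      exact inFibreChart_contract u α hw)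
  have hd2 : formDeriv ((contract x (contract y α)).inFibreChart p₀) z =
        formDeriv (fun w => contraction E (x.inChart p₀ w)
          (contraction E (y.inChart p₀ w) (α.inFibreChart p₀ w))) z :=
    formDeriv_congr (by
      filter_upwards [(isOpen_extChartAt_target (I := 𝓘(ℝ, E)) p₀).mem_nhds hz] with w hw
      rw [inFibreChart_contract _ _ hw, inFibreChart_contract _ _ hw])
  have hyα := contDiffAt_inChart_contract hy hz hα
  have hxα := contDiffAt_inChart_contract hx hz hα
  have hxyα := contDiffAt_inChart_contract hx hz hyα
  simp only [lieD, FormField.inFibreChart_sub, FormField.inFibreChart_smul,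
    inFibreChart_contract _ _ hz, inFibreChart_extD hz hα, inFibreChart_extD hz hyα,
    inFibreChart_extD hz hxα, inFibreChart_extD hz hxyα, hd x, hd y, hd2]
  rw [derivedBracket_local (Eventually.of_forall fun w => MultivectorField.inChart_mem hx p₀ w)
    (Eventually.of_forall fun w => MultivectorField.inChart_mem hy p₀ w)
    ((MultivectorField.contDiffAt_inChart hx hz).of_le (by simp))
    ((MultivectorField.contDiffAt_inChart hy hz).of_le (by simp))
    (β := α.inFibreChart p₀) (fun k => (hα k).of_le (by simp)), add_sub_cancel_left]

/-- The Schouten bracket of multivector fields of degrees `a` and `b`. -/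
def schouten (a b : ℕ) (x y : MultivectorField E M) : MultivectorField E M := fun p =>
  ExteriorAlgebra.map (chartSymmDeriv p (extChartAt 𝓘(ℝ, E) p p)).toLinearMap
    (schoutenLocal a b (x.inChart p) (y.inChart p) (extChartAt 𝓘(ℝ, E) p p))

omit [FiniteDimensional ℝ E] in
theorem chartSymmDeriv_comp_chartDeriv_self (p : M) :
    (chartSymmDeriv p (extChartAt 𝓘(ℝ, E) p p)).comp (chartDeriv E p p) =
      ContinuousLinearMap.id ℝ E := by
  have h := chartSymmDeriv_comp_chartDeriv (mem_extChartAt_target (I := 𝓘(ℝ, E)) p)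
  rwa [(extChartAt 𝓘(ℝ, E) p).left_inv (mem_extChartAt_source p)] at h

/-- At `p` the bracket is computed in the preferred chart at `p`, where the local formula holds. The
derivative of that chart carries the identity back to the tangent space. -/
theorem contract_schouten_value (hx : x ∈ multivectorSpace E M (a + 1))
    (hy : y ∈ multivectorSpace E M (b + 1)) {p : M} {α : FormField E M}
    (hα : ∀ k, ContDiffAt ℝ ∞ (α.inChart k p) (extChartAt 𝓘(ℝ, E) p p)) :
    (contract (schouten (a + 1) (b + 1) x y) α).value p =
      (lieD (a + 1) x (contract y α) -
        (-1 : ℝ) ^ (a * (b + 1)) • contract y (lieD (a + 1) x α)).value p := by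
  have hp : extChartAt 𝓘(ℝ, E) p p ∈ (extChartAt 𝓘(ℝ, E) p).target := mem_extChartAt_target p
  have hpp : (extChartAt 𝓘(ℝ, E) p).symm (extChartAt 𝓘(ℝ, E) p p) = p :=
    (extChartAt 𝓘(ℝ, E) p).left_inv (mem_extChartAt_source p)
  have h := derivedBracket_inFibreChart hx hy hp hα
  have h2 : pullbackFibre (chartSymmDeriv p (extChartAt 𝓘(ℝ, E) p p))
      ((contract (schouten (a + 1) (b + 1) x y) α).value p) =
      contraction E (schoutenLocal (a + 1) (b + 1) (x.inChart p) (y.inChart p)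
        (extChartAt 𝓘(ℝ, E) p p)) (pullbackFibre (chartSymmDeriv p (extChartAt 𝓘(ℝ, E) p p))
          (α.value p)) :=
    pullbackFibre_contraction _ _ _
  rw [FormField.inFibreChart_eq, FormField.inFibreChart_eq, hpp, ← h2] at h
  have h' := congrArg (pullbackFibre (chartDeriv E p p)) h
  rw [pullbackFibre_comp, pullbackFibre_comp, chartSymmDeriv_comp_chartDeriv_self,
    pullbackFibre_id, pullbackFibre_id] at h'
  exact h'.symm

open scoped Classical in
/-- The family of forms that is constant in the preferred chart at `p₀`, extended by zero. -/
def chartConstant (p₀ : M) (α₀ : FormFibre E) : FormField E M := fun q =>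
  if q ∈ (extChartAt 𝓘(ℝ, E) p₀).source then pullbackFibre (chartDeriv E p₀ q) α₀ else 0

omit [FiniteDimensional ℝ E] in
theorem inFibreChart_chartConstant (p₀ : M) (α₀ : FormFibre E) {z : E}
    (hz : z ∈ (extChartAt 𝓘(ℝ, E) p₀).target) :
    (chartConstant p₀ α₀).inFibreChart p₀ z = α₀ := by
  have h : (chartConstant p₀ α₀ : FormField E M).value ((extChartAt 𝓘(ℝ, E) p₀).symm z) =
      pullbackFibre (chartDeriv E p₀ ((extChartAt 𝓘(ℝ, E) p₀).symm z)) α₀ :=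
    if_pos ((extChartAt 𝓘(ℝ, E) p₀).map_target hz)
  rw [FormField.inFibreChart_eq, h, pullbackFibre_comp, chartDeriv_comp_chartSymmDeriv hz,
    pullbackFibre_id]

omit [FiniteDimensional ℝ E] in
theorem contDiffAt_chartConstant (p₀ : M) (α₀ : FormFibre E) {z : E}
    (hz : z ∈ (extChartAt 𝓘(ℝ, E) p₀).target) (k : ℕ) :
    ContDiffAt ℝ ∞ ((chartConstant p₀ α₀).inChart k p₀) z := by
  refine contDiffAt_const (c := α₀ k) |>.congr_of_eventuallyEq ?_
  filter_upwards [(isOpen_extChartAt_target (I := 𝓘(ℝ, E)) p₀).mem_nhds hz] with w hw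
  exact congrFun (inFibreChart_chartConstant p₀ α₀ hw) k

omit [IsManifold 𝓘(ℝ, E) ∞ M] in
theorem schouten_value_mem (hx : x ∈ multivectorSpace E M (a + 1))
    (hy : y ∈ multivectorSpace E M (b + 1)) (p : M) :
    schouten (a + 1) (b + 1) x y p ∈ ⋀[ℝ]^(a + b + 1) (TangentSpace 𝓘(ℝ, E) p) := by
  have hp : extChartAt 𝓘(ℝ, E) p p ∈ (extChartAt 𝓘(ℝ, E) p).target := mem_extChartAt_target p
  have h := schoutenLocal_mem (Eventually.of_forall fun w => MultivectorField.inChart_mem hx p w)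
    (Eventually.of_forall fun w => MultivectorField.inChart_mem hy p w)
    ((MultivectorField.contDiffAt_inChart hx hp).differentiableAt (by simp))
    ((MultivectorField.contDiffAt_inChart hy hp).differentiableAt (by simp))
  exact exteriorMap_mem (chartSymmDeriv p (extChartAt 𝓘(ℝ, E) p p)).toLinearMap h

/-- The definition uses another chart at every point, so it does not show smoothness. But the
derived bracket involves only `extD` and `contract`, which are compatible with all charts. Tested on
forms constant in the chart at `p₀`, both sides have equal contractions, and contractions separate
multivectors. -/
theorem schouten_inChart (hx : x ∈ multivectorSpace E M (a + 1))
    (hy : y ∈ multivectorSpace E M (b + 1)) {p₀ : M} {z : E}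
    (hz : z ∈ (extChartAt 𝓘(ℝ, E) p₀).target) :
    (schouten (a + 1) (b + 1) x y).inChart p₀ z =
      schoutenLocal (a + 1) (b + 1) (x.inChart p₀) (y.inChart p₀) z := by
  refine eq_of_contraction_eq (n := a + b + 1) (exteriorMap_mem _ (schouten_value_mem hx hy _))
    (schoutenLocal_mem (Eventually.of_forall fun w => MultivectorField.inChart_mem hx p₀ w)
    (Eventually.of_forall fun w => MultivectorField.inChart_mem hy p₀ w)
    ((MultivectorField.contDiffAt_inChart hx hz).differentiableAt (by simp))
    ((MultivectorField.contDiffAt_inChart hy hz).differentiableAt (by simp))) fun α₀ => ?_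
  have hα := contDiffAt_chartConstant p₀ α₀ hz
  have h1 := derivedBracket_inFibreChart hx hy hz hα
  have h2 := inFibreChart_contract (schouten (a + 1) (b + 1) x y) (chartConstant p₀ α₀) hz
  rw [inFibreChart_chartConstant p₀ α₀ hz] at h1 h2
  rw [← h1, ← h2, FormField.inFibreChart_eq, FormField.inFibreChart_eq]
  congr 1
  exact contract_schouten_value hx hy fun k =>
    contDiffAt_inChart_transition hz (mem_extChartAt_source _) (hα k)

theorem schouten_mem (hx : x ∈ multivectorSpace E M (a + 1))
    (hy : y ∈ multivectorSpace E M (b + 1)) :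
    schouten (a + 1) (b + 1) x y ∈ multivectorSpace E M (a + b + 1) := by
  refine ⟨fun φ p₀ => ?_, schouten_value_mem hx hy⟩
  refine (contDiffOn_exterior_iff.1 (contDiffOn_schoutenLocal (a := a + 1) (b := b + 1)
    (isOpen_extChartAt_target (I := 𝓘(ℝ, E)) p₀) (MultivectorField.contDiffOn_inChart hx p₀)
    (MultivectorField.contDiffOn_inChart hy p₀)) φ).congr fun z hz => ?_
  rw [schouten_inChart hx hy hz]

/-- The derived bracket `[[d, ι_x], ι_y]` is the contraction with the Schouten bracket. -/
theorem lieD_contract (hx : x ∈ multivectorSpace E M (a + 1))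
    (hy : y ∈ multivectorSpace E M (b + 1)) {α : FormField E M} (hα : α.IsSmooth) :
    lieD (a + 1) x (contract y α) =
      contract (schouten (a + 1) (b + 1) x y) α +
        (-1 : ℝ) ^ (a * (b + 1)) • contract y (lieD (a + 1) x α) := by
  rw [← sub_eq_iff_eq_add]
  exact (FormField.ext_value fun p => contract_schouten_value hx hy fun k =>
    hα.contDiffAt (mem_extChartAt_target p) k).symm

end Schouten

end Global

/-! ### Degrees, and contraction operators on smooth forms -/

section Operators

variable {E : Type*} [NormedAddCommGroup E] [NormedSpace ℝ E]
  {M : Type*} [TopologicalSpace M] [ChartedSpace E M]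

theorem contract_mul (x y : MultivectorField E M) (α : FormField E M) :
    contract (x * y) α = contract x (contract y α) := by
  funext p
  simp [contract]

theorem contract_one (α : FormField E M) : contract (1 : MultivectorField E M) α = α := by
  funext p
  simp [contract]

theorem contract_smul_left (c : ℝ) (x : MultivectorField E M) (α : FormField E M) :
    contract (c • x) α = c • contract x α := by
  funext p
  simp [contract]

theorem contract_add_left (x y : MultivectorField E M) (α : FormField E M) :
    contract (x + y) α = contract x α + contract y α := by
  funext p
  simp [contract]

theorem contract_add_right (x : MultivectorField E M) (α β : FormField E M) :
    contract x (α + β) = contract x α + contract x β := by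
  funext p
  simp [contract]

theorem contract_smul_right (c : ℝ) (x : MultivectorField E M) (α : FormField E M) :
    contract x (c • α) = c • contract x α := by
  funext p
  simp [contract]

theorem contract_zero_right (x : MultivectorField E M) :
    contract x (0 : FormField E M) = 0 := by
  funext p
  simp [contract]

theorem multivector_mul_comm {a b : ℕ} {x y : MultivectorField E M}
    (hx : x ∈ multivectorSpace E M a) (hy : y ∈ multivectorSpace E M b) :
    x * y = (-1 : ℝ) ^ (a * b) • (y * x) :=
  funext fun p => exteriorPower_mul_comm (hx.2 p) (hy.2 p)

theorem contract_comm {a b : ℕ} {x y : MultivectorField E M}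
    (hx : x ∈ multivectorSpace E M a) (hy : y ∈ multivectorSpace E M b) (α : FormField E M) :
    contract x (contract y α) = (-1 : ℝ) ^ (a * b) • contract y (contract x α) := by
  rw [← contract_mul, multivector_mul_comm hx hy, contract_smul_left, contract_mul]

theorem extD_mem_degree {k : ℕ} {α : FormField E M} (hα : ∀ p l, l ≠ k → α p l = 0)
    (p : M) (l : ℕ) (h : l ≠ k + 1) : extD α p l = 0 := by
  cases l with
  | zero => rfl
  | succ l =>
    have h1 : α.inChart l p = 0 := by
      funext y
      change (α ((extChartAt 𝓘(ℝ, E) p).symm y) l).compContinuousLinearMap _ = 0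
      rw [hα _ l (by omega)]
      rfl
    simp only [extD, h1, extDeriv_zero]
    rfl

variable (E M) in
/-- The space of smooth differential forms of all degrees. -/
def smoothForms : Submodule ℝ (FormField E M) where
  carrier := {α | α.IsSmooth}
  add_mem' := fun {α β} hα hβ k p₀ => by
    rw [FormField.inChart_add]
    exact (hα k p₀).add (hβ k p₀)
  zero_mem' := fun k p₀ => by
    rw [FormField.inChart_zero]
    exact contDiffOn_const
  smul_mem' := fun c α hα k p₀ => by
    rw [FormField.inChart_smul]
    exact (hα k p₀).const_smul c

variable (E M) in
/-- The smooth differential forms of all degrees, as a type. -/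
def SmoothForm : Type _ := smoothForms E M

instance : AddCommGroup (SmoothForm E M) := inferInstanceAs (AddCommGroup (smoothForms E M))

instance : Module ℝ (SmoothForm E M) := inferInstanceAs (Module ℝ (smoothForms E M))

variable (E M) in
/-- The inclusion of the smooth forms into the families of forms. -/
def SmoothForm.val : SmoothForm E M →ₗ[ℝ] FormField E M where
  toFun α := Subtype.val (p := fun α : FormField E M => α ∈ smoothForms E M) α
  map_add' _ _ := rfl
  map_smul' _ _ := rfl

theorem SmoothForm.ext {α β : SmoothForm E M} (h : SmoothForm.val E M α = SmoothForm.val E M β) :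
    α = β :=
  Subtype.ext h

theorem SmoothForm.isSmooth (α : SmoothForm E M) : (SmoothForm.val E M α).IsSmooth :=
  Subtype.prop (p := fun α : FormField E M => α ∈ smoothForms E M) α

/-- A smooth form as an element of the space of smooth forms. -/
def SmoothForm.mk (α : FormField E M) (hα : α.IsSmooth) : SmoothForm E M :=
  Subtype.mk (p := fun α : FormField E M => α ∈ smoothForms E M) α hα

variable [FiniteDimensional ℝ E] [IsManifold 𝓘(ℝ, E) ∞ M]

theorem extD_mem_formSpace {k : ℕ} {α : FormField E M} (hα : α ∈ formSpace E M k) :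
    extD α ∈ formSpace E M (k + 1) :=
  ⟨isSmooth_extD hα.1, extD_mem_degree hα.2⟩

variable (E M) in
/-- The exterior derivative as an operator on smooth forms. -/
def extDOp : Module.End ℝ (SmoothForm E M) where
  toFun α := SmoothForm.mk (extD (SmoothForm.val E M α)) (isSmooth_extD α.isSmooth)
  map_add' α β := SmoothForm.ext (extD_add_of_isSmooth α.isSmooth β.isSmooth)
  map_smul' c α := SmoothForm.ext (extD_smul c (SmoothForm.val E M α))

/-- The contraction with a multivector field as an operator on smooth forms. -/
def contractOp {n : ℕ} {x : MultivectorField E M} (hx : x ∈ multivectorSpace E M n) :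
    Module.End ℝ (SmoothForm E M) where
  toFun α := SmoothForm.mk (contract x (SmoothForm.val E M α)) (isSmooth_contract hx α.isSmooth)
  map_add' α β :=
    SmoothForm.ext (contract_add_right x (SmoothForm.val E M α) (SmoothForm.val E M β))
  map_smul' c α := SmoothForm.ext (contract_smul_right c x (SmoothForm.val E M α))

end Operators

/-! ### Koszul signs and unshuffles -/

section Signs

/-- The Koszul sign of moving the element with index `a` to the front. -/
def frontSign {n : ℕ} (d : Fin n → ℤ) (a : Fin n) : ℤˣ :=
  ∏ c : Fin n, if c < a then (d a * d c).negOnePow else 1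

theorem frontSign_zero {n : ℕ} (d : Fin (n + 1) → ℤ) : frontSign d 0 = 1 :=
  Finset.prod_eq_one fun c _ => if_neg (Fin.not_lt_zero c)

theorem frontSign_succ {n : ℕ} (d : Fin (n + 1) → ℤ) (a : Fin n) :
    frontSign d a.succ = (d a.succ * d 0).negOnePow * frontSign (fun c => d c.succ) a := by
  rw [frontSign, Fin.prod_univ_succ, if_pos (Fin.succ_pos a), frontSign]
  simp only [Fin.succ_lt_succ_iff]

/-- The permutation with `0 ↦ a` that permutes the remaining indices by `τ`. -/
def consPerm {n : ℕ} (a : Fin (n + 1)) (τ : Equiv.Perm (Fin n)) : Equiv.Perm (Fin (n + 1)) :=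
  (finSuccEquiv' 0).trans ((Equiv.optionCongr τ).trans (finSuccEquiv' a).symm)

@[simp]
theorem consPerm_zero {n : ℕ} (a : Fin (n + 1)) (τ : Equiv.Perm (Fin n)) :
    consPerm a τ 0 = a := by
  simp [consPerm]

@[simp]
theorem consPerm_succ {n : ℕ} (a : Fin (n + 1)) (τ : Equiv.Perm (Fin n)) (k : Fin n) :
    consPerm a τ k.succ = a.succAbove (τ k) := by
  have h : finSuccEquiv' (0 : Fin (n + 1)) k.succ = some k := by
    rw [← Fin.succAbove_zero, finSuccEquiv'_succAbove]
  simp only [consPerm, Equiv.trans_apply, h]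
  simp

theorem consPerm_bijective (n : ℕ) :
    Function.Bijective fun x : Fin (n + 1) × Equiv.Perm (Fin n) => consPerm x.1 x.2 := by
  rw [Fintype.bijective_iff_injective_and_card]
  constructor
  · rintro ⟨a, τ⟩ ⟨a', τ'⟩ h
    have h0 := congrArg (fun σ : Equiv.Perm (Fin (n + 1)) => σ 0) h
    simp only [consPerm_zero] at h0
    subst h0
    have h1 : τ = τ' := by
      ext k
      have hk := congrArg (fun σ : Equiv.Perm (Fin (n + 1)) => σ k.succ) h
      simp only [consPerm_succ] at hk
      rw [Fin.succAbove_right_injective hk]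
    rw [h1]
  · simp [Fintype.card_perm, Nat.factorial_succ]

/-- A permutation of `n + 1` indices is an index followed by a permutation of the others. -/
def consPermEquiv (n : ℕ) : Fin (n + 1) × Equiv.Perm (Fin n) ≃ Equiv.Perm (Fin (n + 1)) :=
  Equiv.ofBijective _ (consPerm_bijective n)

theorem koszulSign_eq_prod {n : ℕ} (d : Fin n → ℤ) (σ : Equiv.Perm (Fin n)) :
    koszulSign d σ = ∏ p : Fin n, ∏ q : Fin n,
      if p < q ∧ σ q < σ p then (d (σ p) * d (σ q)).negOnePow else 1 := by
  rw [koszulSign, Finset.prod_filter, Fintype.prod_prod_type]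

theorem koszulSign_one {n : ℕ} (d : Fin n → ℤ) : koszulSign d 1 = 1 := by
  rw [koszulSign_eq_prod]
  refine Finset.prod_eq_one fun p _ => Finset.prod_eq_one fun q _ => if_neg ?_
  simp only [Equiv.Perm.coe_one, id_eq]
  omega

/-- Inversions at position `0` come from the indices below `a` and give `frontSign`. The others are
the inversions of `τ`, because `a.succAbove` is increasing. -/
theorem koszulSign_consPerm {n : ℕ} (d : Fin (n + 1) → ℤ) (a : Fin (n + 1))
    (τ : Equiv.Perm (Fin n)) :
    koszulSign d (consPerm a τ) = frontSign d a * koszulSign (d ∘ a.succAbove) τ := by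
  rw [koszulSign_eq_prod, koszulSign_eq_prod, Fin.prod_univ_succ]
  congr 1
  · rw [Fin.prod_univ_succ, if_neg (by simp), one_mul, frontSign, Fin.prod_univ_succAbove _ a,
      if_neg (lt_irrefl a), one_mul]
    simp only [consPerm_zero, consPerm_succ, Fin.succ_pos, true_and]
    exact Equiv.prod_comp τ fun k =>
      if a.succAbove k < a then (d a * d (a.succAbove k)).negOnePow else 1
  · refine Finset.prod_congr rfl fun p _ => ?_
    rw [Fin.prod_univ_succ, if_neg (by simp), one_mul]
    simp [consPerm_succ, Fin.succAbove_lt_succAbove_iff]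

theorem ofFn_prod_eq_frontSign_smul {A : Type*} [Ring A] {n : ℕ} (x : Fin (n + 1) → A)
    (d : Fin (n + 1) → ℤ)
    (h : ∀ a b, x a * x b = (d a * d b).negOnePow • (x b * x a)) (a : Fin (n + 1)) :
    (List.ofFn x).prod = frontSign d a • (x a * (List.ofFn fun k => x (a.succAbove k)).prod) := by
  induction n with
  | zero =>
    obtain rfl : a = 0 := Fin.ext (by omega)
    simp [frontSign_zero]
  | succ n ih =>
    refine Fin.cases ?_ (fun a => ?_) a
    · simp [frontSign_zero, List.ofFn_succ]
    · rw [List.ofFn_succ, List.prod_cons, ih (fun k => x k.succ) (fun k => d k.succ)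
        (fun a b => h _ _) a, List.ofFn_succ, List.prod_cons, frontSign_succ, mul_smul_comm,
        ← mul_assoc, h 0 a.succ]
      simp only [Fin.succ_succAbove_zero, Fin.succ_succAbove_succ]
      rw [smul_mul_assoc, smul_smul, mul_comm (d 0), mul_comm (frontSign _ _), mul_assoc]

theorem ofFn_prod_eq_koszulSign_smul {A : Type*} [Ring A] {n : ℕ} (x : Fin n → A)
    (d : Fin n → ℤ) (h : ∀ a b, x a * x b = (d a * d b).negOnePow • (x b * x a))
    (σ : Equiv.Perm (Fin n)) :
    (List.ofFn x).prod = koszulSign d σ • (List.ofFn (x ∘ σ)).prod := by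
  induction n with
  | zero => simp [koszulSign]
  | succ n ih =>
    obtain ⟨⟨a, τ⟩, rfl⟩ := (consPerm_bijective n).2 σ
    rw [koszulSign_consPerm, ofFn_prod_eq_frontSign_smul x d h a,
      ih (fun k => x (a.succAbove k)) (d ∘ a.succAbove) (fun _ _ => h _ _) τ, List.ofFn_succ,
      List.prod_cons, mul_smul_comm, smul_smul]
    simp [Function.comp_def]

theorem isUnshuffle_consPerm {n p : ℕ} (a : Fin (n + 1)) (τ : Equiv.Perm (Fin n)) :
    IsUnshuffle (p + 1) (consPerm a τ) ↔
      IsUnshuffle p τ ∧ ∀ k : Fin n, (k : ℕ) < p → a < a.succAbove (τ k) := by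
  constructor
  · intro h
    refine ⟨fun k l hkl hp => ?_, fun k hk => ?_⟩
    · have := h k.succ l.succ (Fin.succ_lt_succ_iff.2 hkl) (by simpa using hp)
      simpa using this
    · have := h 0 k.succ (Fin.succ_pos k) (Or.inl (by simpa using hk))
      simpa using this
  · rintro ⟨h, h'⟩ k l hkl hp
    induction l using Fin.cases with
    | zero => exact absurd hkl (Fin.not_lt_zero k)
    | succ l =>
      induction k using Fin.cases with
      | zero => simpa using h' l (by simpa using hp)
      | succ k =>
        have := h k l (Fin.succ_lt_succ_iff.1 hkl) (by simpa using hp)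
        simpa using this

theorem perm_eq_one_of_strictMono {n : ℕ} {σ : Equiv.Perm (Fin n)} (h : StrictMono σ) : σ = 1 := by
  let s : Fin n ≃o Fin n := { σ with map_rel_iff' := h.le_iff_le }
  have hs : s = OrderIso.refl _ := Subsingleton.elim _ _
  exact Equiv.ext fun k => congrArg (fun t : Fin n ≃o Fin n => t k) hs

theorem isUnshuffle_zero {n : ℕ} {σ : Equiv.Perm (Fin n)} : IsUnshuffle 0 σ ↔ σ = 1 :=
  ⟨fun h => perm_eq_one_of_strictMono fun a b hab => h a b hab (Or.inr (Nat.zero_le _)),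
    fun h a b hab _ => by simpa [h] using hab⟩

theorem isUnshuffle_self {n : ℕ} {σ : Equiv.Perm (Fin n)} : IsUnshuffle n σ ↔ σ = 1 :=
  ⟨fun h => perm_eq_one_of_strictMono fun a b hab => h a b hab (Or.inl b.2),
    fun h a b hab _ => by simpa [h] using hab⟩

/-- A `(2, n)`-unshuffle amounts to two indices in increasing order. As `b` numbers the indices
other than `a`, the condition `a ≤ b.castSucc` means `a < a.succAbove b`. -/
theorem isUnshuffle_two {n : ℕ} (a : Fin (n + 2)) (b : Fin (n + 1)) (ρ : Equiv.Perm (Fin n)) :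
    IsUnshuffle 2 (consPerm a (consPerm b ρ)) ↔ ρ = 1 ∧ a ≤ b.castSucc := by
  rw [isUnshuffle_consPerm, isUnshuffle_consPerm, isUnshuffle_zero]
  simp only [Nat.not_lt_zero, false_implies, implies_true, and_true, and_congr_right_iff]
  rintro rfl
  constructor
  · intro h
    simpa using Fin.lt_succAbove_iff_le_castSucc _ _ |>.1 (h 0 (by simp))
  · intro h k hk
    obtain rfl : k = 0 := Fin.ext (by simpa using hk)
    simpa using Fin.lt_succAbove_iff_le_castSucc _ _ |>.2 h

open scoped Classical in
theorem sum_unshuffle_two {A : Type*} [AddCommMonoid A] {n : ℕ}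
    (f : Equiv.Perm (Fin (n + 2)) → A) :
    ∑ σ : Equiv.Perm (Fin (n + 2)) with IsUnshuffle 2 σ, f σ =
      ∑ a : Fin (n + 2), ∑ b : Fin (n + 1),
        if a ≤ b.castSucc then f (consPerm a (consPerm b 1)) else 0 := by
  rw [Finset.sum_filter, ← (consPermEquiv (n + 1)).sum_comp, Fintype.sum_prod_type]
  refine Finset.sum_congr rfl fun a _ => ?_
  rw [← (consPermEquiv n).sum_comp, Fintype.sum_prod_type]
  refine Finset.sum_congr rfl fun b _ => ?_
  change (∑ ρ, if IsUnshuffle 2 (consPerm a (consPerm b ρ)) then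
    f (consPerm a (consPerm b ρ)) else 0) = _
  simp only [isUnshuffle_two]
  rw [Finset.sum_eq_single 1]
  · simp
  · intro ρ _ h
    simp [h]
  · simp

end Signs

/-! ### Second order operators -/

section SecondOrder

variable {W : Type*} [AddCommGroup W] [Module ℝ W]

theorem map_units_zsmul (f : Module.End ℝ W) (u : ℤˣ) (w : W) : f (u • w) = u • f w := by
  simp [Units.smul_def]

/-- A supercommutator with `L` is a derivation of products. -/
theorem derivation_expansion {n : ℕ} (L : Module.End ℝ W) (e₀ : ℤ)
    (P B : Fin (n + 1) → Module.End ℝ W)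
    (e : Fin (n + 1) → ℤ)
    (hL : ∀ b w, L (P b w) = B b w + ((e₀ + 1) * e b).negOnePow • P b (L w))
    (hB : ∀ b c w, P c (B b w) = (e c * (e₀ + e b + 1)).negOnePow • B b (P c w))
    (w₀ : W) (hw₀ : L w₀ = 0) :
    L ((List.ofFn P).prod w₀) =
      ∑ b, frontSign e b • B b ((List.ofFn fun c => P (b.succAbove c)).prod w₀) := by
  induction n with
  | zero => simp [frontSign_zero, hL, hw₀]
  | succ n ih =>
    -- Either `L` hits the first factor, which is the summand `b = 0`, or it passes. In the second
    -- case `P 0` must afterwards move behind `B b`, and the two signs combine to `frontSign`.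
    rw [Fin.sum_univ_succ, List.ofFn_succ, List.prod_cons, Module.End.mul_apply, hL,
      ih (fun c => P c.succ) (fun c => B c.succ) (fun c => e c.succ) (fun b w => hL _ w)
        (fun b c w => hB _ _ w), frontSign_zero, one_smul]
    congr 1
    rw [map_sum, Finset.smul_sum]
    refine Finset.sum_congr rfl fun b _ => ?_
    rw [map_units_zsmul, hB, List.ofFn_succ, List.prod_cons, frontSign_succ, smul_smul, smul_smul]
    simp only [Fin.succ_succAbove_zero, Fin.succ_succAbove_succ, Module.End.mul_apply]
    congr 1
    rw [mul_right_comm, ← Int.negOnePow_add]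
    congr 1
    rw [show (e₀ + 1) * e 0 + e 0 * (e₀ + e b.succ + 1) = e b.succ * e 0 + 2 * ((e₀ + 1) * e 0) by
      ring, Int.negOnePow_add, Int.negOnePow_two_mul, mul_one]

/-- The expansion of an operator `D` of second order on a product, in terms of its derived
brackets `B`. -/
theorem second_order_expansion {n : ℕ} (D : Module.End ℝ W) (P L : Fin (n + 2) → Module.End ℝ W)
    (B : Fin (n + 2) → Fin (n + 2) → Module.End ℝ W) (e : Fin (n + 2) → ℤ)
    (hD : ∀ a w, D (P a w) = L a w + (e a).negOnePow • P a (D w))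
    (hL : ∀ a b w, L a (P b w) = B a b w + ((e a + 1) * e b).negOnePow • P b (L a w))
    (hB : ∀ a b c w, P c (B a b w) = (e c * (e a + e b + 1)).negOnePow • B a b (P c w))
    (w₀ : W) (hDw : D w₀ = 0) (hLw : ∀ a, L a w₀ = 0) :
    D ((List.ofFn P).prod w₀) = ∑ a : Fin (n + 2), ∑ b : Fin (n + 1),
      if a ≤ b.castSucc then (frontSign e a * frontSign (e ∘ a.succAbove) b) •
        B a (a.succAbove b) ((List.ofFn fun c => P (a.succAbove (b.succAbove c))).prod w₀)
      else 0 := by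
  induction n with
  | zero =>
    simp [List.ofFn_succ, hD, hL, hDw, hLw, frontSign]
  | succ n ih =>
    -- In `D P₀ = L₀ ± P₀ D`, the operator `L₀` acts as a derivation and gives the pairs containing
    -- the index `0`; the second term gives the other pairs by induction, after `P₀` has passed
    -- their brackets.
    rw [List.ofFn_succ, List.prod_cons, Module.End.mul_apply, hD, Fin.sum_univ_succ]
    congr 1
    · rw [derivation_expansion (L 0) (e 0) (fun c => P c.succ) (fun c => B 0 c.succ)
        (fun c => e c.succ) (fun b w => hL _ _ w) (fun b c w => hB _ _ _ w) w₀ (hLw 0)]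
      simp only [Fin.zero_le, if_true, frontSign_zero, one_mul, Fin.succAbove_zero,
        Function.comp_def]
    · rw [ih (fun a => P a.succ) (fun a => L a.succ) (fun a b => B a.succ b.succ)
        (fun a => e a.succ) (fun a w => hD _ w) (fun a b w => hL _ _ w)
        (fun a b c w => hB _ _ _ w) (fun a => hLw _), map_sum, Finset.smul_sum]
      refine Finset.sum_congr rfl fun a _ => ?_
      -- For a first index `a.succ`, the choice `b = 0` is the index `0`, which is out of order and
      -- contributes nothing.
      conv_rhs => rw [Fin.sum_univ_succ, if_neg (by simp), zero_add]
      rw [map_sum, Finset.smul_sum]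
      refine Finset.sum_congr rfl fun b _ => ?_
      simp only [Fin.castSucc_succ, Fin.succ_le_succ_iff]
      split_ifs with hab
      · rw [map_units_zsmul, hB, List.ofFn_succ, List.prod_cons, frontSign_succ, frontSign_succ,
          smul_smul, smul_smul]
        simp only [Fin.succ_succAbove_zero, Fin.succ_succAbove_succ, Module.End.mul_apply,
          Function.comp_def]
        congr 1
        rw [mul_mul_mul_comm, ← Int.negOnePow_add, mul_right_comm, ← Int.negOnePow_add]
        congr 1
        rw [show e 0 + e 0 * (e a.succ + e (a.succAbove b).succ + 1) =
          e a.succ * e 0 + e (a.succAbove b).succ * e 0 + 2 * e 0 by ring, Int.negOnePow_add,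
          Int.negOnePow_two_mul, mul_one]
      · simp

end SecondOrder

/-! ### Contractions of a closed form with products of multivector fields -/

theorem negOnePow_natCast_smul {W : Type*} [AddCommGroup W] [Module ℝ W] (n : ℕ) (w : W) :
    (n : ℤ).negOnePow • w = (-1 : ℝ) ^ n • w := by
  rcases Nat.even_or_odd n with h | h
  · rw [Int.negOnePow_even _ (by exact_mod_cast h), h.neg_one_pow, one_smul, one_smul]
  · rw [Int.negOnePow_odd _ (by exact_mod_cast h), h.neg_one_pow]
    simp [Units.smul_def]

section Products

variable {E : Type*} [NormedAddCommGroup E] [NormedSpace ℝ E]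
  {M : Type*} [TopologicalSpace M] [ChartedSpace E M]

theorem contractProd_succ {n : ℕ} (x : Fin (n + 1) → MultivectorField E M) (α : FormField E M) :
    contractProd x α = contract (x 0) (contractProd (fun a => x a.succ) α) := by
  rw [contractProd, List.ofFn_succ, List.prod_cons, contract_mul, contractProd]

theorem contractProd_cons {n : ℕ} (y : MultivectorField E M) (x : Fin n → MultivectorField E M)
    (α : FormField E M) :
    contractProd (Fin.cons y x) α = contract y (contractProd x α) := by
  rw [contractProd_succ]
  simp

theorem contractProd_zero (x : Fin 0 → MultivectorField E M) (α : FormField E M) :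
    contractProd x α = α := by
  rw [contractProd, List.ofFn_zero, List.prod_nil, contract_one]

theorem multivector_mul_comm_negOnePow {a b : ℕ} {x y : MultivectorField E M}
    (hx : x ∈ multivectorSpace E M a) (hy : y ∈ multivectorSpace E M b) :
    x * y = ((a : ℤ) * b).negOnePow • (y * x) := by
  rw [multivector_mul_comm hx hy, ← Nat.cast_mul, negOnePow_natCast_smul]

/-- The contraction with a product only depends on the contractions with the factors. -/
theorem contractProd_congr {n : ℕ} {x y : Fin n → MultivectorField E M} {d : Fin n → ℕ}
    {α : FormField E M} (hx : ∀ a, x a ∈ multivectorSpace E M (d a))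
    (hy : ∀ a, y a ∈ multivectorSpace E M (d a))
    (h : ∀ a, contract (x a) α = contract (y a) α) : contractProd x α = contractProd y α := by
  induction n with
  | zero => rw [contractProd_zero, contractProd_zero]
  | succ n ih =>
    -- A factor can be moved next to `α` with a sign that depends only on degrees, so it enters only
    -- through its contraction with `α`.
    have key : ∀ {k : ℕ} {u : MultivectorField E M}, u ∈ multivectorSpace E M k →
        ∀ {l : ℕ} {z : Fin l → MultivectorField E M} {e : Fin l → ℕ},
        (∀ a, z a ∈ multivectorSpace E M (e a)) → contract u (contractProd z α) =
          (-1 : ℝ) ^ (k * ∑ a, e a) • contractProd z (contract u α) := by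
      intro k u hu l
      induction l with
      | zero => intro z e _; simp [contractProd_zero]
      | succ l ihl =>
        intro z e hz
        rw [contractProd_succ, contract_comm hu (hz 0), ihl fun a => hz a.succ,
          contract_smul_right, smul_smul, ← pow_add, contractProd_succ, Fin.sum_univ_succ,
          mul_add]
    rw [contractProd_succ, contractProd_succ, ih (fun a => hx a.succ) (fun a => hy a.succ)
      (fun a => h a.succ), key (hx 0) fun a => hy a.succ, key (hy 0) fun a => hy a.succ, h 0]

theorem contractProd_apply_eq_zero {n k : ℕ} {x : Fin n → MultivectorField E M} {d : Fin n → ℕ}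
    {α : FormField E M} (hx : ∀ a, x a ∈ multivectorSpace E M (d a))
    (hα : ∀ p l, l ≠ k → α p l = 0) (p : M) (l : ℕ) (h : l + ∑ a, d a ≠ k) :
    contractProd x α p l = 0 := by
  induction n generalizing l with
  | zero =>
    rw [contractProd_zero]
    exact hα p l (by simpa using h)
  | succ n ih =>
    rw [contractProd_succ]
    refine contraction_eq_zero ((hx 0).2 p) (ih (fun a => hx a.succ) _ ?_)
    rw [Fin.sum_univ_succ] at h
    omega

theorem contractProd_eq_zero {n k : ℕ} {x : Fin n → MultivectorField E M} {d : Fin n → ℕ}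
    {α : FormField E M} (hx : ∀ a, x a ∈ multivectorSpace E M (d a))
    (hα : α ∈ formSpace E M k) (h : k < ∑ a, d a) : contractProd x α = 0 := by
  funext p l
  exact contractProd_apply_eq_zero hx hα.2 p l (by omega)

theorem lieD_eq_zero {α : FormField E M} {n : ℕ} {x : MultivectorField E M} (hα : extD α = 0)
    (hx : extD (contract x α) = 0) : lieD n x α = 0 := by
  rw [lieD, hα, hx, contract_zero_right, smul_zero, sub_zero]

variable [FiniteDimensional ℝ E] [IsManifold 𝓘(ℝ, E) ∞ M]

variable {α : FormField E M}

theorem isSmooth_contractProd {n : ℕ} {x : Fin n → MultivectorField E M} {d : Fin n → ℕ}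
    (hx : ∀ a, x a ∈ multivectorSpace E M (d a)) (hα : α.IsSmooth) :
    (contractProd x α).IsSmooth := by
  induction n with
  | zero => rwa [contractProd_zero]
  | succ n ih =>
    rw [contractProd_succ]
    exact isSmooth_contract (hx 0) (ih fun a => hx a.succ)

theorem contractProd_mem_formSpace {n k : ℕ} {x : Fin n → MultivectorField E M} {d : Fin n → ℕ}
    (hx : ∀ a, x a ∈ multivectorSpace E M (d a))
    (hα : α ∈ formSpace E M (k + ∑ a, d a)) : contractProd x α ∈ formSpace E M k :=
  ⟨isSmooth_contractProd hx hα.1, fun p l hl =>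
    contractProd_apply_eq_zero hx hα.2 p l (by omega)⟩

/-- Of the four terms of `[[d, ι_x], ι_y] α`, three contain `dα`, `d ι_x α` or `d ι_y α` and vanish.
This is what makes a binary bracket hamiltonian. -/
theorem contract_schouten {a b : ℕ} {x y : MultivectorField E M}
    (hx : x ∈ multivectorSpace E M (a + 1)) (hy : y ∈ multivectorSpace E M (b + 1))
    (hα : α.IsSmooth) (hdα : extD α = 0) (hdx : extD (contract x α) = 0)
    (hdy : extD (contract y α) = 0) :
    contract (schouten (a + 1) (b + 1) x y) α = extD (contract x (contract y α)) := by
  have h := lieD_contract hx hy hα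
  rw [lieD_eq_zero hdα hdx, contract_zero_right, smul_zero, add_zero, lieD, hdy,
    contract_zero_right, smul_zero, sub_zero] at h
  exact h.symm

theorem val_ofFn_contractOp_prod {n : ℕ} {x : Fin n → MultivectorField E M} {d : Fin n → ℕ}
    (hx : ∀ a, x a ∈ multivectorSpace E M (d a)) (w : SmoothForm E M) :
    SmoothForm.val E M ((List.ofFn fun a => contractOp (hx a)).prod w) =
      contractProd x (SmoothForm.val E M w) := by
  induction n with
  | zero => simp [contractProd_zero]
  | succ n ih =>
    rw [List.ofFn_succ, List.prod_cons, contractProd_succ, Module.End.mul_apply,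
      ← ih fun a => hx a.succ]
    rfl

/-- The exterior derivative of the contraction of a closed form with a product of multivector
fields whose contractions are closed. -/
theorem extD_contractProd {n : ℕ} {x : Fin (n + 2) → MultivectorField E M} {j : Fin (n + 2) → ℕ}
    (hx : ∀ a, x a ∈ multivectorSpace E M (j a + 1)) (hα : α.IsSmooth) (hdα : extD α = 0)
    (hdx : ∀ a, extD (contract (x a) α) = 0) (e : Fin (n + 2) → ℤ) (he : ∀ a, e a = j a + 1) :
    extD (contractProd x α) = ∑ a : Fin (n + 2), ∑ b : Fin (n + 1),
      if a ≤ b.castSucc then (frontSign e a * frontSign (e ∘ a.succAbove) b) •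
        contract (schouten (j a + 1) (j (a.succAbove b) + 1) (x a) (x (a.succAbove b)))
          (contractProd (fun c => x (a.succAbove (b.succAbove c))) α)
      else 0 := by
  let D := extDOp E M
  let P : Fin (n + 2) → Module.End ℝ (SmoothForm E M) := fun a => contractOp (hx a)
  let L : Fin (n + 2) → Module.End ℝ (SmoothForm E M) := fun a =>
    D * P a - (-1 : ℝ) ^ (j a + 1) • (P a * D)
  let B : Fin (n + 2) → Fin (n + 2) → Module.End ℝ (SmoothForm E M) := fun a b =>
    contractOp (schouten_mem (hx a) (hx b))
  have hecast : ∀ a, e a = ((j a + 1 : ℕ) : ℤ) := fun a => by rw [he]; push_cast; rfl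
  have hLval : ∀ a (w : SmoothForm E M), SmoothForm.val E M (L a w) =
      lieD (j a + 1) (x a) (SmoothForm.val E M w) := fun a w => rfl
  -- The Koszul exponents are written with the degrees `e a = j a + 1`. They differ from the
  -- exponents of the Cartan calculus by even numbers, which the identities `hsq` split off.
  have h := second_order_expansion D P L B e
    (fun a w => by
      rw [hecast, negOnePow_natCast_smul]
      exact (sub_add_cancel (D (P a w)) ((-1 : ℝ) ^ (j a + 1) • P a (D w))).symm)
    (fun a b w => by
      have hsq : (e a + 1) * e b = ((j a * (j b + 1) : ℕ) : ℤ) + 2 * e b := by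
        rw [he, he]; push_cast; ring
      rw [hsq, Int.negOnePow_add, Int.negOnePow_even _ (even_two_mul (e b)), mul_one,
        negOnePow_natCast_smul]
      exact SmoothForm.ext (lieD_contract (hx a) (hx b) w.isSmooth))
    (fun a b c w => by
      have hsq : e c * (e a + e b + 1) = (((j c + 1) * (j a + j b + 1) : ℕ) : ℤ) + 2 * e c := by
        rw [he, he, he]; push_cast; ring
      rw [hsq, Int.negOnePow_add, Int.negOnePow_even _ (even_two_mul (e c)), mul_one,
        negOnePow_natCast_smul]
      exact SmoothForm.ext (contract_comm (hx c) (schouten_mem (hx a) (hx b)) _))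
    (SmoothForm.mk α hα) (SmoothForm.ext hdα)
    (fun a => SmoothForm.ext (lieD_eq_zero hdα (hdx a)))
  have h' := congrArg (SmoothForm.val E M) h
  rw [map_sum] at h'
  refine Eq.trans ?_ (h'.trans (Finset.sum_congr rfl fun a _ => ?_))
  · exact congrArg extD (val_ofFn_contractOp_prod hx (SmoothForm.mk α hα)).symm
  · rw [map_sum]
    refine Finset.sum_congr rfl fun b _ => ?_
    split_ifs with hab
    · rw [Units.smul_def, Units.smul_def, map_zsmul]
      congr 1
      exact congrArg (contract _) (val_ofFn_contractOp_prod
        (fun c => hx (a.succAbove (b.succAbove c))) (SmoothForm.mk α hα))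
    · exact map_zero _

end Products

/-! ### Direct sums and linear algebra -/

section Grading

variable {ι : Type*} [DecidableEq ι] {A : ι → Type*} [∀ i, AddCommGroup (A i)]
  [∀ i, Module ℝ (A i)] (deg : ι → ℤ)

/-- The grading of a direct sum by the degrees of the indices of its summands. -/
def degreeGrading (k : ℤ) : Submodule ℝ (⨁ i, A i) :=
  ⨆ (i : ι) (_ : deg i = k), LinearMap.range (DirectSum.lof ℝ ι A i)

theorem mem_degreeGrading_iff {k : ℤ} {v : ⨁ i, A i} :
    v ∈ degreeGrading (A := A) deg k ↔ ∀ i, deg i ≠ k → v i = 0 := by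
  constructor
  · intro hv i hi
    suffices h : degreeGrading (A := A) deg k ≤ LinearMap.ker (DirectSum.component ℝ ι A i) from
      h hv
    refine iSup₂_le fun i' hi' => ?_
    rintro _ ⟨a, rfl⟩
    have hne : i' ≠ i := by rintro rfl; exact hi hi'
    exact DirectSum.component.of (R := ℝ) i i' a |>.trans (dif_neg hne)
  · classical
    intro hv
    rw [← DirectSum.sum_support_of v]
    refine Submodule.sum_mem _ fun i hi => ?_
    have hik : deg i = k := by
      by_contra h
      exact (DFinsupp.mem_support_iff.1 hi) (hv i h)
    exact Submodule.mem_iSup_of_mem i (Submodule.mem_iSup_of_mem hik ⟨v i, rfl⟩)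

theorem isInternal_degreeGrading : DirectSum.IsInternal (degreeGrading (A := A) deg) := by
  rw [DirectSum.isInternal_submodule_iff_iSupIndep_and_iSup_eq_top]
  constructor
  · rw [iSupIndep_def]
    intro k
    rw [Submodule.disjoint_def]
    intro v hv hv'
    ext i : 1
    -- Components of degree `k` vanish because `v` lies in the span of the other degrees, all
    -- remaining ones because `v` has degree `k`.
    by_cases hi : deg i = k
    · suffices h : (⨆ j, ⨆ (_ : j ≠ k), degreeGrading (A := A) deg j) ≤
          LinearMap.ker (DirectSum.component ℝ ι A i) from h hv'
      refine iSup₂_le fun j hj w hw => ?_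
      exact (mem_degreeGrading_iff deg).1 hw i (by rw [hi]; exact hj.symm)
    · exact (mem_degreeGrading_iff deg).1 hv i hi
  · classical
    rw [eq_top_iff]
    intro v _
    rw [← DirectSum.sum_support_of v]
    exact Submodule.sum_mem _ fun i _ => Submodule.mem_iSup_of_mem (deg i)
      (Submodule.mem_iSup_of_mem i (Submodule.mem_iSup_of_mem rfl ⟨v i, rfl⟩))

/-- Multilinear maps on a direct sum are determined by their values on homogeneous elements. -/
theorem multilinearMap_directSum_ext {n : ℕ} {L : Type*} [AddCommGroup L] [Module ℝ L]
    {f g : MultilinearMap ℝ (fun _ : Fin n => ⨁ i, A i) L}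
    (h : ∀ (p : Fin n → ι) (α : ∀ a, A (p a)),
      f (fun a => DirectSum.lof ℝ ι A (p a) (α a)) =
        g (fun a => DirectSum.lof ℝ ι A (p a) (α a))) : f = g :=
  MultilinearMap.dfinsupp_ext fun p => MultilinearMap.ext fun α => h p α

end Grading

/-- A linear section of `f` over its range is extended to all of `W`. This provides projections onto
the bigraded pieces, a linear choice of hamiltonian fields, and a left inverse of the inclusion of
Rogers' space. -/
theorem exists_linear_pseudoinverse {V W : Type*} [AddCommGroup V] [Module ℝ V] [AddCommGroup W]
    [Module ℝ W] (f : V →ₗ[ℝ] W) : ∃ g : W →ₗ[ℝ] V, ∀ v, f (g (f v)) = f v := by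
  obtain ⟨s, hs⟩ := f.rangeRestrict.exists_rightInverse_of_surjective f.range_rangeRestrict
  obtain ⟨g, hg⟩ := s.exists_extend
  refine ⟨g, fun v => ?_⟩
  have h1 : g (f v) = s (f.rangeRestrict v) := LinearMap.congr_fun hg (f.rangeRestrict v)
  rw [h1]
  exact congrArg Subtype.val (LinearMap.congr_fun hs (f.rangeRestrict v))

/-! ### Formal properties of brackets and their morphisms -/

section Brackets

variable {L : Type*} [AddCommGroup L] [Module ℝ L]

theorem composeFirst_eq_zero (l : Brackets L) {n : ℕ} (i : Fin (n + 1)) {v : Fin (n + 1) → L}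
    (h : ∃ a, v a = 0) : composeFirst l i v = 0 := by
  obtain ⟨a, ha⟩ := h
  rw [composeFirst]
  by_cases hai : (a : ℕ) ≤ i
  · refine MultilinearMap.map_coord_zero _ 0 ?_
    rw [Fin.cons_zero]
    exact MultilinearMap.map_coord_zero _ ⟨a, by omega⟩ ha
  · refine MultilinearMap.map_coord_zero _ (Fin.succ ⟨a - (i + 1), by omega⟩) ?_
    rw [Fin.cons_succ]
    convert ha using 2
    exact Fin.ext (by simp only []; omega)

theorem jacobiator_eq_zero_of_coord (l : Brackets L) {n : ℕ} (d : Fin (n + 1) → ℤ)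
    {v : Fin (n + 1) → L} (h : ∃ a, v a = 0) : jacobiator l d v = 0 := by
  classical
  obtain ⟨a, ha⟩ := h
  refine Finset.sum_eq_zero fun i _ => Finset.sum_eq_zero fun σ _ => ?_
  rw [composeFirst_eq_zero l i ⟨σ.symm a, by simpa using ha⟩, smul_zero]

variable {L' : Type*} [AddCommGroup L'] [Module ℝ L']

theorem map_composeFirst {l : Brackets L} {l' : Brackets L'} {F : L' →ₗ[ℝ] L}
    (h : ∀ (n : ℕ) (v : Fin (n + 1) → L'), l n (fun a => F (v a)) = F (l' n v)) {n : ℕ}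
    (i : Fin (n + 1)) (v : Fin (n + 1) → L') :
    composeFirst l i (fun a => F (v a)) = F (composeFirst l' i v) := by
  rw [composeFirst, composeFirst, ← h]
  congr 1
  funext a
  refine Fin.cases ?_ (fun a => ?_) a
  · simp [h]
  · simp

theorem map_jacobiator {l : Brackets L} {l' : Brackets L'} {F : L' →ₗ[ℝ] L}
    (h : ∀ (n : ℕ) (v : Fin (n + 1) → L'), l n (fun a => F (v a)) = F (l' n v)) {n : ℕ}
    (d : Fin (n + 1) → ℤ) (v : Fin (n + 1) → L') :
    jacobiator l d (fun a => F (v a)) = F (jacobiator l' d v) := by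
  classical
  rw [jacobiator, jacobiator, map_sum]
  refine Finset.sum_congr rfl fun i _ => ?_
  rw [map_sum]
  refine Finset.sum_congr rfl fun σ _ => ?_
  rw [Units.smul_def, Units.smul_def, map_zsmul, ← map_composeFirst h]
  rfl

/-- An injective morphism into an `L∞`-algebra that reflects the grading makes its source an
`L∞`-algebra. -/
theorem IsLInfinityAlgebra.of_injective {gr : ℤ → Submodule ℝ L} {l : Brackets L}
    (hl : IsLInfinityAlgebra gr l) {gr' : ℤ → Submodule ℝ L'} {l' : Brackets L'}
    {F : L' →ₗ[ℝ] L} (hF : Function.Injective F)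
    (hgr : ∀ k v, v ∈ gr' k ↔ F v ∈ gr k)
    (h : ∀ (n : ℕ) (v : Fin (n + 1) → L'), l n (fun a => F (v a)) = F (l' n v))
    (hint : DirectSum.IsInternal gr') : IsLInfinityAlgebra gr' l' where
  isInternal := hint
  positive k hk := by
    rw [eq_bot_iff]
    intro v hv
    rw [hgr, hl.positive k hk, Submodule.mem_bot] at hv
    exact hF (by rw [hv, map_zero])
  degree n d v hv := by
    rw [hgr, ← h]
    exact hl.degree n d _ fun a => (hgr _ _).1 (hv a)
  symmetric n d v hv σ := by
    refine hF ?_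
    rw [Units.smul_def, map_zsmul, ← Units.smul_def, ← h, ← h]
    exact hl.symmetric n d _ (fun a => (hgr _ _).1 (hv a)) σ
  jacobi n d v hv := by
    refine hF ?_
    rw [map_zero, ← map_jacobiator h]
    exact hl.jacobi n d _ fun a => (hgr _ _).1 (hv a)

end Brackets

/-! ### The brackets of `Ξ(M)` -/

section XiBrackets

variable {E : Type*} [NormedAddCommGroup E] [NormedSpace ℝ E]
  {M : Type*} [TopologicalSpace M] [ChartedSpace E M] {m : ℕ} {ω₀ : FormField E M}

theorem xiPiece_eq_bot {i j : ℕ} (h : ¬(1 ≤ i ∧ i + j ≤ m)) : xiPiece m ω₀ (i, j) = ⊥ :=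
  if_neg h

theorem xiPiece_one {j : ℕ} (h : 1 + j ≤ m) :
    xiPiece m ω₀ (1, j) = hamiltonianSpace m ω₀ (j + 1) :=
  (if_pos ⟨le_rfl, h⟩).trans (if_pos rfl)

theorem xiPiece_of_two_le {i j : ℕ} (hi : 2 ≤ i) (h : i + j ≤ m) :
    xiPiece m ω₀ (i, j) = formSpace E M (m - (i + j)) :=
  (if_pos ⟨(by omega : 1 ≤ i), h⟩).trans (if_neg (by simp only []; omega))

theorem xiPiece_le_formSpace (q : ℕ × ℕ) :
    xiPiece m ω₀ q ≤ formSpace E M (m - (q.1 + q.2)) := by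
  obtain ⟨i, j⟩ := q
  by_cases h : 1 ≤ i ∧ i + j ≤ m
  · rcases eq_or_ne i 1 with rfl | hi
    · rw [xiPiece_one h.2]
      intro α hα
      have := hα.1
      rwa [add_comm j 1] at this
    · exact (xiPiece_of_two_le (by omega) h.2).le
  · rw [xiPiece_eq_bot h]
    exact bot_le

theorem extD_zero_form : extD (0 : FormField E M) = 0 := by
  simpa using extD_smul (0 : ℝ) (0 : FormField E M)

theorem exists_hamiltonian {j : ℕ} (α : xiPiece m ω₀ (1, j)) :
    ∃ x ∈ multivectorSpace E M (j + 1), contract x ω₀ = extD (α : FormField E M) := by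
  obtain ⟨α, hα⟩ := α
  by_cases h : 1 + j ≤ m
  · rw [xiPiece_one h] at hα
    exact hα.2
  · rw [xiPiece_eq_bot (by omega), Submodule.mem_bot] at hα
    refine ⟨0, Submodule.zero_mem _, ?_⟩
    subst hα
    rw [extD_zero_form]
    funext p
    simp [contract]

variable (m ω₀)

/-- A linear projection onto a bigraded piece. -/
def xiProj (q : ℕ × ℕ) : FormField E M →ₗ[ℝ] xiPiece m ω₀ q :=
  (exists_linear_pseudoinverse (V := xiPiece m ω₀ q) (W := FormField E M)
    (xiPiece m ω₀ q).subtype).choose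

theorem xiProj_coe {q : ℕ × ℕ} (α : xiPiece m ω₀ q) : xiProj m ω₀ q α = α :=
  Subtype.ext ((exists_linear_pseudoinverse (V := xiPiece m ω₀ q) (W := FormField E M)
    (xiPiece m ω₀ q).subtype).choose_spec α)

/-- A linear extension of `xiOf` to all families of forms. -/
def xiMk (i j : ℕ) : FormField E M →ₗ[ℝ] Xi m ω₀ :=
  xiOf m ω₀ i j ∘ₗ xiProj m ω₀ (i, j)

theorem xiMk_coe {i j : ℕ} (α : xiPiece m ω₀ (i, j)) : xiMk m ω₀ i j α = xiOf m ω₀ i j α :=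
  congrArg (xiOf m ω₀ i j) (xiProj_coe m ω₀ α)

theorem xiMk_mem_range (i j : ℕ) (α : FormField E M) :
    ∃ β, xiMk m ω₀ i j α = xiOf m ω₀ i j β :=
  ⟨_, rfl⟩

theorem xiMk_eq_zero {i j : ℕ} (h : ¬(1 ≤ i ∧ i + j ≤ m)) (α : FormField E M) :
    xiMk m ω₀ i j α = 0 := by
  obtain ⟨⟨β, hβ⟩, h'⟩ := xiMk_mem_range m ω₀ i j α
  have h0 : (⟨β, hβ⟩ : xiPiece m ω₀ (i, j)) = 0 := Subtype.ext (by
    rwa [xiPiece_eq_bot h, Submodule.mem_bot] at hβ)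
  rw [h', h0, map_zero]

/-- The exterior derivative on a bigraded piece. -/
def extDXi (q : ℕ × ℕ) : xiPiece m ω₀ q →ₗ[ℝ] FormField E M where
  toFun α := extD (α : FormField E M)
  map_add' α β := extD_add (xiPiece_le_formSpace q α.2) (xiPiece_le_formSpace q β.2)
  map_smul' c α := extD_smul c (α : FormField E M)

variable {m}

/-- The contraction `x ↦ ι_x ω`. -/
def contractLin : MultivectorField E M →ₗ[ℝ] FormField E M where
  toFun x := contract x ω₀
  map_add' x y := contract_add_left x y ω₀
  map_smul' c x := contract_smul_left c x ω₀

/-- A linear choice of multivector fields `x` with `ι_x ω = β`. -/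
def contractInv (n : ℕ) : FormField E M →ₗ[ℝ] multivectorSpace E M n :=
  (exists_linear_pseudoinverse (contractLin ω₀ ∘ₗ (multivectorSpace E M n).subtype)).choose

theorem contract_contractInv {n : ℕ} {x : MultivectorField E M} (hx : x ∈ multivectorSpace E M n) :
    contract (contractInv ω₀ n (contract x ω₀) : MultivectorField E M) ω₀ = contract x ω₀ :=
  (exists_linear_pseudoinverse
    (contractLin ω₀ ∘ₗ (multivectorSpace E M n).subtype)).choose_spec ⟨x, hx⟩

variable (m)

/-- A linear choice of hamiltonian multivector fields of the elements of the first column, extended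
by zero to the other columns. -/
def hamiltonianField : Xi m ω₀ →ₗ[ℝ] MultivectorField E M :=
  DirectSum.toModule ℝ (ℕ × ℕ) _ fun q =>
    if q.1 = 1 then
      (multivectorSpace E M (q.2 + 1)).subtype ∘ₗ contractInv ω₀ (q.2 + 1) ∘ₗ extDXi m ω₀ q
    else 0

variable {m ω₀}

theorem hamiltonianField_one {j : ℕ} (α : xiPiece m ω₀ (1, j)) :
    hamiltonianField m ω₀ (xiOf m ω₀ 1 j α) =
      contractInv ω₀ (j + 1) (extD (α : FormField E M)) := by
  rw [hamiltonianField, xiOf, DirectSum.toModule_lof, if_pos rfl]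
  rfl

theorem hamiltonianField_of_ne_one {i j : ℕ} (hi : i ≠ 1) (α : xiPiece m ω₀ (i, j)) :
    hamiltonianField m ω₀ (xiOf m ω₀ i j α) = 0 := by
  rw [hamiltonianField, xiOf, DirectSum.toModule_lof, if_neg hi]
  rfl

theorem hamiltonianField_of_closed {i j : ℕ} {α : xiPiece m ω₀ (i, j)}
    (hα : extD (α : FormField E M) = 0) : hamiltonianField m ω₀ (xiOf m ω₀ i j α) = 0 := by
  rcases eq_or_ne i 1 with rfl | hi
  · rw [hamiltonianField_one, hα, map_zero]
    rfl
  · exact hamiltonianField_of_ne_one hi α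

theorem hamiltonianField_one_mem {j : ℕ} (α : xiPiece m ω₀ (1, j)) :
    hamiltonianField m ω₀ (xiOf m ω₀ 1 j α) ∈ multivectorSpace E M (j + 1) := by
  rw [hamiltonianField_one]
  exact Subtype.prop _

theorem contract_hamiltonianField_one {j : ℕ} (α : xiPiece m ω₀ (1, j)) :
    contract (hamiltonianField m ω₀ (xiOf m ω₀ 1 j α)) ω₀ = extD (α : FormField E M) := by
  obtain ⟨x, hx, hxα⟩ := exists_hamiltonian α
  rw [hamiltonianField_one, ← hxα, contract_contractInv ω₀ hx]

variable (m ω₀) in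
theorem xiGrading_eq (k : ℤ) : xiGrading m ω₀ k =
    degreeGrading (A := fun q => xiPiece m ω₀ q) (fun q => (q.1 : ℤ) + q.2) k := by
  rw [xiGrading, degreeGrading, iSup_prod]

theorem xiOf_mem_xiGrading {i j : ℕ} {k : ℤ} (h : (i : ℤ) + j = k) (α : xiPiece m ω₀ (i, j)) :
    xiOf m ω₀ i j α ∈ xiGrading m ω₀ k :=
  Submodule.mem_iSup_of_mem i (Submodule.mem_iSup_of_mem j (Submodule.mem_iSup_of_mem h ⟨α, rfl⟩))

theorem xiGrading_le {k : ℤ} {S : Submodule ℝ (Xi m ω₀)}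
    (h : ∀ (i j : ℕ) (α : xiPiece m ω₀ (i, j)), (i : ℤ) + j = k → xiOf m ω₀ i j α ∈ S) :
    xiGrading m ω₀ k ≤ S := by
  refine iSup_le fun i => iSup₂_le fun j hij => ?_
  rintro _ ⟨α, rfl⟩
  exact h i j α hij

theorem xiGrading_eq_bot {k : ℤ} (hk : k ≤ 0) : xiGrading m ω₀ k = ⊥ := by
  rw [eq_bot_iff]
  refine xiGrading_le fun i j α hij => ?_
  rw [← xiMk_coe, xiMk_eq_zero m ω₀ (by omega)]
  exact Submodule.zero_mem _

/-- There is nothing in nonpositive degrees, so an entry of such a degree is zero and multilinear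
identities become trivial. Otherwise the degree `j + 1` names the row `j` of the first column. -/
theorem exists_eq_zero_or_natDegrees {n : ℕ} {d : Fin n → ℤ} {v : Fin n → Xi m ω₀}
    (hv : ∀ a, v a ∈ xiGrading m ω₀ (d a)) :
    (∃ a, v a = 0) ∨ ∃ j : Fin n → ℕ, ∀ a, d a = j a + 1 := by
  by_cases h : ∃ a, d a ≤ 0
  · obtain ⟨a, ha⟩ := h
    have := hv a
    rw [xiGrading_eq_bot ha, Submodule.mem_bot] at this
    exact Or.inl ⟨a, this⟩
  · push Not at h
    exact Or.inr ⟨fun a => (d a - 1).toNat, fun a => by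
      have := h a
      change d a = ((d a - 1).toNat : ℤ) + 1
      omega⟩

/-- In total degree `j + 1` the first column contributes only `Ξ_1^j`, and the other columns have
field zero. -/
theorem hamiltonianField_of_mem {j : ℕ} {v : Xi m ω₀} (hv : v ∈ xiGrading m ω₀ (j + 1)) :
    ∃ α : xiPiece m ω₀ (1, j), hamiltonianField m ω₀ v =
      hamiltonianField m ω₀ (xiOf m ω₀ 1 j α) := by
  let f : Xi m ω₀ →ₗ[ℝ] MultivectorField E M := hamiltonianField m ω₀
  let g : Xi m ω₀ →ₗ[ℝ] MultivectorField E M :=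
    f ∘ₗ xiOf m ω₀ 1 j ∘ₗ DirectSum.component ℝ (ℕ × ℕ) (fun q => xiPiece m ω₀ q) (1, j)
  suffices h : xiGrading m ω₀ (j + 1) ≤ LinearMap.eqLocus f g from
    ⟨DirectSum.component ℝ (ℕ × ℕ) (fun q => xiPiece m ω₀ q) (1, j) v, h hv⟩
  refine xiGrading_le fun i j' α hij => ?_
  change f (xiOf m ω₀ i j' α) = g (xiOf m ω₀ i j' α)
  rcases eq_or_ne i 1 with rfl | hi
  · obtain rfl : j' = j := by omega
    exact congrArg (f ∘ₗ xiOf m ω₀ 1 j') 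
      (DirectSum.component.lof_self (M := fun q => xiPiece m ω₀ q) ℝ (1, j') α).symm
  · have h0 : DirectSum.component ℝ (ℕ × ℕ) (fun q => xiPiece m ω₀ q) (1, j)
        (xiOf m ω₀ i j' α) = 0 :=
      (DirectSum.component.of (R := ℝ) (M := fun q => xiPiece m ω₀ q) (1, j) (i, j') α).trans
        (dif_neg (by simp [hi]))
    have h1 : g (xiOf m ω₀ i j' α) = f (xiOf m ω₀ 1 j 0) := congrArg (f ∘ₗ xiOf m ω₀ 1 j) h0
    rw [h1, map_zero, map_zero]
    exact hamiltonianField_of_ne_one hi α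

theorem hamiltonianField_mem {j : ℕ} {v : Xi m ω₀} (hv : v ∈ xiGrading m ω₀ (j + 1)) :
    hamiltonianField m ω₀ v ∈ multivectorSpace E M (j + 1) := by
  obtain ⟨α, hα⟩ := hamiltonianField_of_mem hv
  rw [hα]
  exact hamiltonianField_one_mem α

variable (m ω₀) in
/-- The differential `l₁`. -/
def xiDifferential : Module.End ℝ (Xi m ω₀) :=
  DirectSum.toModule ℝ (ℕ × ℕ) _ fun q =>
    if 2 ≤ q.1 then -(xiMk m ω₀ (q.1 - 1) q.2 ∘ₗ extDXi m ω₀ q) else 0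

theorem xiDifferential_of_two_le {i j : ℕ} (hi : 2 ≤ i) (α : xiPiece m ω₀ (i, j)) :
    xiDifferential m ω₀ (xiOf m ω₀ i j α) =
      xiMk m ω₀ (i - 1) j (-extD (α : FormField E M)) := by
  rw [xiDifferential, xiOf, DirectSum.toModule_lof, if_pos hi, map_neg]
  rfl

theorem xiDifferential_of_lt_two {i j : ℕ} (hi : i < 2) (α : xiPiece m ω₀ (i, j)) :
    xiDifferential m ω₀ (xiOf m ω₀ i j α) = 0 := by
  rw [xiDifferential, xiOf, DirectSum.toModule_lof, if_neg (not_le.2 hi)]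
  rfl

variable (E M) in
/-- The component of degree `k`. -/
def degreePart (k : ℕ) : FormField E M →ₗ[ℝ] FormField E M where
  toFun α p l := if l = k then α p l else 0
  map_add' α β := by
    funext p l
    by_cases h : l = k <;> simp [h]
  map_smul' c α := by
    funext p l
    by_cases h : l = k <;> simp [h]

theorem degreePart_self {k : ℕ} {α : FormField E M} (hα : α ∈ formSpace E M k) :
    degreePart E M k α = α := by
  funext p l
  change (if l = k then α p l else 0) = _
  split_ifs with h
  · rfl
  · exact (hα.2 p l h).symm

theorem degreePart_of_ne {k k' : ℕ} (h : k ≠ k') {α : FormField E M} (hα : α ∈ formSpace E M k') :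
    degreePart E M k α = 0 := by
  funext p l
  change (if l = k then α p l else 0) = _
  split_ifs with hl
  · exact hα.2 p l (by omega)
  · rfl

variable (m ω₀) in
/-- The brackets of `Ξ(M)`. -/
def xiBrackets : Brackets (Xi m ω₀)
  | 0 => MultilinearMap.ofSubsingleton ℝ (Xi m ω₀) (Xi m ω₀) (0 : Fin 1) (xiDifferential m ω₀)
  -- The row of the value depends on the arguments, so it is read off linearly from the form degree:
  -- the part of degree `m - (n + 1 + j)` goes to row `j`. Rows beyond `m` are zero.
  | n + 1 => (∑ j ∈ Finset.range (m + 1), xiMk m ω₀ (n + 1) j ∘ₗ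
      degreePart E M (m - (n + 1 + j)) ∘ₗ contractLin ω₀).compMultilinearMap
        ((MultilinearMap.mkPiAlgebraFin ℝ (n + 2) (MultivectorField E M)).compLinearMap
          fun _ => hamiltonianField m ω₀)

theorem xiBrackets_zero (v : Fin 1 → Xi m ω₀) :
    xiBrackets m ω₀ 0 v = xiDifferential m ω₀ (v 0) :=
  rfl

theorem xiBrackets_apply {n : ℕ} (hn : 1 ≤ n) (v : Fin (n + 1) → Xi m ω₀) :
    xiBrackets m ω₀ n v = ∑ j ∈ Finset.range (m + 1), xiMk m ω₀ n j
      (degreePart E M (m - (n + j)) (contractProd (fun a => hamiltonianField m ω₀ (v a)) ω₀)) := by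
  obtain ⟨n, rfl⟩ := Nat.exists_eq_succ_of_ne_zero (by omega : n ≠ 0)
  simp only [Nat.succ_eq_add_one, xiBrackets, LinearMap.compMultilinearMap_apply,
    LinearMap.sum_apply, LinearMap.comp_apply, MultilinearMap.compLinearMap_apply,
    MultilinearMap.mkPiAlgebraFin_apply]
  rfl

theorem xiBrackets_eq_zero {n : ℕ} (hn : 1 ≤ n) {v : Fin (n + 1) → Xi m ω₀}
    (h : ∃ a, hamiltonianField m ω₀ (v a) = 0) : xiBrackets m ω₀ n v = 0 := by
  obtain ⟨n, rfl⟩ := Nat.exists_eq_succ_of_ne_zero (by omega : n ≠ 0)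
  obtain ⟨a, ha⟩ := h
  simp only [Nat.succ_eq_add_one, xiBrackets, LinearMap.compMultilinearMap_apply,
    MultilinearMap.compLinearMap_apply]
  rw [MultilinearMap.map_coord_zero _ a ha, map_zero]

end XiBrackets

/-! ### The `L∞`-identities -/

theorem composeFirst_last {L : Type*} [AddCommGroup L] [Module ℝ L] (l : Brackets L) {n : ℕ}
    (v : Fin (n + 1) → L) : composeFirst l (Fin.last n) v = l 0 fun _ => l n v := by
  -- The arity of the outer bracket is a difference that equals zero only propositionally, so it is
  -- replaced by a variable.
  have h : ∀ (k : ℕ) (_ : k = 0) (w : Fin (k + 1) → L), l k w = l 0 fun _ => w 0 := by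
    rintro k rfl w
    congr 1
    funext a
    rw [Subsingleton.elim (α := Fin 1) a 0]
  rw [composeFirst, h _ (by simp)]
  rfl

theorem composeFirst_consPerm {L : Type*} [AddCommGroup L] [Module ℝ L] (l : Brackets L) {n : ℕ}
    (v : Fin (n + 3) → L) (a : Fin (n + 3)) (b : Fin (n + 2)) :
    composeFirst l (1 : Fin (n + 3)) (v ∘ consPerm a (consPerm b 1)) =
      l (n + 1) (Fin.cons (l 1 ![v a, v (a.succAbove b)])
        fun c => v (a.succAbove (b.succAbove c))) := by
  have h : ∀ (i : Fin (n + 3)) (_ : i = ⟨1, by omega⟩) (w : Fin (n + 3) → L),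
      composeFirst l i w = l (n + 1) (Fin.cons (l 1 ![w 0, w 1]) fun c => w c.succ.succ) := by
    rintro i rfl w
    change l (n + 1) (Fin.cons (l 1 _) _) = _
    congr 2
    · congr 1
      funext c
      refine Fin.cases rfl (fun c => ?_) c
      obtain rfl : c = 0 := Subsingleton.elim _ _
      rfl
    · funext c
      exact congrArg w (Fin.ext (by simp; omega))
  rw [h 1 rfl]
  congr 2

section Identities

variable {E : Type*} [NormedAddCommGroup E] [NormedSpace ℝ E] [FiniteDimensional ℝ E]
  {M : Type*} [TopologicalSpace M] [ChartedSpace E M] [IsManifold 𝓘(ℝ, E) ∞ M]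
  {m : ℕ} {ω₀ : FormField E M}

theorem neg_extD_mem_xiPiece {i j : ℕ} (hi : 2 ≤ i) (α : xiPiece m ω₀ (i, j)) :
    -extD (α : FormField E M) ∈ xiPiece m ω₀ (i - 1, j) := by
  obtain ⟨α, hα⟩ := α
  by_cases h : i + j ≤ m
  · rw [xiPiece_of_two_le hi h] at hα
    have h1 : -extD α ∈ formSpace E M (m - (i - 1 + j)) := by
      have := Submodule.neg_mem _ (extD_mem_formSpace hα)
      rwa [show m - (i + j) + 1 = m - (i - 1 + j) by omega] at this
    rcases eq_or_ne i 2 with rfl | hi2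
    -- Here the target is the first column, and a closed form is hamiltonian with field zero.
    · rw [xiPiece_one (by omega)]
      refine ⟨by rwa [add_comm j 1], 0, Submodule.zero_mem _, ?_⟩
      rw [← neg_one_smul ℝ, extD_smul, extD_extD hα.1, smul_zero]
      funext p
      simp [contract]
    · rwa [xiPiece_of_two_le (by omega) (by omega)]
  · rw [xiPiece_eq_bot (by omega), Submodule.mem_bot] at hα
    subst hα
    rw [extD_zero_form, neg_zero]
    exact Submodule.zero_mem _

theorem extD_neg_extD {i j : ℕ} (α : xiPiece m ω₀ (i, j)) :
    extD (-extD (α : FormField E M)) = 0 := by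
  rw [← neg_one_smul ℝ, extD_smul, extD_extD (xiPiece_le_formSpace _ α.2).1, smul_zero]

/-- Values of `l₁` are closed, and the chosen field depends linearly on the exterior derivative.
Hence inserting `l₁` into a higher bracket gives zero. -/
theorem hamiltonianField_xiDifferential (v : Xi m ω₀) :
    hamiltonianField m ω₀ (xiDifferential m ω₀ v) = 0 := by
  suffices h : hamiltonianField m ω₀ ∘ₗ xiDifferential m ω₀ = 0 from LinearMap.congr_fun h v
  refine DirectSum.linearMap_ext _ fun ⟨i, j⟩ => LinearMap.ext fun α => ?_
  change hamiltonianField m ω₀ (xiDifferential m ω₀ (xiOf m ω₀ i j α)) = 0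
  rcases le_or_gt 2 i with hi | hi
  · rw [xiDifferential_of_two_le hi, xiMk_coe m ω₀ ⟨_, neg_extD_mem_xiPiece hi α⟩]
    exact hamiltonianField_of_closed (extD_neg_extD α)
  · rw [xiDifferential_of_lt_two hi, map_zero]

theorem xiDifferential_xiDifferential (v : Xi m ω₀) :
    xiDifferential m ω₀ (xiDifferential m ω₀ v) = 0 := by
  suffices h : xiDifferential m ω₀ ∘ₗ xiDifferential m ω₀ = 0 from LinearMap.congr_fun h v
  refine DirectSum.linearMap_ext _ fun ⟨i, j⟩ => LinearMap.ext fun α => ?_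
  change xiDifferential m ω₀ (xiDifferential m ω₀ (xiOf m ω₀ i j α)) = 0
  rcases le_or_gt 2 i with hi | hi
  · rw [xiDifferential_of_two_le hi, xiMk_coe m ω₀ ⟨_, neg_extD_mem_xiPiece hi α⟩]
    rcases le_or_gt 2 (i - 1) with hi' | hi'
    · rw [xiDifferential_of_two_le hi', extD_neg_extD, neg_zero, map_zero]
    · rw [xiDifferential_of_lt_two hi']
  · rw [xiDifferential_of_lt_two hi, map_zero]

theorem xiDifferential_mem {k : ℤ} {v : Xi m ω₀} (hv : v ∈ xiGrading m ω₀ k) :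
    xiDifferential m ω₀ v ∈ xiGrading m ω₀ (k - 1) := by
  suffices h : xiGrading m ω₀ k ≤ (xiGrading m ω₀ (k - 1)).comap (xiDifferential m ω₀) from h hv
  refine xiGrading_le fun i j α hij => ?_
  rw [Submodule.mem_comap]
  rcases le_or_gt 2 i with hi | hi
  · rw [xiDifferential_of_two_le hi, xiMk_coe m ω₀ ⟨_, neg_extD_mem_xiPiece hi α⟩]
    exact xiOf_mem_xiGrading (by omega) _
  · rw [xiDifferential_of_lt_two hi]
    exact Submodule.zero_mem _

theorem extD_contract_hamiltonianField {j : ℕ} {v : Xi m ω₀} (hv : v ∈ xiGrading m ω₀ (j + 1)) :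
    extD (contract (hamiltonianField m ω₀ v) ω₀) = 0 := by
  obtain ⟨α, hα⟩ := hamiltonianField_of_mem hv
  rw [hα, contract_hamiltonianField_one, extD_extD (xiPiece_le_formSpace _ α.2).1]

/-- The fields remove `∑ (j a + 1)` from the degree `m + 1` of `ω`, which leaves `m - (n + ∑ j a)`.
Only for two factors is the target the first column, and then the Schouten bracket is a hamiltonian
field. -/
theorem contractProd_mem_xiPiece (hω : IsPreSymplectic m ω₀) {n : ℕ} (hn : 1 ≤ n)
    {j : Fin (n + 1) → ℕ} {x : Fin (n + 1) → MultivectorField E M}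
    (hx : ∀ a, x a ∈ multivectorSpace E M (j a + 1))
    (hdx : ∀ a, extD (contract (x a) ω₀) = 0) :
    contractProd x ω₀ ∈ xiPiece m ω₀ (n, ∑ a, j a) := by
  have hsum : ∑ a, (j a + 1) = ∑ a, j a + (n + 1) := by
    simp [Finset.sum_add_distrib]
  by_cases h : n + ∑ a, j a ≤ m
  · have hmem : contractProd x ω₀ ∈ formSpace E M (m - (n + ∑ a, j a)) :=
      contractProd_mem_formSpace hx (by
        rw [hsum, show m - (n + ∑ a, j a) + (∑ a, j a + (n + 1)) = m + 1 by omega]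
        exact hω.1)
    rcases eq_or_ne n 1 with rfl | hn1
    · rw [xiPiece_one h]
      refine ⟨by rwa [add_comm _ 1], _, ?_, (contract_schouten (hx 0) (hx 1) hω.1.1 hω.2 (hdx 0)
        (hdx 1)).trans ?_⟩
      · rw [Fin.sum_univ_two]
        exact schouten_mem (hx 0) (hx 1)
      · rw [contractProd_succ, contractProd_succ, contractProd_zero]
        rfl
    · rwa [xiPiece_of_two_le (by omega) h]
  · rw [contractProd_eq_zero hx hω.1 (by omega)]
    exact Submodule.zero_mem _

theorem xiBrackets_of_mem (hω : IsPreSymplectic m ω₀) {n : ℕ} (hn : 1 ≤ n) {j : Fin (n + 1) → ℕ}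
    {v : Fin (n + 1) → Xi m ω₀} (hv : ∀ a, v a ∈ xiGrading m ω₀ (j a + 1)) :
    ∃ β : xiPiece m ω₀ (n, ∑ a, j a),
      (β : FormField E M) = contractProd (fun a => hamiltonianField m ω₀ (v a)) ω₀ ∧
      xiBrackets m ω₀ n v = xiOf m ω₀ n (∑ a, j a) β := by
  have hmem := contractProd_mem_xiPiece hω hn (fun a => hamiltonianField_mem (hv a))
    fun a => extD_contract_hamiltonianField (hv a)
  refine ⟨⟨_, hmem⟩, rfl, ?_⟩
  rw [xiBrackets_apply hn, ← xiMk_coe]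
  have hf := xiPiece_le_formSpace _ hmem
  rw [Finset.sum_eq_single (∑ a, j a), degreePart_self hf]
  · intro k _ hk
    -- Distinct rows within the range have distinct form degrees. Outside it truncated subtraction
    -- may identify degrees, but then the target piece or the value itself is zero.
    by_cases h : n + k ≤ m ∧ n + ∑ a, j a ≤ m
    · rw [degreePart_of_ne (by simp only []; omega) hf, map_zero]
    · rcases not_and_or.1 h with h | h
      · exact xiMk_eq_zero m ω₀ (by omega) _
      · rw [xiPiece_eq_bot (by omega), Submodule.mem_bot] at hmem
        rw [hmem, map_zero, map_zero]
  · intro hj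
    rw [Finset.mem_range] at hj
    exact xiMk_eq_zero m ω₀ (by omega) _

/-- With one argument the value is closed; with at least three it lies in column `n ≥ 2`. So only
`l₂` has values that a higher bracket can see. -/
theorem hamiltonianField_xiBrackets {n : ℕ} (hn : n ≠ 1) (v : Fin (n + 1) → Xi m ω₀) :
    hamiltonianField m ω₀ (xiBrackets m ω₀ n v) = 0 := by
  rcases Nat.eq_zero_or_pos n with rfl | hn0
  · exact hamiltonianField_xiDifferential _
  · rw [xiBrackets_apply hn0, map_sum]
    exact Finset.sum_eq_zero fun k _ => hamiltonianField_of_ne_one hn _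

theorem xiBrackets_isXiBrackets (hω : IsPreSymplectic m ω₀) :
    IsXiBrackets m ω₀ (xiBrackets m ω₀) where
  differential i j hi α := by
    refine ⟨⟨_, neg_extD_mem_xiPiece hi α⟩, rfl, ?_⟩
    rw [xiBrackets_zero, xiDifferential_of_two_le hi, ← xiMk_coe]
  differential_column_one j α := by
    rw [xiBrackets_zero, xiDifferential_of_lt_two (by omega)]
  higher n hn j α x h := by
    obtain ⟨β, hβ, hv⟩ := xiBrackets_of_mem hω hn
      (v := fun a => xiOf m ω₀ 1 (j a) (α a)) (j := j)
      fun a => xiOf_mem_xiGrading (by push_cast; ring) _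
    -- The chosen fields and the given ones have the same contractions `dα` with `ω`.
    refine ⟨β, hβ.trans ?_, hv⟩
    exact contractProd_congr (fun a => hamiltonianField_one_mem (α a)) (fun a => (h a).2.1)
      fun a => (contract_hamiltonianField_one (α a)).trans (h a).2.2.2.symm
  higher_zero n hn i j α h := by
    obtain ⟨a, ha⟩ := h
    exact xiBrackets_eq_zero hn ⟨a, hamiltonianField_of_ne_one ha (α a)⟩

theorem xiBrackets_degree (hω : IsPreSymplectic m ω₀) (n : ℕ) (d : Fin (n + 1) → ℤ)
    (v : Fin (n + 1) → Xi m ω₀) (hv : ∀ a, v a ∈ xiGrading m ω₀ (d a)) :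
    xiBrackets m ω₀ n v ∈ xiGrading m ω₀ (∑ a, d a - 1) := by
  rcases Nat.eq_zero_or_pos n with rfl | hn
  · rw [Fin.sum_univ_one]
    exact xiDifferential_mem (hv 0)
  · rcases exists_eq_zero_or_natDegrees hv with ⟨a, ha⟩ | ⟨j, hj⟩
    · rw [MultilinearMap.map_coord_zero _ a ha]
      exact Submodule.zero_mem _
    · obtain ⟨β, -, h⟩ := xiBrackets_of_mem hω hn (j := j) fun a => hj a ▸ hv a
      rw [h]
      refine xiOf_mem_xiGrading ?_ β
      simp only [hj, Finset.sum_add_distrib]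
      simp
      ring

omit [FiniteDimensional ℝ E] [IsManifold 𝓘(ℝ, E) ∞ M] in
-- Elements of `Ξ_1^j` and their fields have the same degree `j + 1`, so the Koszul sign is the sign
-- of permuting the fields in the exterior algebra.
theorem xiBrackets_symmetric (n : ℕ) (d : Fin (n + 1) → ℤ)
    (v : Fin (n + 1) → Xi m ω₀) (hv : ∀ a, v a ∈ xiGrading m ω₀ (d a))
    (σ : Equiv.Perm (Fin (n + 1))) :
    koszulSign d σ • xiBrackets m ω₀ n (v ∘ σ) = xiBrackets m ω₀ n v := by
  rcases Nat.eq_zero_or_pos n with rfl | hn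
  · obtain rfl : σ = 1 := Subsingleton.elim (α := Equiv.Perm (Fin 1)) _ _
    rw [koszulSign_one, one_smul]
    rfl
  · rcases exists_eq_zero_or_natDegrees hv with ⟨a, ha⟩ | ⟨j, hj⟩
    · rw [MultilinearMap.map_coord_zero _ a ha,
        MultilinearMap.map_coord_zero _ (σ.symm a) (by simpa using ha), smul_zero]
    · have hx : ∀ a, hamiltonianField m ω₀ (v a) ∈ multivectorSpace E M (j a + 1) := fun a =>
        hamiltonianField_mem (hj a ▸ hv a)
      have h := ofFn_prod_eq_koszulSign_smul (fun a => hamiltonianField m ω₀ (v a)) d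
        (fun a b => by
          rw [multivector_mul_comm_negOnePow (hx a) (hx b), hj, hj]
          push_cast
          rfl) σ
      have h2 : contractProd (fun a => hamiltonianField m ω₀ (v a)) ω₀ = koszulSign d σ •
          contractProd (fun a => hamiltonianField m ω₀ ((v ∘ σ) a)) ω₀ := by
        have := congrArg (contractLin ω₀) h
        rwa [Units.smul_def, map_zsmul, ← Units.smul_def] at this
      rw [xiBrackets_apply hn v, h2, xiBrackets_apply hn (v ∘ σ), Finset.smul_sum]
      refine Finset.sum_congr rfl fun k _ => ?_
      rw [Units.smul_def, Units.smul_def, map_zsmul, map_zsmul]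

end Identities

/-! ### The generalized Jacobi identities -/

section Jacobi

variable {E : Type*} [NormedAddCommGroup E] [NormedSpace ℝ E] [FiniteDimensional ℝ E]
  {M : Type*} [TopologicalSpace M] [ChartedSpace E M] [IsManifold 𝓘(ℝ, E) ∞ M]
  {m : ℕ} {ω₀ : FormField E M}

theorem composeFirst_xiBrackets_eq_zero {n : ℕ} {i : Fin (n + 1)} (hi : (i : ℕ) ≠ 1)
    (hin : (i : ℕ) < n) (v : Fin (n + 1) → Xi m ω₀) :
    composeFirst (xiBrackets m ω₀) i v = 0 :=
  xiBrackets_eq_zero (by omega) ⟨0, hamiltonianField_xiBrackets hi _⟩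

/-- The double bracket is the contraction with the Schouten bracket. -/
theorem xiBrackets_cons_xiBrackets (hω : IsPreSymplectic m ω₀) {n : ℕ} {j : Fin (n + 3) → ℕ}
    {v : Fin (n + 3) → Xi m ω₀} (hv : ∀ a, v a ∈ xiGrading m ω₀ (j a + 1)) (a : Fin (n + 3))
    (b : Fin (n + 2)) :
    xiBrackets m ω₀ (n + 1) (Fin.cons (xiBrackets m ω₀ 1 ![v a, v (a.succAbove b)])
        fun c => v (a.succAbove (b.succAbove c))) =
      xiMk m ω₀ (n + 1) (∑ a, j a) (contract
        (schouten (j a + 1) (j (a.succAbove b) + 1) (hamiltonianField m ω₀ (v a))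
          (hamiltonianField m ω₀ (v (a.succAbove b))))
        (contractProd (fun c => hamiltonianField m ω₀ (v (a.succAbove (b.succAbove c)))) ω₀)) := by
  set b' := a.succAbove b
  set x := fun a => hamiltonianField m ω₀ (v a)
  have hx : ∀ a, x a ∈ multivectorSpace E M (j a + 1) := fun a => hamiltonianField_mem (hv a)
  have hdx : ∀ a, extD (contract (x a) ω₀) = 0 := fun a => extD_contract_hamiltonianField (hv a)
  obtain ⟨β, hβ, h1⟩ := xiBrackets_of_mem hω le_rfl (v := ![v a, v b']) (j := ![j a, j b'])
    (fun c => Fin.cases (hv a) (fun c => Fin.cases (hv b') (fun c => c.elim0) c) c)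
  have hsum2 : ∑ c, ![j a, j b'] c = j a + j b' := by simp
  have hyg : xiBrackets m ω₀ 1 ![v a, v b'] ∈ xiGrading m ω₀ (((j a + j b' : ℕ) : ℤ) + 1) := by
    rw [h1]
    exact xiOf_mem_xiGrading (by rw [hsum2]; push_cast; ring) β
  have hy := hamiltonianField_mem hyg
  -- The field chosen for the inner bracket need not be the Schouten bracket; it suffices that their
  -- contractions with `ω` agree.
  have hyω : contract (hamiltonianField m ω₀ (xiBrackets m ω₀ 1 ![v a, v b'])) ω₀ =
      contract (schouten (j a + 1) (j b' + 1) (x a) (x b')) ω₀ := by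
    rw [h1, contract_hamiltonianField_one, hβ, contract_schouten (hx a) (hx b') hω.1.1 hω.2
      (hdx a) (hdx b'), contractProd_succ, contractProd_succ, contractProd_zero]
    rfl
  set w : Fin (n + 2) → Xi m ω₀ := Fin.cons (xiBrackets m ω₀ 1 ![v a, v b'])
    fun c => v (a.succAbove (b.succAbove c))
  obtain ⟨γ, hγ, h2⟩ := xiBrackets_of_mem hω (Nat.le_add_left 1 n) (v := w)
    (j := Fin.cons (j a + j b') fun c => j (a.succAbove (b.succAbove c)))
    (fun c => by
      refine Fin.cases ?_ (fun c => ?_) c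
      · exact hyg
      · exact hv _)
  have hsum : ∑ c, (Fin.cons (j a + j b') fun c => j (a.succAbove (b.succAbove c)) :
      Fin (n + 2) → ℕ) c = ∑ c, j c := by
    rw [Fin.sum_univ_succ, Fin.sum_univ_succAbove j a, Fin.sum_univ_succAbove _ b]
    simp only [Fin.cons_zero, Fin.cons_succ]
    exact add_assoc _ _ _
  rw [h2, ← xiMk_coe, hγ, hsum]
  congr 1
  rw [← contractProd_cons]
  refine contractProd_congr (d := Fin.cons (j a + j b' + 1)
    fun c => j (a.succAbove (b.succAbove c)) + 1) (fun c => ?_) (fun c => ?_) fun c => ?_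
  · exact Fin.cases hy (fun c => hx _) c
  · exact Fin.cases (schouten_mem (hx a) (hx b')) (fun c => hx _) c
  · exact Fin.cases hyω (fun c => rfl) c

theorem xiBrackets_jacobi (hω : IsPreSymplectic m ω₀) (n : ℕ) (d : Fin (n + 1) → ℤ)
    (v : Fin (n + 1) → Xi m ω₀) (hv : ∀ a, v a ∈ xiGrading m ω₀ (d a)) :
    jacobiator (xiBrackets m ω₀) d v = 0 := by
  classical
  rcases exists_eq_zero_or_natDegrees hv with h | ⟨j, hj⟩
  · exact jacobiator_eq_zero_of_coord _ d h
  obtain rfl : d = fun a => (j a : ℤ) + 1 := funext hj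
  have hlast : ∀ σ : Equiv.Perm (Fin (n + 1)), IsUnshuffle ((Fin.last n : ℕ) + 1) σ ↔ σ = 1 :=
    fun σ => isUnshuffle_self
  have hsumlast : (∑ σ : Equiv.Perm (Fin (n + 1)) with IsUnshuffle ((Fin.last n : ℕ) + 1) σ,
      koszulSign (fun a => (j a : ℤ) + 1) σ •
        composeFirst (xiBrackets m ω₀) (Fin.last n) (v ∘ σ)) =
      xiDifferential m ω₀ (xiBrackets m ω₀ n v) := by
    simp only [hlast]
    rw [Finset.sum_filter, Finset.sum_eq_single 1 (fun σ _ h => if_neg h) (by simp), if_pos rfl,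
      koszulSign_one, one_smul, composeFirst_last]
    rfl
  rw [jacobiator]
  match n, j, v, hv, hsumlast with
  | 0, j, v, hv, hsumlast =>
    rw [Fin.sum_univ_one]
    refine hsumlast.trans ?_
    exact xiDifferential_xiDifferential _
  -- Two arguments: inserting `l₁` into `l₂` gives zero, and `l₁` vanishes on the first column,
  -- where `l₂` takes its values.
  | 1, j, v, hv, hsumlast =>
    rw [Fin.sum_univ_two]
    obtain ⟨β, -, h⟩ := xiBrackets_of_mem hω le_rfl hv
    rw [Finset.sum_eq_zero fun σ _ => by
      rw [composeFirst_xiBrackets_eq_zero (by simp) (by simp), smul_zero], zero_add]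
    refine hsumlast.trans ?_
    rw [h, xiDifferential_of_lt_two (by omega)]
  | n + 2, j, v, hv, hsumlast =>
    have hne : (1 : Fin (n + 3)) ≠ Fin.last (n + 2) := by
      simp [Fin.ext_iff]
    -- Index `1` is the insertion of `l₂`, the last index is `l₁` applied to the full bracket; all
    -- other insertions vanish.
    rw [Finset.sum_eq_add (1 : Fin (n + 3)) (Fin.last (n + 2)) hne (fun i _ hi => ?_) (by simp)
      (by simp), hsumlast]
    · obtain ⟨β, hβ, h⟩ := xiBrackets_of_mem hω (Nat.le_add_left 1 (n + 1)) hv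
      rw [h, xiDifferential_of_two_le (by omega), hβ, extD_contractProd
        (fun a => hamiltonianField_mem (hv a)) hω.1.1 hω.2
        (fun a => extD_contract_hamiltonianField (hv a)) (fun a => (j a : ℤ) + 1) (fun a => rfl),
        map_neg, map_sum]
      -- The sign in `l₁ = -d` puts the expansion of `d` on the other side, where it matches the sum
      -- over unshuffles pair by pair.
      rw [add_neg_eq_zero]
      refine (sum_unshuffle_two _).trans (Finset.sum_congr rfl fun a _ => ?_)
      rw [map_sum]
      refine Finset.sum_congr rfl fun b _ => ?_
      split_ifs with hab
      · rw [composeFirst_consPerm, xiBrackets_cons_xiBrackets hω hv, koszulSign_consPerm,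
          koszulSign_consPerm, koszulSign_one, mul_one, Units.smul_def, Units.smul_def, map_zsmul]
        rfl
      · rw [map_zero]
    · refine Finset.sum_eq_zero fun σ _ => ?_
      rw [composeFirst_xiBrackets_eq_zero (fun h => hi.1 (Fin.ext h))
        (lt_of_le_of_ne (Nat.le_of_lt_succ i.2) fun h => hi.2 (Fin.ext h)), smul_zero]

theorem xiBrackets_isLInfinityAlgebra (hω : IsPreSymplectic m ω₀) :
    IsLInfinityAlgebra (xiGrading m ω₀) (xiBrackets m ω₀) where
  isInternal := by
    rw [funext (xiGrading_eq m ω₀)]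
    exact isInternal_degreeGrading (A := fun q => xiPiece m ω₀ q) _
  positive k hk := xiGrading_eq_bot hk
  degree := xiBrackets_degree hω
  symmetric := xiBrackets_symmetric
  jacobi := xiBrackets_jacobi hω

end Jacobi

/-! ### Uniqueness, and Rogers' brackets -/

section Rogers

variable {E : Type*} [NormedAddCommGroup E] [NormedSpace ℝ E]
  {M : Type*} [TopologicalSpace M] [ChartedSpace E M] {m : ℕ} {ω₀ : FormField E M}

theorem xiOf_eq_zero {i j : ℕ} (h : ¬(1 ≤ i ∧ i + j ≤ m)) (α : xiPiece m ω₀ (i, j)) :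
    xiOf m ω₀ i j α = 0 := by
  rw [← xiMk_coe, xiMk_eq_zero m ω₀ h]

theorem multilinearMap_zero_apply {L L' : Type*} [AddCommGroup L] [Module ℝ L] [AddCommGroup L']
    [Module ℝ L'] (f : MultilinearMap ℝ (fun _ : Fin 1 => L) L') : (f fun _ => 0) = 0 :=
  f.map_coord_zero 0 rfl

theorem fin_one_eq_const {L : Type*} (v : Fin 1 → L) : v = fun _ => v 0 :=
  funext fun a => congrArg v (Subsingleton.elim a 0)

theorem exists_isHamiltonianPair {j : ℕ} (h : 1 + j ≤ m) (α : xiPiece m ω₀ (1, j)) :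
    ∃ x, IsHamiltonianPair m ω₀ (j + 1) x (α : FormField E M) := by
  obtain ⟨x, hx, hxα⟩ := exists_hamiltonian α
  have hα := xiPiece_le_formSpace _ α.2
  rw [add_comm] at hα h
  exact ⟨x, h, hx, hα, hxα⟩

/-- The prescriptions reach all homogeneous arguments: pieces outside the index range are zero, and
inside it every element of the first column belongs to a hamiltonian pair. -/
theorem IsXiBrackets.unique {l l' : Brackets (Xi m ω₀)} (hl : IsXiBrackets m ω₀ l)
    (hl' : IsXiBrackets m ω₀ l') : l = l' := by
  have h1 : ∀ (i j : ℕ) (α : xiPiece m ω₀ (i, j)),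
      (l 0 fun _ => xiOf m ω₀ i j α) = l' 0 fun _ => xiOf m ω₀ i j α := by
    intro i j α
    rcases Nat.lt_trichotomy i 1 with hi | rfl | hi
    · rw [xiOf_eq_zero (by omega), multilinearMap_zero_apply, multilinearMap_zero_apply]
    · rw [hl.differential_column_one, hl'.differential_column_one]
    · obtain ⟨β, hβ, h⟩ := hl.differential i j hi α
      obtain ⟨β', hβ', h'⟩ := hl'.differential i j hi α
      rw [h, h', Subtype.ext (hβ.trans hβ'.symm)]
  funext n
  refine multilinearMap_directSum_ext (A := fun q => xiPiece m ω₀ q) fun p α => ?_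
  obtain ⟨i, j, rfl⟩ : ∃ i j : Fin (n + 1) → ℕ, p = fun a => (i a, j a) :=
    ⟨fun a => (p a).1, fun a => (p a).2, rfl⟩
  change l n (fun a => xiOf m ω₀ (i a) (j a) (α a)) = l' n fun a => xiOf m ω₀ (i a) (j a) (α a)
  rcases Nat.eq_zero_or_pos n with rfl | hn
  · rw [fin_one_eq_const fun a => xiOf m ω₀ (i a) (j a) (α a)]
    exact h1 _ _ _
  by_cases h0 : ∃ a, ¬(1 ≤ i a ∧ i a + j a ≤ m)
  · obtain ⟨a, ha⟩ := h0
    have hz : xiOf m ω₀ (i a) (j a) (α a) = 0 := xiOf_eq_zero ha _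
    rw [MultilinearMap.map_coord_zero _ a hz, MultilinearMap.map_coord_zero _ a hz]
  push Not at h0
  by_cases hi : ∃ a, i a ≠ 1
  · rw [hl.higher_zero n hn i j α hi, hl'.higher_zero n hn i j α hi]
  push Not at hi
  obtain rfl : i = fun _ => 1 := funext hi
  choose x hx using fun a => exists_isHamiltonianPair (h0 a).2 (α a)
  obtain ⟨β, hβ, h⟩ := hl.higher n hn j α x hx
  obtain ⟨β', hβ', h'⟩ := hl'.higher n hn j α x hx
  rw [h, h', Subtype.ext (hβ.trans hβ'.symm)]

theorem rogersInclusion_of {n : ℕ} (α : rogersPiece m ω₀ n) :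
    rogersInclusion m ω₀ (rogersOf m ω₀ n α) =
      xiOf m ω₀ n 0 (Submodule.inclusion (rogersPiece_eq m ω₀ n).le α) := by
  rw [rogersInclusion, rogersOf, DirectSum.toModule_lof]
  rfl

theorem rogersInclusion_of_eq_xiMk {n : ℕ} (α : rogersPiece m ω₀ n) :
    rogersInclusion m ω₀ (rogersOf m ω₀ n α) = xiMk m ω₀ n 0 α := by
  rw [rogersInclusion_of, ← xiMk_coe]
  rfl

/-- The bottom row components recover the element, which makes the inclusion injective and lets it
reflect the grading. -/
theorem coe_rogersInclusion_apply (v : Rogers m ω₀) (n : ℕ) :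
    (rogersInclusion m ω₀ v (n, 0) : FormField E M) = v n := by
  let f : Rogers m ω₀ →ₗ[ℝ] FormField E M := (xiPiece m ω₀ (n, 0)).subtype ∘ₗ
    DirectSum.component ℝ (ℕ × ℕ) (fun q => xiPiece m ω₀ q) (n, 0) ∘ₗ rogersInclusion m ω₀
  let g : Rogers m ω₀ →ₗ[ℝ] FormField E M := (rogersPiece m ω₀ n).subtype ∘ₗ
    DirectSum.component ℝ ℕ (fun i => rogersPiece m ω₀ i) n
  suffices h : f = g from LinearMap.congr_fun h v
  refine DirectSum.linearMap_ext _ fun i => LinearMap.ext fun α => ?_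
  change ((rogersInclusion m ω₀ (rogersOf m ω₀ i α)) (n, 0) : FormField E M) =
    (rogersOf m ω₀ i α n : FormField E M)
  rw [rogersInclusion_of]
  rcases eq_or_ne i n with rfl | hi
  · have h1 := DirectSum.component.lof_self (M := fun q => xiPiece m ω₀ q) ℝ (i, 0)
      (Submodule.inclusion (rogersPiece_eq m ω₀ i).le α)
    have h2 := DirectSum.component.lof_self (M := fun n => rogersPiece m ω₀ n) ℝ i α
    exact (congrArg Subtype.val h1).trans (congrArg Subtype.val h2).symm
  · have h1 := (DirectSum.component.of (R := ℝ) (M := fun q => xiPiece m ω₀ q) (n, 0) (i, 0)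
      (Submodule.inclusion (rogersPiece_eq m ω₀ i).le α)).trans (dif_neg (by simp [hi]))
    have h2 := (DirectSum.component.of (R := ℝ) (M := fun n => rogersPiece m ω₀ n) n i α).trans
      (dif_neg hi)
    exact (congrArg Subtype.val h1).trans (congrArg Subtype.val h2).symm

theorem rogersInclusion_injective : Function.Injective (rogersInclusion m ω₀) := by
  intro v w h
  refine DFinsupp.ext fun n => Subtype.ext ?_
  have h1 := coe_rogersInclusion_apply v n
  rw [h, coe_rogersInclusion_apply w n] at h1
  exact h1.symm

variable (m ω₀) in
theorem rogersGrading_eq (k : ℤ) : rogersGrading m ω₀ k =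
    degreeGrading (A := fun n => rogersPiece m ω₀ n) (fun n => (n : ℤ)) k :=
  rfl

theorem mem_rogersGrading_iff (k : ℤ) (v : Rogers m ω₀) :
    v ∈ rogersGrading m ω₀ k ↔ rogersInclusion m ω₀ v ∈ xiGrading m ω₀ k := by
  constructor
  · intro hv
    suffices h : rogersGrading m ω₀ k ≤ (xiGrading m ω₀ k).comap (rogersInclusion m ω₀) from h hv
    refine iSup₂_le fun n hn => ?_
    rintro _ ⟨α, rfl⟩
    rw [Submodule.mem_comap]
    have h1 := rogersInclusion_of α
    exact h1 ▸ xiOf_mem_xiGrading (by simpa using hn) _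
  · intro hv
    rw [xiGrading_eq] at hv
    rw [rogersGrading_eq]
    refine (mem_degreeGrading_iff _).2 fun n hn => Subtype.ext ?_
    have h1 := (mem_degreeGrading_iff _).1 hv (n, 0) (by simpa using hn)
    exact (coe_rogersInclusion_apply v n).symm.trans (congrArg Subtype.val h1)

/-- On homogeneous elements both families obey the same formulas. With injectivity of the inclusion
this also yields uniqueness of Rogers' brackets. -/
theorem IsRogersBrackets.map_rogersInclusion {l : Brackets (Xi m ω₀)} (hl : IsXiBrackets m ω₀ l)
    {r : Brackets (Rogers m ω₀)} (hr : IsRogersBrackets m ω₀ r) (n : ℕ)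
    (v : Fin (n + 1) → Rogers m ω₀) :
    l n (fun a => rogersInclusion m ω₀ (v a)) = rogersInclusion m ω₀ (r n v) := by
  have h1 : ∀ (i : ℕ) (α : rogersPiece m ω₀ i),
      (l 0 fun _ => rogersInclusion m ω₀ (rogersOf m ω₀ i α)) =
        rogersInclusion m ω₀ (r 0 fun _ => rogersOf m ω₀ i α) := by
    intro i α
    rcases Nat.lt_trichotomy i 1 with hi | rfl | hi
    · have hz : rogersOf m ω₀ i α = 0 := rogersInclusion_injective (by
        rw [rogersInclusion_of, xiOf_eq_zero (by omega), map_zero])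
      rw [hz, map_zero, multilinearMap_zero_apply, multilinearMap_zero_apply, map_zero]
    · rw [rogersInclusion_of, hl.differential_column_one, hr.differential_degree_one, map_zero]
    · obtain ⟨β, hβ, h⟩ := hl.differential i 0 hi (Submodule.inclusion (rogersPiece_eq m ω₀ i).le α)
      obtain ⟨β', hβ', h'⟩ := hr.differential i hi α
      rw [rogersInclusion_of, h, h', rogersInclusion_of_eq_xiMk, ← xiMk_coe, hβ, hβ']
      rfl
  suffices h : (l n).compLinearMap (fun _ => rogersInclusion m ω₀) =
      (rogersInclusion m ω₀).compMultilinearMap (r n) from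
    congrArg (fun f : MultilinearMap ℝ (fun _ : Fin (n + 1) => Rogers m ω₀) (Xi m ω₀) => f v) h
  refine multilinearMap_directSum_ext (A := fun n => rogersPiece m ω₀ n) fun i α => ?_
  change l n (fun a => rogersInclusion m ω₀ (rogersOf m ω₀ (i a) (α a))) =
    rogersInclusion m ω₀ (r n fun a => rogersOf m ω₀ (i a) (α a))
  rcases Nat.eq_zero_or_pos n with rfl | hn
  · rw [fin_one_eq_const fun a => rogersOf m ω₀ (i a) (α a),
      fin_one_eq_const fun a => rogersInclusion m ω₀ (rogersOf m ω₀ (i a) (α a))]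
    exact h1 _ _
  simp only [rogersInclusion_of]
  by_cases hi : ∃ a, i a ≠ 1
  · rw [hr.higher_zero n hn i α hi, map_zero]
    exact hl.higher_zero n hn i (fun _ => 0) _ hi
  push Not at hi
  obtain rfl : i = fun _ => 1 := funext hi
  by_cases hm : 1 ≤ m
  · choose x hx using fun a => exists_isHamiltonianPair (j := 0) hm
      (Submodule.inclusion (rogersPiece_eq m ω₀ 1).le (α a))
    obtain ⟨β, hβ, h⟩ := hl.higher n hn (fun _ => 0) _ x hx
    obtain ⟨β', hβ', h'⟩ := hr.higher n hn α x hx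
    rw [h', rogersInclusion_of_eq_xiMk, hβ']
    refine h.trans ?_
    rw [← xiMk_coe, hβ, Finset.sum_const_zero]
  -- For `m = 0` there are no hamiltonian pairs with a vector field, but the degree one piece is
  -- zero as well.
  · have hz : ∀ a, xiOf m ω₀ 1 0 (Submodule.inclusion (rogersPiece_eq m ω₀ 1).le (α a)) = 0 :=
      fun a => xiOf_eq_zero (by omega) _
    have hz' : rogersOf m ω₀ 1 (α 0) = 0 := rogersInclusion_injective (by
      rw [rogersInclusion_of, hz, map_zero])
    rw [MultilinearMap.map_coord_zero (r n) 0 hz', map_zero]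
    exact MultilinearMap.map_coord_zero (l n) 0 (hz 0)

/-- The bottom row is closed under the brackets of `Ξ(M)`, so they can be restricted to it and
brought back by a linear left inverse of the inclusion. -/
theorem IsXiBrackets.exists_isRogersBrackets {l : Brackets (Xi m ω₀)}
    (hl : IsXiBrackets m ω₀ l) : ∃ r : Brackets (Rogers m ω₀), IsRogersBrackets m ω₀ r := by
  obtain ⟨G, hG⟩ := exists_linear_pseudoinverse (rogersInclusion m ω₀)
  have hGF : ∀ v, G (rogersInclusion m ω₀ v) = v := fun v => rogersInclusion_injective (hG v)
  -- The row of a higher bracket appears as a sum of zeros, hence a variable `j` with `j = 0`.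
  have key : ∀ (n j : ℕ) (_ : j = 0) (β : xiPiece m ω₀ (n, j)),
      ∃ γ : rogersPiece m ω₀ n, (γ : FormField E M) = β ∧
        G (xiOf m ω₀ n j β) = rogersOf m ω₀ n γ := by
    rintro n j rfl β
    refine ⟨Submodule.inclusion (rogersPiece_eq m ω₀ n).ge β, rfl, ?_⟩
    rw [← hGF (rogersOf m ω₀ n _), rogersInclusion_of]
    rfl
  refine ⟨fun n => G.compMultilinearMap ((l n).compLinearMap fun _ => rogersInclusion m ω₀),
    ?_, ?_, ?_, ?_⟩
  · intro i hi α
    obtain ⟨β, hβ, h⟩ := hl.differential i 0 hi (Submodule.inclusion (rogersPiece_eq m ω₀ i).le α)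
    obtain ⟨γ, hγ, h'⟩ := key (i - 1) 0 rfl β
    refine ⟨γ, hγ.trans hβ, ?_⟩
    change G (l 0 fun _ => rogersInclusion m ω₀ (rogersOf m ω₀ i α)) = _
    rw [rogersInclusion_of, h, h']
  · intro α
    change G (l 0 fun _ => rogersInclusion m ω₀ (rogersOf m ω₀ 1 α)) = _
    rw [rogersInclusion_of, hl.differential_column_one, map_zero]
  · intro n hn α x hx
    obtain ⟨β, hβ, h⟩ := hl.higher n hn (fun _ => 0)
      (fun a => Submodule.inclusion (rogersPiece_eq m ω₀ 1).le (α a)) x hx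
    obtain ⟨γ, hγ, h'⟩ := key n _ Finset.sum_const_zero β
    refine ⟨γ, hγ.trans hβ, ?_⟩
    change G (l n fun a => rogersInclusion m ω₀ (rogersOf m ω₀ 1 (α a))) = _
    simp only [rogersInclusion_of]
    rw [h, h']
  · intro n hn i α hi
    change G (l n fun a => rogersInclusion m ω₀ (rogersOf m ω₀ (i a) (α a))) = _
    simp only [rogersInclusion_of]
    rw [hl.higher_zero n hn i (fun _ => 0) _ hi, map_zero]

theorem IsRogersBrackets.unique {l : Brackets (Xi m ω₀)} (hl : IsXiBrackets m ω₀ l)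
    {r r' : Brackets (Rogers m ω₀)} (hr : IsRogersBrackets m ω₀ r)
    (hr' : IsRogersBrackets m ω₀ r') : r = r' := by
  funext n
  refine MultilinearMap.ext fun v => rogersInclusion_injective ?_
  rw [← hr.map_rogersInclusion hl, ← hr'.map_rogersInclusion hl]

theorem isInternal_rogersGrading : DirectSum.IsInternal (rogersGrading m ω₀) := by
  rw [funext (rogersGrading_eq m ω₀)]
  exact isInternal_degreeGrading (A := fun n => rogersPiece m ω₀ n) _

end Rogers

end MultiSymp

end

/-! ### The theorem -/

theorem theorem3p2
    {E : Type*} [NormedAddCommGroup E] [NormedSpace ℝ E] [FiniteDimensional ℝ E]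
    {M : Type*} [TopologicalSpace M] [T2Space M] [SecondCountableTopology M]
    [ChartedSpace E M] [IsManifold 𝓘(ℝ, E) ∞ M]
    (m : ℕ) (ω₀ : MultiSymp.FormField E M) (hom : MultiSymp.IsPreSymplectic m ω₀) :
    (∃! l : MultiSymp.Brackets (MultiSymp.Xi m ω₀), MultiSymp.IsXiBrackets m ω₀ l) ∧
    (∃! r : MultiSymp.Brackets (MultiSymp.Rogers m ω₀), MultiSymp.IsRogersBrackets m ω₀ r) ∧
    ∀ (l : MultiSymp.Brackets (MultiSymp.Xi m ω₀))
      (r : MultiSymp.Brackets (MultiSymp.Rogers m ω₀)),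
      MultiSymp.IsXiBrackets m ω₀ l → MultiSymp.IsRogersBrackets m ω₀ r →
      MultiSymp.IsLInfinityAlgebra (MultiSymp.xiGrading m ω₀) l ∧
      MultiSymp.IsLInfinityAlgebra (MultiSymp.rogersGrading m ω₀) r ∧
      MultiSymp.IsLInfinitySubalgebra (MultiSymp.rogersGrading m ω₀) r
        (MultiSymp.xiGrading m ω₀) l (MultiSymp.rogersInclusion m ω₀) := by
  have hl₀ := MultiSymp.xiBrackets_isXiBrackets hom
  obtain ⟨r₀, hr₀⟩ := hl₀.exists_isRogersBrackets
  refine ⟨⟨_, hl₀, fun l hl => hl.unique hl₀⟩, ⟨r₀, hr₀, fun r hr => hr.unique hl₀ hr₀⟩,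
    fun l r hl hr => ?_⟩
  -- By uniqueness, `l` is the constructed family.
  obtain rfl := hl.unique hl₀
  have hL := MultiSymp.xiBrackets_isLInfinityAlgebra hom
  refine ⟨hL, hL.of_injective MultiSymp.rogersInclusion_injective
    MultiSymp.mem_rogersGrading_iff (hr.map_rogersInclusion hl)
    MultiSymp.isInternal_rogersGrading, MultiSymp.rogersInclusion_injective,
    fun k v hv => (MultiSymp.mem_rogersGrading_iff k v).1 hv, hr.map_rogersInclusion hl⟩
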